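/- **Setting.** Let $G$ be a (Hausdorff) locally compact group with a left Haar measure $dg$, let $B$ be a $G$-$C^*$-algebra (a $C^*$-algebra with a strongly continuous action $\beta$ of $G$), and let $\mathcal E$ be a Hilbert $B,G$-module, that is, a right Hilbert $B$-module with a strongly continuous action $\gamma$ of $G$ by linear maps with $\gamma_g(\xi b)=\gamma_g(\xi)\beta_g(b)$ and $\langle\gamma_g\xi,\gamma_g\eta\rangle=\beta_g\langle\xi,\eta\rangle$. Let $L^2(G,B)$ be the completion of $C_c(G,B)$ for the norm $\|\int_G f(g)^*f(g)\,dg\|^{1/2}$. For $K\in C_c(G,B)$ let $\rho_K$ be the bounded operator on $L^2(G,B)$ with $(\rho_Kf)(g)=\int_G\beta_g(K(g^{-1}h))f(h)\,dh$ for $f\in C_c(G,B)$; the reduced crossed product $C^*_r(G,B)$ is the norm closure of $\{\rho_K : K\in C_c(G,B)\}$. A continuous function $f\colon G\to B$ belongs to $L^2(G,B)$ if $\chi f$ converges in $L^2(G,B)$ as $\chi$ runs through the compactly supported continuous functions $G\to[0,1]$ converging to $1$ uniformly on compact subsets; $f$ is then identified with the limit. An element $\xi\in\mathcal E$ is square-integrable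 if $\langle\langle\xi|\eta:=(g\mapsto\langle\gamma_g\xi,\eta\rangle)$ belongs to $L^2(G,B)$ for all $\eta\in\mathcal E$. Let $\mathcal E_{si}$ be the space of square-integrable elements. For $\xi\in\mathcal E_{si}$, the operator $|\xi\rangle\rangle f=\int_G\gamma_g(\xi)f(g)\,dg$ extends from $C_c(G,B)$ to a bounded operator $L^2(G,B)\to\mathcal E$; put $\|\xi\|_{si}=\|\xi\|+\||\xi\rangle\rangle\|$ and $\langle\langle\xi|\eta\rangle\rangle=\langle\langle\xi|\circ|\eta\rangle\rangle$. For $K\in C_c(G,B)$ let $\xi*K=\int_G\gamma_g(\xi\cdot K(g^{-1}))\,dg$. A subset $R\subseteq\mathcal E$ is *relatively continuous* if $R\subseteq\mathcal E_{si}$ and $\langle\langle\xi|\eta\rangle\rangle\in C^*_r(G,B)$ for all $\xi,\eta\in R$. It is *complete* if it is a linear subspace of $\mathcal E_{si}$ that is closed for $\|\cdot\|_{si}$ and satisfies $R*C_c(G,B)\subseteq R$. The *completion* of a subset of $\mathcal E_{si}$ is the smallest complete subspace containing it. Let $S(\mathcal E)$ be the set of all dense, complete, relatively continuous subspaces of $\mathcal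 E$. Let $\mathbb K(\mathcal E)$ be the $G$-$C^*$-algebra of compact operators on $\mathcal E$, that is, the closed linear span of the operators $|\xi\rangle\langle\eta|\colon\zeta\mapsto\xi\langle\eta,\zeta\rangle$, with the action $T\mapsto\gamma_gT\gamma_g^{-1}$, and let $S\mathbb K(\mathcal E)$ be the corresponding set for $\mathbb K(\mathcal E)$, viewed as a Hilbert module over itself. For $R\in S(\mathcal E)$ let $i(R)$ be the completion in $\mathbb K(\mathcal E)$ of the linear span of $\{|\xi\rangle\langle\eta| : \xi\in R,\ \eta\in\mathcal E\}$; for $R\in S\mathbb K(\mathcal E)$ let $j(R)$ be the completion in $\mathcal E$ of the linear span of $\{T\eta : T\in R,\ \eta\in\mathcal E\}$. The group $G$ is *exact* if $C^*_r(G,I)=\ker\bigl(C^*_r(G,B)\to C^*_r(G,B/I)\bigr)$ for each $G$-$C^*$-algebra $B$ and each invariant closed ideal $I\subseteq B$, where $C^*_r(G,I)$ is viewed as an ideal of $C^*_r(G,B)$. **Theorem.** For all $G$, $B$ and $\mathcal E$ as above, $i$ and $j$ are well-defined maps $i\colon S(\mathcal E)\to S\mathbb K(\mathcal E)$ and $j\colon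 S\mathbb K(\mathcal E)\to S(\mathcal E)$; the composition $i\circ j$ is the identity map on $S\mathbb K(\mathcal E)$, and $j\circ i(R)\subseteq R$ for all $R\in S(\mathcal E)$. If $G$ is exact, then $j\circ i$ is the identity map on $S(\mathcal E)$ for all $B$ and $\mathcal E$. Conversely, if $G$ is not exact, then there are a $G$-$C^*$-algebra $B$ and a Hilbert $B,G$-module $\mathcal E$ for which $j\circ i$ is not the identity map on $S(\mathcal E)$. -/

import Mathlib

open MeasureTheory Filter Topology
open scoped CompactlySupported RightActions

universe u

namespace SquareIntegrable

/-- The Cauchy-Schwarz inequality for `B`-valued semi-inner products. -/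
theorem cauchy_schwarz {B X : Type*} [NonUnitalCStarAlgebra B] [AddCommGroup X]
    (act : X → B → X) (ip : X → X → B)
    (hadd : ∀ x y z, ip x (y + z) = ip x y + ip x z)
    (hact : ∀ x y b, ip x (act y b) = ip x y * b)
    (hstar : ∀ x y, star (ip x y) = ip y x)
    (hpos : ∀ x, ∃ b, ip x x = star b * b) (x y : X) :
    ‖ip x y‖ ^ 2 ≤ ‖ip x x‖ * ‖ip y y‖ := by
  let _ := CStarAlgebra.spectralOrder B
  have _ := CStarAlgebra.spectralOrderedRing B
  have hpos' : ∀ x, 0 ≤ ip x x := fun x => by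
    obtain ⟨b, hb⟩ := hpos x
    rw [hb]; exact star_mul_self_nonneg b
  have hneg : ∀ x y, ip x (-y) = -ip x y := fun x y => by
    have h0 : ip x 0 = 0 := by simpa using hadd x 0 0
    have := hadd x y (-y)
    rw [add_neg_cancel, h0] at this
    exact (neg_eq_of_add_eq_zero_right this.symm).symm
  have haddl : ∀ x y z, ip (x + y) z = ip x z + ip y z := fun x y z => by
    rw [← hstar, hadd, star_add, hstar, hstar]
  have hnegl : ∀ x z, ip (-x) z = -ip x z := fun x z => by
    rw [← hstar, hneg, star_neg, hstar]
  have hactl : ∀ x y b, ip (act x b) y = star b * ip x y := fun x y b => by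
    rw [← hstar, hact, star_mul, hstar]
  set c := ip x y with hc
  have key : ∀ M : ℝ, 0 < M → ‖ip x x‖ ≤ M → ‖c‖ ^ 2 ≤ M * ‖ip y y‖ := by
    intro M hM hxM
    set t : ℝ := M⁻¹ with ht
    have htp : 0 < t := inv_pos.2 hM
    set a : B := t • c with ha
    have h1 := hpos' (act x a + -y)
    have h2 : ip (act x a + -y) (act x a + -y)
        = star a * ip x x * a - (2 * t) • (star c * c) + ip y y := by
      have hyx : ip y x = star c := by rw [hc, hstar]
      simp only [hadd, haddl, hneg, hnegl, hact, hactl, ← hc, hyx]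
      simp only [ha, star_smul, smul_mul_assoc, mul_smul_comm, star_trivial, two_mul, add_smul,
        mul_assoc]
      abel
    have h3 : star a * ip x x * a ≤ t • (star c * c) := by
      refine (CStarAlgebra.star_left_conjugate_le_norm_smul
        (hb := IsSelfAdjoint.of_nonneg (hpos' x))).trans ?_
      have : star a * a = (t * t) • (star c * c) := by
        simp [ha, smul_mul_assoc, mul_smul_comm, smul_smul]
      rw [this, smul_smul]
      refine smul_le_smul_of_nonneg_right ?_ (star_mul_self_nonneg c)
      calc ‖ip x x‖ * (t * t) ≤ M * (t * t) := by gcongr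
        _ = t := by rw [ht]; field_simp
    have h4 : t • (star c * c) ≤ ip y y := by
      rw [h2] at h1
      have h5 : (0 : B) ≤ t • (star c * c) - (2 * t) • (star c * c) + ip y y :=
        h1.trans (by gcongr)
      have h6 : t • (star c * c) - (2 * t) • (star c * c) + ip y y
          = ip y y - t • (star c * c) := by
        rw [two_mul, add_smul]; abel
      rw [h6] at h5
      exact sub_nonneg.1 h5
    have h7 := CStarAlgebra.norm_le_norm_of_nonneg_of_le
      (smul_nonneg htp.le (star_mul_self_nonneg c)) h4
    rw [norm_smul, CStarRing.norm_star_mul_self, Real.norm_of_nonneg htp.le, ht,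
      inv_mul_le_iff₀ hM] at h7
    rw [pow_two]; exact h7
  have hlim : Tendsto (fun ε : ℝ => (‖ip x x‖ + ε) * ‖ip y y‖) (𝓝[>] 0)
      (𝓝 (‖ip x x‖ * ‖ip y y‖)) := by
    have : Continuous fun ε : ℝ => (‖ip x x‖ + ε) * ‖ip y y‖ := by fun_prop
    simpa using (this.tendsto 0).mono_left nhdsWithin_le_nhds
  refine ge_of_tendsto hlim ?_
  filter_upwards [self_mem_nhdsWithin] with ε hε
  exact key _ (add_pos_of_nonneg_of_pos (norm_nonneg _) hε) (by linarith [Set.mem_Ioi.1 hε])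

/-- A (right) Hilbert module over a C⋆-algebra `B`; `x <• b` is the right action of `b` on `x`. The
norm of `E` is `‖⟨x, x⟩‖^{1/2}`; completeness of `E` is assumed separately. The remaining laws of
a right `B`-module follow from those listed, because `⟨z, x⟩ = ⟨z, y⟩` for all `z` gives `x = y`.
Positivity of `⟨x, x⟩` is stated as `⟨x, x⟩ = b⋆ b`. -/
class HilbertModule (B E : Type*) [NonUnitalCStarAlgebra B] [NormedAddCommGroup E]
    [NormedSpace ℂ E] [SMul Bᵐᵒᵖ E] extends Inner B E where
  inner_add_right : ∀ x y z : E, inner x (y + z) = inner x y + inner x z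
  inner_smul_right : ∀ (c : ℂ) (x y : E), inner x (c • y) = c • inner x y
  inner_act_right : ∀ (x y : E) (b : B), inner x (y <• b) = inner x y * b
  star_inner : ∀ x y : E, star (inner x y) = inner y x
  inner_self_nonneg : ∀ x : E, ∃ b : B, inner x x = star b * b
  norm_sq_eq : ∀ x : E, ‖x‖ ^ 2 = ‖inner x x‖

/-- A strongly continuous action of `G` on a C⋆-algebra `B`, so that `B` is a `G`-C⋆-algebra. -/
class CStarAction (G B : Type*) [Group G] [TopologicalSpace G] [NonUnitalCStarAlgebra B] where
  act : G →* (B →⋆ₙₐ[ℂ] B)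
  continuous_act : ∀ b : B, Continuous fun g => act g b

/-- A strongly continuous action of `G` on a Hilbert `B`-module that is compatible with the action
on `B`, so that `E` is a Hilbert `B,G`-module. -/
class HilbertAction (G B E : Type*) [Group G] [TopologicalSpace G] [NonUnitalCStarAlgebra B]
    [CStarAction G B] [NormedAddCommGroup E] [NormedSpace ℂ E] [SMul Bᵐᵒᵖ E]
    [HilbertModule B E] where
  act : Representation ℂ G E
  act_smul : ∀ (g : G) (x : E) (b : B),
    act g (x <• b) = act g x <• CStarAction.act g b
  inner_act : ∀ (g : G) (x y : E),
    inner B (act g x) (act g y) = CStarAction.act g (inner B x y)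
  continuous_act : ∀ x : E, Continuous fun g => act g x


section Basic

variable {B E : Type*} [NonUnitalCStarAlgebra B] [NormedAddCommGroup E] [NormedSpace ℂ E]
  [SMul Bᵐᵒᵖ E] [HilbertModule B E]

theorem norm_inner_le (x y : E) : ‖inner B x y‖ ≤ ‖x‖ * ‖y‖ := by
  have h := cauchy_schwarz (fun (x : E) (b : B) => x <• b) (inner B)
    HilbertModule.inner_add_right HilbertModule.inner_act_right HilbertModule.star_inner
    HilbertModule.inner_self_nonneg x y
  rw [← HilbertModule.norm_sq_eq, ← HilbertModule.norm_sq_eq, ← mul_pow] at h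
  exact le_of_sq_le_sq h (by positivity)

theorem inner_add_left (x y z : E) : inner B (x + y) z = inner B x z + inner B y z := by
  rw [← HilbertModule.star_inner, HilbertModule.inner_add_right, star_add,
    HilbertModule.star_inner, HilbertModule.star_inner]

theorem inner_smul_left (c : ℂ) (x y : E) : inner B (c • x) y = star c • inner B x y := by
  rw [← HilbertModule.star_inner, HilbertModule.inner_smul_right, star_smul,
    HilbertModule.star_inner]

theorem inner_act_left (x y : E) (b : B) : inner B (x <• b) y = star b * inner B x y := by
  rw [← HilbertModule.star_inner, HilbertModule.inner_act_right, star_mul,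
    HilbertModule.star_inner]

/-- The inner product as a real-bilinear continuous map. -/
noncomputable def innerL (B E : Type*) [NonUnitalCStarAlgebra B] [NormedAddCommGroup E]
    [NormedSpace ℂ E] [SMul Bᵐᵒᵖ E] [HilbertModule B E] : E →L[ℝ] E →L[ℝ] B :=
  LinearMap.mkContinuous₂
    (LinearMap.mk₂ ℝ (inner B) inner_add_left
      (fun c x y => by
        have := inner_smul_left (B := B) (c : ℂ) x y
        simpa using this)
      HilbertModule.inner_add_right
      (fun c x y => by
        have := HilbertModule.inner_smul_right (B := B) (c : ℂ) x y
        simpa using this)) 1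
    (fun x y => by simpa using norm_inner_le x y)

@[simp] theorem innerL_apply (x y : E) : innerL B E x y = inner B x y := rfl

theorem ext_inner {x y : E} (h : ∀ z, inner B z x = inner B z y) : x = y := by
  have h0 : inner B (x - y) (x - y) = 0 := by
    have := (innerL B E (x - y)).map_sub x y
    simp only [innerL_apply] at this
    rw [this, h, sub_self]
  have h1 := HilbertModule.norm_sq_eq (B := B) (x - y)
  rw [h0, norm_zero] at h1
  exact sub_eq_zero.1 (norm_eq_zero.1 (pow_eq_zero_iff two_ne_zero |>.1 h1))

theorem norm_act_le (x : E) (b : B) : ‖x <• b‖ ≤ ‖x‖ * ‖b‖ := by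
  refine le_of_sq_le_sq (α := ℝ) ?_ (by positivity)
  rw [HilbertModule.norm_sq_eq (B := B), HilbertModule.inner_act_right, inner_act_left]
  calc ‖star b * inner B x x * b‖ ≤ ‖star b‖ * ‖inner B x x‖ * ‖b‖ := norm_mul₃_le
    _ = (‖x‖ * ‖b‖) ^ 2 := by rw [norm_star, ← HilbertModule.norm_sq_eq]; ring

/-- The right module structure as a bilinear continuous map. -/
noncomputable def actL (B E : Type*) [NonUnitalCStarAlgebra B] [NormedAddCommGroup E]
    [NormedSpace ℂ E] [SMul Bᵐᵒᵖ E] [HilbertModule B E] : E →L[ℂ] B →L[ℂ] E :=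
  LinearMap.mkContinuous₂
    (LinearMap.mk₂ ℂ (fun (x : E) (b : B) => x <• b)
      (fun x y b => ext_inner (B := B) fun z => by
        simp [HilbertModule.inner_act_right, HilbertModule.inner_add_right, add_mul])
      (fun c x b => ext_inner (B := B) fun z => by
        simp only [HilbertModule.inner_act_right, HilbertModule.inner_smul_right,
          smul_mul_assoc])
      (fun x b b' => ext_inner (B := B) fun z => by
        simp only [HilbertModule.inner_act_right, HilbertModule.inner_add_right, mul_add])
      (fun c x b => ext_inner (B := B) fun z => by
        simp only [HilbertModule.inner_act_right, HilbertModule.inner_smul_right,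
          mul_smul_comm])) 1
    (fun x b => by simpa using norm_act_le x b)

@[simp] theorem actL_apply (x : E) (b : B) : actL B E x b = x <• b := rfl

/-- A C⋆-algebra is a Hilbert module over itself, with `⟨a, b⟩ = a⋆ b`. -/
instance selfHilbertModule (B : Type*) [NonUnitalCStarAlgebra B] : HilbertModule B B where
  inner a b := star a * b
  inner_add_right a b c := mul_add _ _ _
  inner_smul_right c a b := mul_smul_comm _ _ _
  inner_act_right a b c := (mul_assoc _ _ _).symm
  star_inner a b := by simp
  inner_self_nonneg a := ⟨a, rfl⟩
  norm_sq_eq a := by rw [CStarRing.norm_star_mul_self, pow_two]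

/-- A `G`-C⋆-algebra as a `G`-equivariant Hilbert module over itself. -/
instance selfHilbertAction (G B : Type*) [Group G] [TopologicalSpace G]
    [NonUnitalCStarAlgebra B] [CStarAction G B] : HilbertAction G B B where
  act :=
    { toFun := fun g =>
        { toFun := fun b => CStarAction.act g b
          map_add' := fun a b => map_add _ a b
          map_smul' := fun c a => map_smul _ c a }
      map_one' := by ext b; simp
      map_mul' := fun g h => by ext b; simp; rfl }
  act_smul g x b := map_mul (CStarAction.act g) x b
  inner_act g x y := by
    change star (CStarAction.act g x) * CStarAction.act g y = CStarAction.act g (star x * y)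
    rw [map_mul, map_star]
  continuous_act := CStarAction.continuous_act

end Basic

section Compact

variable (B : Type*) {E : Type*} [NonUnitalCStarAlgebra B] [NormedAddCommGroup E]
  [NormedSpace ℂ E] [SMul Bᵐᵒᵖ E] [HilbertModule B E]

/-- `S` is an adjoint of `T`. -/
def IsAdjoint (T S : E →L[ℂ] E) : Prop := ∀ x y : E, inner B (T x) y = inner B x (S y)

/-- The rank-one operator `|ξ⟩⟨η| : ζ ↦ ξ ⟨η, ζ⟩`. -/
noncomputable def rankOne (ξ η : E) : E →L[ℂ] E :=
  LinearMap.mkContinuous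
    { toFun := fun ζ => ξ <• (inner B η ζ : B)
      map_add' := fun x y => by
        rw [HilbertModule.inner_add_right]; exact (actL B E ξ).map_add _ _
      map_smul' := fun c x => by
        rw [HilbertModule.inner_smul_right]; exact (actL B E ξ).map_smul _ _ }
    (‖ξ‖ * ‖η‖)
    (fun ζ => (norm_act_le _ _).trans (by
      rw [mul_assoc]
      exact mul_le_mul_of_nonneg_left (norm_inner_le _ _) (norm_nonneg _)))

variable {B}

@[simp] theorem rankOne_apply (ξ η ζ : E) : rankOne B ξ η ζ = ξ <• (inner B η ζ : B) := rfl

theorem IsAdjoint.symm {T S : E →L[ℂ] E} (h : IsAdjoint B T S) : IsAdjoint B S T := fun x y => by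
  rw [← HilbertModule.star_inner, ← h, HilbertModule.star_inner]

theorem IsAdjoint.unique {T S S' : E →L[ℂ] E} (h : IsAdjoint B T S) (h' : IsAdjoint B T S') :
    S = S' := by
  ext y
  exact ext_inner (B := B) fun z => by rw [← h, h']

theorem IsAdjoint.add {T S T' S' : E →L[ℂ] E} (h : IsAdjoint B T S) (h' : IsAdjoint B T' S') :
    IsAdjoint B (T + T') (S + S') := fun x y => by
  simp [inner_add_left, HilbertModule.inner_add_right, h x y, h' x y]

theorem IsAdjoint.smul {T S : E →L[ℂ] E} (c : ℂ) (h : IsAdjoint B T S) :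
    IsAdjoint B (c • T) (star c • S) := fun x y => by
  simp [inner_smul_left, HilbertModule.inner_smul_right, h x y]

theorem IsAdjoint.mul {T S T' S' : E →L[ℂ] E} (h : IsAdjoint B T S) (h' : IsAdjoint B T' S') :
    IsAdjoint B (T * T') (S' * S) := fun x y => by
  simp [h _ y, h' x _]

theorem isAdjoint_zero : IsAdjoint B (0 : E →L[ℂ] E) 0 := fun x y => by
  have h1 := inner_smul_left (B := B) 0 x y
  have h2 := HilbertModule.inner_smul_right (B := B) 0 x y
  simp_all

theorem isAdjoint_rankOne (ξ η : E) : IsAdjoint B (rankOne B ξ η) (rankOne B η ξ) := fun x y => by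
  simp [inner_act_left, HilbertModule.inner_act_right, HilbertModule.star_inner]

theorem IsAdjoint.norm_le {T S : E →L[ℂ] E} (h : IsAdjoint B T S) : ‖S‖ ≤ ‖T‖ := by
  refine S.opNorm_le_bound (norm_nonneg _) fun y => ?_
  rcases (norm_nonneg (S y)).eq_or_lt with h0 | h0
  · rw [← h0]; positivity
  · have h1 : ‖S y‖ ^ 2 ≤ ‖S y‖ * (‖T‖ * ‖y‖) := by
      rw [HilbertModule.norm_sq_eq (B := B), ← h]
      calc _ ≤ ‖T (S y)‖ * ‖y‖ := norm_inner_le _ _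
        _ ≤ ‖T‖ * ‖S y‖ * ‖y‖ := by gcongr; exact T.le_opNorm _
        _ = _ := by ring
    rw [pow_two] at h1
    exact le_of_mul_le_mul_left h1 h0

theorem mul_rankOne {T S : E →L[ℂ] E} (h : IsAdjoint B T S) (ξ η : E) :
    T * rankOne B ξ η = rankOne B (T ξ) η := by
  ext ζ
  refine ext_inner (B := B) fun z => ?_
  simp [← h.symm z, HilbertModule.inner_act_right]

variable (B E)

/-- The algebra of finite rank operators, that is, the linear span of the rank-one operators. -/
noncomputable def finiteRank : NonUnitalSubalgebra ℂ (E →L[ℂ] E) where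
  toSubmodule := Submodule.span ℂ (Set.range fun p : E × E => rankOne B p.1 p.2)
  mul_mem' := by
    intro S T hS hT
    induction hS using Submodule.span_induction with
    | zero => rw [zero_mul]; exact Submodule.zero_mem _
    | add x y _ _ hx hy => rw [add_mul]; exact Submodule.add_mem _ hx hy
    | smul c x _ hx => rw [smul_mul_assoc]; exact Submodule.smul_mem _ c hx
    | mem x hx =>
      induction hT using Submodule.span_induction with
      | zero => rw [mul_zero]; exact Submodule.zero_mem _
      | add y z _ _ hy hz => rw [mul_add]; exact Submodule.add_mem _ hy hz
      | smul c y _ hy => rw [mul_smul_comm]; exact Submodule.smul_mem _ c hy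
      | mem y hy =>
        obtain ⟨⟨ξ, η⟩, rfl⟩ := hx
        obtain ⟨⟨ξ', η'⟩, rfl⟩ := hy
        refine Submodule.subset_span ⟨(rankOne B ξ η ξ', η'), ?_⟩
        exact (mul_rankOne (isAdjoint_rankOne ξ η) ξ' η').symm

/-- The algebra `K(E)` of compact operators: the closed linear span of the rank-one operators. -/
noncomputable def compacts : NonUnitalSubalgebra ℂ (E →L[ℂ] E) :=
  (finiteRank B E).topologicalClosure

variable {B E}

theorem exists_adjoint_finiteRank {T : E →L[ℂ] E} (hT : T ∈ finiteRank B E) :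
    ∃ S ∈ finiteRank B E, IsAdjoint B T S := by
  change T ∈ Submodule.span ℂ _ at hT
  induction hT using Submodule.span_induction with
  | zero => exact ⟨0, zero_mem _, isAdjoint_zero⟩
  | add x y _ _ hx hy =>
    obtain ⟨S, hS, h⟩ := hx
    obtain ⟨S', hS', h'⟩ := hy
    exact ⟨S + S', add_mem hS hS', h.add h'⟩
  | smul c x _ hx =>
    obtain ⟨S, hS, h⟩ := hx
    exact ⟨star c • S, SMulMemClass.smul_mem _ hS, h.smul c⟩
  | mem x hx =>
    obtain ⟨⟨ξ, η⟩, rfl⟩ := hx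
    exact ⟨_, Submodule.subset_span ⟨(η, ξ), rfl⟩, isAdjoint_rankOne ξ η⟩

theorem isClosed_adjoint :
    IsClosed {p : (E →L[ℂ] E) × (E →L[ℂ] E) | IsAdjoint B p.1 p.2} := by
  have : {p : (E →L[ℂ] E) × (E →L[ℂ] E) | IsAdjoint B p.1 p.2}
      = ⋂ x : E, ⋂ y : E, {p | innerL B E (p.1 x) y = innerL B E x (p.2 y)} := by
    ext p; simp [IsAdjoint]
  rw [this]
  refine isClosed_iInter fun x => isClosed_iInter fun y => isClosed_eq ?_ ?_
  · fun_prop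
  · fun_prop

theorem exists_adjoint_compacts [CompleteSpace E] {T : E →L[ℂ] E} (hT : T ∈ compacts B E) :
    ∃ S ∈ compacts B E, IsAdjoint B T S := by
  have hT' : T ∈ closure (finiteRank B E : Set (E →L[ℂ] E)) := hT
  obtain ⟨t, ht, hlim⟩ := mem_closure_iff_seq_limit.1 hT'
  choose s hs hadj using fun n => exists_adjoint_finiteRank (ht n)
  have hsub : ∀ n m, IsAdjoint B (t n - t m) (s n - s m) := fun n m => by
    have := (hadj n).add ((hadj m).smul (-1))
    simpa [sub_eq_add_neg] using this
  have hcau : CauchySeq s := by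
    have hc := hlim.cauchySeq
    rw [Metric.cauchySeq_iff] at hc ⊢
    intro ε hε
    obtain ⟨N, hN⟩ := hc ε hε
    refine ⟨N, fun m hm n hn => ?_⟩
    have := hN m hm n hn
    rw [dist_eq_norm] at this ⊢
    exact (hsub m n).norm_le.trans_lt this
  obtain ⟨S, hS⟩ := cauchySeq_tendsto_of_complete hcau
  refine ⟨S, ?_, ?_⟩
  · exact mem_closure_of_tendsto hS (Eventually.of_forall hs)
  · exact isClosed_adjoint.mem_of_tendsto (hlim.prodMk_nhds hS) (Eventually.of_forall hadj)

variable (B E)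

/-- The type of compact operators on the Hilbert module `E`. -/
def CompactOp : Type _ := compacts B E

namespace CompactOp

noncomputable instance : NonUnitalNormedRing (CompactOp B E) :=
  inferInstanceAs (NonUnitalNormedRing (compacts B E))

noncomputable instance : NormedSpace ℂ (CompactOp B E) :=
  inferInstanceAs (NormedSpace ℂ (compacts B E).toSubmodule)

instance : IsScalarTower ℂ (CompactOp B E) (CompactOp B E) :=
  inferInstanceAs (IsScalarTower ℂ (compacts B E) (compacts B E))

instance : SMulCommClass ℂ (CompactOp B E) (CompactOp B E) :=
  inferInstanceAs (SMulCommClass ℂ (compacts B E) (compacts B E))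

instance [CompleteSpace E] : CompleteSpace (CompactOp B E) :=
  IsClosed.completeSpace_coe (s := (compacts B E : Set (E →L[ℂ] E)))
    (hs := NonUnitalSubalgebra.isClosed_topologicalClosure _)

variable {B E}

/-- The bounded operator underlying a compact operator. -/
def op (T : CompactOp B E) : E →L[ℂ] E := T.1

theorem ext {S T : CompactOp B E} (h : S.op = T.op) : S = T := Subtype.ext h

@[simp] theorem op_mul (S T : CompactOp B E) : (S * T).op = S.op * T.op := rfl
@[simp] theorem op_add (S T : CompactOp B E) : (S + T).op = S.op + T.op := rfl
@[simp] theorem op_sub (S T : CompactOp B E) : (S - T).op = S.op - T.op := rfl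
@[simp] theorem op_zero : (0 : CompactOp B E).op = 0 := rfl
@[simp] theorem op_smul (c : ℂ) (T : CompactOp B E) : (c • T).op = c • T.op := rfl
theorem norm_def (T : CompactOp B E) : ‖T‖ = ‖T.op‖ := rfl

variable [CompleteSpace E]

/-- The involution is the adjoint. -/
noncomputable instance : Star (CompactOp B E) where
  star T := ⟨(exists_adjoint_compacts T.2).choose, (exists_adjoint_compacts T.2).choose_spec.1⟩

theorem isAdjoint_star (T : CompactOp B E) : IsAdjoint B T.op (star T).op :=
  (exists_adjoint_compacts T.2).choose_spec.2

theorem star_eq {T S : CompactOp B E} (h : IsAdjoint B T.op S.op) : star T = S :=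
  ext ((isAdjoint_star T).unique h)

noncomputable instance : StarRing (CompactOp B E) where
  star_involutive T := star_eq (isAdjoint_star T).symm
  star_mul S T := star_eq ((isAdjoint_star S).mul (isAdjoint_star T))
  star_add S T := star_eq ((isAdjoint_star S).add (isAdjoint_star T))

noncomputable instance : NonUnitalCStarAlgebra (CompactOp B E) where
  star_smul c T := star_eq ((isAdjoint_star T).smul c)
  norm_mul_self_le T := by
    have key : ∀ x : E, ‖T.op x‖ ≤ √‖star T * T‖ * ‖x‖ := fun x => by
      refine le_of_sq_le_sq (α := ℝ) ?_ (by positivity)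
      rw [HilbertModule.norm_sq_eq (B := B), isAdjoint_star T, mul_pow,
        Real.sq_sqrt (norm_nonneg _)]
      calc _ ≤ ‖x‖ * ‖(star T * T).op x‖ := norm_inner_le _ _
        _ ≤ ‖x‖ * (‖star T * T‖ * ‖x‖) := by gcongr; exact (star T * T).op.le_opNorm x
        _ = _ := by ring
    have h := T.op.opNorm_le_bound (Real.sqrt_nonneg _) key
    rw [norm_def T]
    calc ‖T.op‖ * ‖T.op‖ ≤ √‖star T * T‖ * √‖star T * T‖ := by gcongr
      _ = ‖star T * T‖ := Real.mul_self_sqrt (norm_nonneg _)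

end CompactOp

end Compact

section Action

variable {G : Type*} (B : Type*) {E : Type*} [Group G] [TopologicalSpace G]
  [NonUnitalCStarAlgebra B] [CStarAction G B]
  [NormedAddCommGroup E] [NormedSpace ℂ E] [SMul Bᵐᵒᵖ E] [HilbertModule B E] [HilbertAction G B E]

theorem norm_cstarAct {B : Type*} [NonUnitalCStarAlgebra B] [CStarAction G B] (g : G) (b : B) :
    ‖CStarAction.act g b‖ = ‖b‖ := by
  refine le_antisymm (NonUnitalStarAlgHom.norm_apply_le _ _) ?_
  have h : CStarAction.act g⁻¹ (CStarAction.act g b) = b := by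
    have := congrArg (fun φ : B →⋆ₙₐ[ℂ] B => φ b)
      ((CStarAction.act (G := G) (B := B)).map_mul g⁻¹ g)
    simp only [inv_mul_cancel, map_one] at this
    exact this.symm
  calc ‖b‖ = ‖CStarAction.act g⁻¹ (CStarAction.act g b)‖ := by rw [h]
    _ ≤ _ := NonUnitalStarAlgHom.norm_apply_le _ _

theorem continuous_cstarAct {B : Type*} [NonUnitalCStarAlgebra B] [CStarAction G B]
    {X : Type*} [TopologicalSpace X] {f : X → G} {k : X → B} (hf : Continuous f)
    (hk : Continuous k) : Continuous fun x => CStarAction.act (f x) (k x) := by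
  rw [continuous_iff_continuousAt]
  intro x
  have h1 : Tendsto (fun y => CStarAction.act (f y) (k y - k x)) (𝓝 x) (𝓝 0) := by
    rw [tendsto_zero_iff_norm_tendsto_zero]
    simp only [norm_cstarAct]
    have : Continuous fun y => ‖k y - k x‖ := by fun_prop
    simpa using this.tendsto x
  have h2 : Tendsto (fun y => CStarAction.act (f y) (k x)) (𝓝 x)
      (𝓝 (CStarAction.act (f x) (k x))) :=
    ((CStarAction.continuous_act (k x)).comp hf).tendsto x
  have h3 := h1.add h2
  simp only [map_sub, sub_add_cancel, zero_add] at h3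
  exact h3

theorem norm_hilbertAct (g : G) (x : E) : ‖HilbertAction.act (B := B) g x‖ = ‖x‖ := by
  have h : ‖HilbertAction.act (B := B) g x‖ ^ 2 = ‖x‖ ^ 2 := by
    rw [HilbertModule.norm_sq_eq (B := B), HilbertAction.inner_act, norm_cstarAct,
      HilbertModule.norm_sq_eq (B := B)]
  exact (sq_eq_sq₀ (norm_nonneg _) (norm_nonneg _)).1 h

/-- The operator `γ_g` on a Hilbert module. -/
noncomputable def gact (g : G) : E →L[ℂ] E :=
  LinearMap.mkContinuous (HilbertAction.act (B := B) g) 1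
    (fun x => by rw [norm_hilbertAct, one_mul])

theorem norm_gact (g : G) (x : E) : ‖gact B g x‖ = ‖x‖ := norm_hilbertAct B g x

theorem gact_one : gact B (1 : G) = (1 : E →L[ℂ] E) := by
  ext x
  change HilbertAction.act (B := B) (1 : G) x = x
  rw [map_one]; rfl

theorem gact_mul (g h : G) : gact B (g * h) = (gact B g * gact B h : E →L[ℂ] E) := by
  ext x
  change HilbertAction.act (B := B) (g * h) x = _
  rw [map_mul]; rfl

theorem gact_smul (g : G) (x : E) (b : B) :
    gact B g (x <• b) = gact B g x <• CStarAction.act g b := HilbertAction.act_smul g x b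

theorem inner_gact (g : G) (x y : E) :
    inner B (gact B g x) (gact B g y) = CStarAction.act g (inner B x y) :=
  HilbertAction.inner_act g x y

theorem continuous_gact (x : E) : Continuous fun g : G => gact B g x :=
  HilbertAction.continuous_act x

theorem gact_gact_inv (g : G) (x : E) : gact B g (gact B g⁻¹ x) = x := by
  have := gact_mul B (E := E) g g⁻¹
  rw [mul_inv_cancel, gact_one] at this
  exact (DFunLike.congr_fun this x).symm

theorem gact_inv_gact (g : G) (x : E) : gact B g⁻¹ (gact B g x) = x := by
  simpa using gact_gact_inv B g⁻¹ x

/-- Conjugation `T ↦ γ_g T γ_g⁻¹`. -/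
noncomputable def conj (g : G) (T : E →L[ℂ] E) : E →L[ℂ] E := gact B g * T * gact B g⁻¹

theorem conj_apply (g : G) (T : E →L[ℂ] E) (x : E) :
    conj B g T x = gact B g (T (gact B g⁻¹ x)) := rfl

theorem norm_conj_le (g : G) (T : E →L[ℂ] E) : ‖conj B g T‖ ≤ ‖T‖ :=
  ContinuousLinearMap.opNorm_le_bound _ (norm_nonneg _) fun x => by
    rw [conj_apply, norm_gact]
    exact (T.le_opNorm _).trans (by rw [norm_gact])

theorem IsAdjoint.conj {B : Type*} [NonUnitalCStarAlgebra B] [CStarAction G B] [SMul Bᵐᵒᵖ E]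
    [HilbertModule B E] [HilbertAction G B E] {T S : E →L[ℂ] E} (h : IsAdjoint B T S) (g : G) :
    IsAdjoint B (conj B g T) (conj B g S) := fun x y => by
  have h1 := inner_gact B g (T (gact B g⁻¹ x)) (gact B g⁻¹ y)
  have h2 := inner_gact B g (gact B g⁻¹ x) (S (gact B g⁻¹ y))
  rw [gact_gact_inv] at h1 h2
  rw [conj_apply, conj_apply, h1, h2, h]

theorem conj_rankOne (g : G) (ξ η : E) :
    conj B g (rankOne B ξ η) = rankOne B (gact B g ξ) (gact B g η) := by
  ext ζ
  have h := inner_gact B g η (gact B g⁻¹ ζ)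
  rw [gact_gact_inv] at h
  rw [conj_apply, rankOne_apply, rankOne_apply, gact_smul, h]

theorem conj_mem_compacts (g : G) {T : E →L[ℂ] E} (hT : T ∈ compacts B E) :
    conj B g T ∈ compacts B E := by
  have hT' : T ∈ closure (finiteRank B E : Set (E →L[ℂ] E)) := hT
  have hc : Continuous (conj B g : (E →L[ℂ] E) → (E →L[ℂ] E)) := by
    unfold conj; fun_prop
  refine map_mem_closure hc hT' ?_
  intro S hS
  change S ∈ Submodule.span ℂ _ at hS
  change _ ∈ Submodule.span ℂ _
  induction hS using Submodule.span_induction with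
  | zero => rw [conj, mul_zero, zero_mul]; exact Submodule.zero_mem _
  | add x y _ _ hx hy => rw [conj, mul_add, add_mul]; exact Submodule.add_mem _ hx hy
  | smul c x _ hx =>
    rw [conj, mul_smul_comm, smul_mul_assoc]; exact Submodule.smul_mem _ c hx
  | mem x hx =>
    obtain ⟨⟨ξ, η⟩, rfl⟩ := hx
    rw [conj_rankOne]
    exact Submodule.subset_span ⟨(_, _), rfl⟩

theorem norm_rankOne_le (ξ η : E) : ‖rankOne B ξ η‖ ≤ ‖ξ‖ * ‖η‖ :=
  LinearMap.mkContinuous_norm_le _ (by positivity) _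

theorem continuous_rankOne : Continuous fun p : E × E => rankOne B p.1 p.2 := by
  let L : E →L[ℝ] E →L[ℝ] (E →L[ℂ] E) := LinearMap.mkContinuous₂
    (LinearMap.mk₂ ℝ (rankOne B)
      (fun x y z => by
        ext ζ
        have := (actL B E).map_add x y
        exact DFunLike.congr_fun this (inner B z ζ))
      (fun c x z => by
        ext ζ
        have := (actL B E).map_smul_of_tower c x
        exact DFunLike.congr_fun this (inner B z ζ))
      (fun x y z => by
        ext ζ
        rw [rankOne_apply, inner_add_left]
        exact (actL B E x).map_add _ _)
      (fun c x z => by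
        ext ζ
        have h1 : inner B (c • z) ζ = c • inner B z ζ := by
          simpa using inner_smul_left (B := B) (c : ℂ) z ζ
        rw [rankOne_apply, h1]
        exact (actL B E x).map_smul_of_tower c _)) 1
    (fun x y => by
      rw [one_mul]
      exact norm_rankOne_le B x y)
  exact L.continuous₂

theorem continuous_conj {T : E →L[ℂ] E} (hT : T ∈ compacts B E) :
    Continuous fun g : G => conj B g T := by
  have hspan : ∀ S ∈ finiteRank B E, Continuous fun g : G => conj B g S := by
    intro S hS
    change S ∈ Submodule.span ℂ _ at hS
    induction hS using Submodule.span_induction with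
    | zero => simpa [conj] using continuous_const
    | add x y _ _ hx hy => simp only [conj, mul_add, add_mul]; exact hx.add hy
    | smul c x _ hx => simp only [conj, mul_smul_comm, smul_mul_assoc]; exact hx.const_smul c
    | mem x hx =>
      obtain ⟨⟨ξ, η⟩, rfl⟩ := hx
      simp only [conj_rankOne]
      exact (continuous_rankOne B).comp ((continuous_gact B ξ).prodMk (continuous_gact B η))
  refine continuous_of_uniform_approx_of_continuous fun u hu => ?_
  obtain ⟨ε, hε, hεu⟩ := Metric.mem_uniformity_dist.1 hu
  have hT' : T ∈ closure (finiteRank B E : Set (E →L[ℂ] E)) := hT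
  obtain ⟨S, hS, hST⟩ := Metric.mem_closure_iff.1 hT' ε hε
  refine ⟨_, hspan S hS, fun g => hεu ?_⟩
  have hsub : conj B g T - conj B g S = conj B g (T - S) := by
    simp only [conj, mul_sub, sub_mul]
  rw [dist_eq_norm, hsub]
  rw [dist_eq_norm] at hST
  exact (norm_conj_le B g _).trans_lt hST

/-- The action `T ↦ γ_g T γ_g⁻¹` of `G` on `K(E)`. -/
noncomputable instance compactAction [CompleteSpace E] : CStarAction G (CompactOp B E) where
  act :=
    { toFun := fun g =>
        { toFun := fun T => ⟨conj B g T.op, conj_mem_compacts B g T.2⟩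
          map_smul' := fun c T => CompactOp.ext (by
            change conj B g (c • T.op) = c • conj B g T.op
            rw [conj, mul_smul_comm, smul_mul_assoc]; rfl)
          map_zero' := CompactOp.ext (by
            change conj B g 0 = 0
            rw [conj, mul_zero, zero_mul])
          map_add' := fun S T => CompactOp.ext (by
            change conj B g (S.op + T.op) = conj B g S.op + conj B g T.op
            rw [conj, mul_add, add_mul]; rfl)
          map_mul' := fun S T => CompactOp.ext (by
            change conj B g (S.op * T.op) = conj B g S.op * conj B g T.op
            ext x
            simp [conj_apply, gact_inv_gact])
          map_star' := fun T => (CompactOp.star_eq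
            (by exact (CompactOp.isAdjoint_star T).conj g)).symm }
      map_one' := by
        ext T
        refine CompactOp.ext ?_
        change conj B 1 T.op = T.op
        rw [conj, inv_one, gact_one, one_mul, mul_one]
      map_mul' := fun g h => by
        ext T
        refine CompactOp.ext ?_
        change conj B (g * h) T.op = conj B g (conj B h T.op)
        rw [conj, conj, conj, mul_inv_rev, gact_mul, gact_mul]
        simp only [mul_assoc] }
  continuous_act T := by
    refine Continuous.subtype_mk (continuous_conj B T.2) _

end Action

section L2

variable {G : Type*} [TopologicalSpace G] [MeasurableSpace G] [BorelSpace G]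
  (μ : Measure G) [IsFiniteMeasureOnCompacts μ]
  (B : Type*) [NonUnitalCStarAlgebra B]

theorem integrable_cc {X : Type*} [NormedAddCommGroup X] (f : C_c(G, X)) : Integrable f μ :=
  f.continuous.integrable_of_hasCompactSupport f.hasCompactSupport

variable {B}

/-- The `B`-valued inner product `⟨f₁, f₂⟩ = ∫ f₁(g)⋆ f₂(g) dg` on `C_c(G, B)`. -/
noncomputable def ccInner (f₁ f₂ : C_c(G, B)) : B := ∫ g, star (f₁ g) * f₂ g ∂μ

theorem ccInner_add_right (f₁ f₂ f₃ : C_c(G, B)) :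
    ccInner μ f₁ (f₂ + f₃) = ccInner μ f₁ f₂ + ccInner μ f₁ f₃ := by
  unfold ccInner
  have := integral_add (integrable_cc μ (star f₁ * f₂)) (integrable_cc μ (star f₁ * f₃))
  simpa [mul_add] using this

theorem ccInner_smul_right (c : ℂ) (f₁ f₂ : C_c(G, B)) :
    ccInner μ f₁ (c • f₂) = c • ccInner μ f₁ f₂ := by
  unfold ccInner
  rw [← integral_smul]
  simp [mul_smul_comm]

theorem star_ccInner (f₁ f₂ : C_c(G, B)) : star (ccInner μ f₁ f₂) = ccInner μ f₂ f₁ := by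
  unfold ccInner
  have := (starL' ℝ (A := B)).integral_comp_comm (μ := μ) (fun g => star (f₁ g) * f₂ g)
  simp at this
  exact this.symm

theorem ccInner_self_nonneg (f : C_c(G, B)) : ∃ b : B, ccInner μ f f = star b * b := by
  let _ := CStarAlgebra.spectralOrder B
  have _ := CStarAlgebra.spectralOrderedRing B
  refine CStarAlgebra.nonneg_iff_eq_star_mul_self.1 ?_
  exact integral_nonneg fun g => star_mul_self_nonneg _

/-- Pointwise right multiplication by an element of `B`. -/
def ccAct (f : C_c(G, B)) (b : B) : C_c(G, B) where
  toFun g := f g * b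
  continuous_toFun := by fun_prop
  hasCompactSupport' := f.hasCompactSupport.mul_right

theorem ccInner_act_right (f₁ f₂ : C_c(G, B)) (b : B) :
    ccInner μ f₁ (ccAct f₂ b) = ccInner μ f₁ f₂ * b := by
  unfold ccInner
  have := ((ContinuousLinearMap.mul ℝ B).flip b).integral_comp_comm
    (integrable_cc μ (star f₁ * f₂))
  simp at this
  rw [← this]
  simp [ccAct, mul_assoc]

/-- The seminorm `‖f‖ = ‖⟨f, f⟩‖^{1/2}` on `C_c(G, B)`. -/
noncomputable def ccNorm (f : C_c(G, B)) : ℝ := √‖ccInner μ f f‖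

theorem ccNorm_smul (c : ℂ) (f : C_c(G, B)) : ccNorm μ (c • f) = ‖c‖ * ccNorm μ f := by
  unfold ccNorm
  rw [ccInner_smul_right, ← star_ccInner, ccInner_smul_right, norm_smul, norm_star, norm_smul,
    ← mul_assoc, Real.sqrt_mul (by positivity), Real.sqrt_mul_self (norm_nonneg _)]

theorem ccNorm_add_le (f k : C_c(G, B)) : ccNorm μ (f + k) ≤ ccNorm μ f + ccNorm μ k := by
  unfold ccNorm
  have cs := cauchy_schwarz (ccAct (G := G) (B := B)) (ccInner μ) (ccInner_add_right μ)
    (ccInner_act_right μ) (star_ccInner μ) (ccInner_self_nonneg μ) f k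
  have hl : ccInner μ (f + k) (f + k)
      = ccInner μ f f + ccInner μ f k + (star (ccInner μ f k) + ccInner μ k k) := by
    rw [ccInner_add_right, ← star_ccInner μ f (f + k), ← star_ccInner μ k (f + k)]
    rw [ccInner_add_right, ccInner_add_right, star_add, star_add]
    simp only [star_ccInner]
    abel
  rw [Real.sqrt_le_left (by positivity), hl]
  set a := ‖ccInner μ f f‖
  set d := ‖ccInner μ k k‖
  have hc : ‖ccInner μ f k‖ ≤ √a * √d := by
    rw [← Real.sqrt_mul (norm_nonneg _)]
    exact Real.le_sqrt_of_sq_le cs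
  have ha : √a ^ 2 = a := Real.sq_sqrt (norm_nonneg _)
  have hd : √d ^ 2 = d := Real.sq_sqrt (norm_nonneg _)
  calc _ ≤ ‖ccInner μ f f‖ + ‖ccInner μ f k‖
        + (‖star (ccInner μ f k)‖ + ‖ccInner μ k k‖) :=
        (norm_add_le _ _).trans (add_le_add (norm_add_le _ _) (norm_add_le _ _))
    _ ≤ (√a + √d) ^ 2 := by rw [norm_star]; nlinarith

/-- `C_c(G, B)` with the seminorm `‖f‖ = ‖⟨f, f⟩‖^{1/2}`. -/
def PreL2 (_ : Measure G) (B : Type*) [NonUnitalCStarAlgebra B] : Type _ := C_c(G, B)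

instance : AddCommGroup (PreL2 μ B) := inferInstanceAs (AddCommGroup C_c(G, B))
instance : Module ℂ (PreL2 μ B) := inferInstanceAs (Module ℂ C_c(G, B))

noncomputable instance : Norm (PreL2 μ B) where
  norm := ccNorm μ

theorem preL2_core : SeminormedSpace.Core ℂ (PreL2 μ B) where
  norm_nonneg f := Real.sqrt_nonneg _
  norm_smul := ccNorm_smul μ
  norm_triangle := ccNorm_add_le μ

noncomputable instance : SeminormedAddCommGroup (PreL2 μ B) :=
  SeminormedAddCommGroup.ofCore (preL2_core μ)

noncomputable instance : NormedSpace ℂ (PreL2 μ B) where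
  norm_smul_le c f := ((preL2_core μ).norm_smul c f).le

variable (B) in
/-- The Hilbert module `L²(G, B)`: the completion of `C_c(G, B)`. -/
abbrev L2 : Type _ := UniformSpace.Completion (PreL2 μ B)

/-- The canonical map `C_c(G, B) → L²(G, B)`. -/
noncomputable def toL2 : C_c(G, B) →ₗ[ℂ] L2 μ B where
  toFun f := ((show PreL2 μ B from f : PreL2 μ B) : L2 μ B)
  map_add' f k := UniformSpace.Completion.coe_add (α := PreL2 μ B) f k
  map_smul' c f := UniformSpace.Completion.coe_smul (X := PreL2 μ B) c f

theorem denseRange_toL2 : DenseRange (toL2 μ (B := B)) :=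
  UniformSpace.Completion.denseRange_coe (α := PreL2 μ B)

theorem norm_toL2 (f : C_c(G, B)) : ‖toL2 μ f‖ ^ 2 = ‖∫ g, star (f g) * f g ∂μ‖ := by
  have h : ‖toL2 μ f‖ = √‖ccInner μ f f‖ := UniformSpace.Completion.norm_coe (E := PreL2 μ B) f
  rw [h, Real.sq_sqrt (norm_nonneg _)]; rfl

end L2

section Crossed

variable {G : Type*} [Group G] [TopologicalSpace G] [IsTopologicalGroup G]
  [MeasurableSpace G] [BorelSpace G] (μ : Measure G) [IsFiniteMeasureOnCompacts μ]
  {B : Type*} [NonUnitalCStarAlgebra B] [CStarAction G B]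

/-- `(ρ_K f)(g) = ∫ β_g(K(g⁻¹ g₂)) f(g₂) dg₂` on `C_c(G, B)`. -/
noncomputable def rhoFun (K f : C_c(G, B)) : C_c(G, B) where
  toFun g := ∫ h, CStarAction.act g (K (g⁻¹ * h)) * f h ∂μ
  continuous_toFun := by
    rw [← continuousOn_univ]
    refine continuousOn_integral_of_compact_support (k := tsupport f) f.hasCompactSupport ?_ ?_
    · refine Continuous.continuousOn ?_
      have h1 : Continuous fun p : G × G => K (p.1⁻¹ * p.2) := K.continuous.comp (by fun_prop)
      exact (continuous_cstarAct continuous_fst h1).mul (f.continuous.comp continuous_snd)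
    · intro g h _ hh
      rw [image_eq_zero_of_notMem_tsupport hh, mul_zero]
  hasCompactSupport' := by
    refine HasCompactSupport.intro
      (f.hasCompactSupport.isCompact.mul K.hasCompactSupport.isCompact.inv) fun g hg => ?_
    refine integral_eq_zero_of_ae (Eventually.of_forall fun h => ?_)
    by_cases hh : h ∈ tsupport f
    · by_cases hk : g⁻¹ * h ∈ tsupport K
      · refine (hg ?_).elim
        exact Set.mem_mul.2 ⟨h, hh, (g⁻¹ * h)⁻¹, Set.inv_mem_inv.2 hk, by group⟩
      · simp [image_eq_zero_of_notMem_tsupport hk]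
    · simp [image_eq_zero_of_notMem_tsupport hh]

theorem rhoFun_apply (K f : C_c(G, B)) (g : G) :
    rhoFun μ K f g = ∫ h, CStarAction.act g (K (g⁻¹ * h)) * f h ∂μ := rfl

theorem integrable_rho (K f : C_c(G, B)) (g : G) :
    Integrable (fun h => CStarAction.act g (K (g⁻¹ * h)) * f h) μ := by
  have h1 : Continuous fun h : G => K (g⁻¹ * h) := K.continuous.comp (by fun_prop)
  exact ((continuous_cstarAct continuous_const h1).mul
    f.continuous).integrable_of_hasCompactSupport f.hasCompactSupport.mul_left

/-- `ρ_K` as a linear map on `C_c(G, B)`. -/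
noncomputable def rhoLin (K : C_c(G, B)) : C_c(G, B) →ₗ[ℂ] C_c(G, B) where
  toFun := rhoFun μ K
  map_add' f k := by
    ext g
    simp only [CompactlySupportedContinuousMap.coe_add, Pi.add_apply, rhoFun_apply, mul_add]
    exact integral_add (integrable_rho μ K f g) (integrable_rho μ K k g)
  map_smul' c f := by
    ext g
    simp only [CompactlySupportedContinuousMap.coe_smul, Pi.smul_apply, rhoFun_apply,
      mul_smul_comm, RingHom.id_apply]
    exact integral_smul _ _

/-- The bounded operator `ρ_K` on `L²(G, B)`. -/
noncomputable def rho (K : C_c(G, B)) : L2 μ B →L[ℂ] L2 μ B :=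
  ((toL2 μ).comp (rhoLin μ K)).extendOfNorm (toL2 μ)

end Crossed

section CrossedProduct

variable {G : Type*} [Group G] [TopologicalSpace G] [IsTopologicalGroup G]
  [MeasurableSpace G] [BorelSpace G] (μ : Measure G) [IsFiniteMeasureOnCompacts μ]

/-- The reduced crossed product `C⋆_r(G, B)`: the norm closure of `{ρ_K | K ∈ C_c(G, B)}` in the
bounded operators on `L²(G, B)`. -/
def reducedCrossedProduct (B : Type*) [NonUnitalCStarAlgebra B] [CStarAction G B] :
    Set (L2 μ B →L[ℂ] L2 μ B) :=
  closure (Set.range (rho μ (B := B)))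

variable {B Q : Type*} [NonUnitalCStarAlgebra B] [CStarAction G B]
  [NonUnitalCStarAlgebra Q] [CStarAction G Q]

/-- The map `C_c(G, B) → C_c(G, Q)`, `K ↦ π ∘ K`. -/
def ccMap (π : B →⋆ₙₐ[ℂ] Q) (K : C_c(G, B)) : C_c(G, Q) where
  toFun g := π (K g)
  continuous_toFun := (AddMonoidHomClass.continuous_of_bound π 1 fun b => by
    rw [one_mul]; exact NonUnitalStarAlgHom.norm_apply_le π b).comp K.continuous
  hasCompactSupport' := K.hasCompactSupport.comp_left (map_zero π)

/-- The graph of the `⋆`-homomorphism `C⋆_r(G, B) → C⋆_r(G, Q)`, `ρ_K ↦ ρ_{π ∘ K}` induced by an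
equivariant `⋆`-homomorphism `π : B → Q`. As this map is continuous, its graph is the closure
of its restriction to `{ρ_K | K ∈ C_c(G, B)}`. -/
def crossedGraph (π : B →⋆ₙₐ[ℂ] Q) : Set ((L2 μ B →L[ℂ] L2 μ B) × (L2 μ Q →L[ℂ] L2 μ Q)) :=
  closure (Set.range fun K : C_c(G, B) => (rho μ K, rho μ (ccMap π K)))

/-- For an invariant closed ideal `I` in `B`, the reduced crossed product `C⋆_r(G, I)`, viewed as
an ideal in `C⋆_r(G, B)`: the closure of the set of all `ρ_K` with `K ∈ C_c(G, I)`. -/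
def crossedIdeal (I : Set B) : Set (L2 μ B →L[ℂ] L2 μ B) :=
  closure {T | ∃ K : C_c(G, B), (∀ g, K g ∈ I) ∧ T = rho μ K}

end CrossedProduct

/-- `G` is exact: for each invariant closed ideal `I` in a `G`-C⋆-algebra `B`, the ideal
`C⋆_r(G, I)` is the kernel of `C⋆_r(G, B) → C⋆_r(G, B/I)`. The quotient `B → B/I` is given
by an equivariant surjective `⋆`-homomorphism `π : B → Q` with kernel `I`. -/
def IsExactGroup {G : Type u} [Group G] [TopologicalSpace G] [IsTopologicalGroup G]
    [MeasurableSpace G] [BorelSpace G] (μ : Measure G) [IsFiniteMeasureOnCompacts μ] : Prop :=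
  ∀ (B Q : Type u) [NonUnitalCStarAlgebra B] [CStarAction G B]
    [NonUnitalCStarAlgebra Q] [CStarAction G Q] (π : B →⋆ₙₐ[ℂ] Q),
    Function.Surjective π →
    (∀ (g : G) (b : B), π (CStarAction.act g b) = CStarAction.act g (π b)) →
    crossedIdeal μ {b : B | π b = 0} = {T | (T, 0) ∈ crossedGraph μ π}

section SquareIntegrability

variable {G : Type*} [Group G] [TopologicalSpace G] [IsTopologicalGroup G]
  [MeasurableSpace G] [BorelSpace G] (μ : Measure G) [IsFiniteMeasureOnCompacts μ]
  (B : Type*) {E : Type*} [NonUnitalCStarAlgebra B] [CStarAction G B]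
  [NormedAddCommGroup E] [NormedSpace ℂ E] [CompleteSpace E] [SMul Bᵐᵒᵖ E]
  [HilbertModule B E] [HilbertAction G B E]

/-- The filter of continuous, compactly supported cut-off functions `χ : G → [0, 1]` with `χ → 1`
uniformly on compact subsets. -/
def cutoffs (G : Type*) [TopologicalSpace G] : Filter C_c(G, ℝ) :=
  comap (fun χ => (χ.toContinuousMap : C(G, ℝ))) (𝓝 1) ⊓
    𝓟 {χ | ∀ g, χ g ∈ Set.Icc (0 : ℝ) 1}

variable {B} in
/-- The product `χ · f` of a cut-off function and a continuous function. -/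
noncomputable def cutMul (χ : C_c(G, ℝ)) (f : C(G, B)) : C_c(G, B) where
  toFun g := χ g • f g
  continuous_toFun := by fun_prop
  hasCompactSupport' := χ.hasCompactSupport.smul_right

variable {B} in
/-- The continuous function `f` is square-integrable and represents `F ∈ L²(G, B)`, that is,
`χ · f → F` in `L²(G, B)` along the cut-off functions `χ`. -/
def RepresentsL2 (f : C(G, B)) (F : L2 μ B) : Prop :=
  Tendsto (fun χ => toL2 μ (cutMul χ f)) (cutoffs G) (𝓝 F)

/-- The function `⟨⟨ξ|η : g ↦ ⟨γ_g ξ, η⟩`. -/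
noncomputable def bra (ξ η : E) : C(G, B) where
  toFun g := inner B (gact B g ξ) η
  continuous_toFun :=
    (innerL B E).continuous₂.comp ((continuous_gact B ξ).prodMk continuous_const)

/-- The set `E_si` of square-integrable elements of `E`. -/
def squareIntegrable : Set E :=
  {ξ | ∀ η : E, ∃ F : L2 μ B, RepresentsL2 μ (bra B ξ η) F}

/-- The operator `|ξ⟩⟩ f = ∫ γ_g(ξ) f(g) dg` on `C_c(G, B)`. -/
noncomputable def ketLin (ξ : E) : C_c(G, B) →ₗ[ℂ] E where
  toFun f := ∫ g, gact B g ξ <• f g ∂μ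
  map_add' f k := by
    have hint : ∀ f : C_c(G, B), Integrable (fun g => gact B g ξ <• f g) μ := fun f =>
      Continuous.integrable_of_hasCompactSupport
        ((actL B E).continuous₂.comp ((continuous_gact B ξ).prodMk f.continuous))
        (HasCompactSupport.intro f.hasCompactSupport.isCompact fun g hg => by
          rw [image_eq_zero_of_notMem_tsupport hg]
          exact (actL B E _).map_zero)
    rw [← integral_add (hint f) (hint k)]
    exact integral_congr_ae (Eventually.of_forall fun g =>
      (actL B E (gact B g ξ)).map_add (f g) (k g))
  map_smul' c f := by
    rw [RingHom.id_apply, ← integral_smul]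
    exact integral_congr_ae (Eventually.of_forall fun g =>
      (actL B E (gact B g ξ)).map_smul c (f g))

/-- The bounded extension `|ξ⟩⟩ : L²(G, B) → E`, which exists if `ξ` is square-integrable. -/
noncomputable def ket (ξ : E) : L2 μ B →L[ℂ] E := (ketLin μ B ξ).extendOfNorm (toL2 μ)

/-- The norm `‖ξ‖_si = ‖ξ‖ + ‖|ξ⟩⟩‖` on `E_si`. -/
noncomputable def siNorm (ξ : E) : ℝ := ‖ξ‖ + ‖ket μ B ξ‖

/-- `T` is the operator `⟨⟨ξ|η⟩⟩ = ⟨⟨ξ| ∘ |η⟩⟩` on `L²(G, B)`. -/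
def IsBraKet (ξ η : E) (T : L2 μ B →L[ℂ] L2 μ B) : Prop :=
  ∀ F : L2 μ B, RepresentsL2 μ (bra B ξ (ket μ B η F)) (T F)

/-- The right `C_c(G, B)`-module structure `ξ ∗ K = ∫ γ_g(ξ K(g⁻¹)) dg`. -/
noncomputable def convAct (ξ : E) (K : C_c(G, B)) : E := ∫ g : G, gact B g (ξ <• K g⁻¹) ∂μ

/-- A subset `R` of `E` is relatively continuous if it consists of square-integrable elements and
`⟨⟨ξ|η⟩⟩ ∈ C⋆_r(G, B)` for all `ξ, η ∈ R`. -/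
def IsRelativelyContinuous (R : Set E) : Prop :=
  R ⊆ squareIntegrable μ B ∧
    ∀ ξ ∈ R, ∀ η ∈ R, ∃ T ∈ reducedCrossedProduct μ B, IsBraKet μ B ξ η T

/-- A linear subspace `R` of `E` is complete if it is contained in `E_si`, closed for the norm
`‖·‖_si` and satisfies `R ∗ C_c(G, B) ⊆ R`. -/
structure IsCompleteSubspace (R : Submodule ℂ E) : Prop where
  subset_si : (R : Set E) ⊆ squareIntegrable μ B
  closed_si : ∀ ξ ∈ squareIntegrable μ B,
    (∀ ε > 0, ∃ η ∈ R, siNorm μ B (ξ - η) < ε) → ξ ∈ R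
  conv_mem : ∀ ξ ∈ R, ∀ K : C_c(G, B), convAct μ B ξ K ∈ R

/-- The completion of a subset of `E_si`: the smallest complete subspace that contains it. -/
def completion (X : Set E) : Submodule ℂ E :=
  sInf {S : Submodule ℂ E | IsCompleteSubspace μ B S ∧ X ⊆ S}

variable (E) in
/-- The set `S(E)` of all dense, complete, relatively continuous subspaces of `E`. -/
def contSubspaces : Set (Submodule ℂ E) :=
  {R | Dense (R : Set E) ∧ IsCompleteSubspace μ B R ∧ IsRelativelyContinuous μ B (R : Set E)}

/-- The map `i`: the completion of the linear span of `|R⟩⟨E|` in `K(E)`. -/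
noncomputable def toCompacts (R : Submodule ℂ E) : Submodule ℂ (CompactOp B E) :=
  completion μ (CompactOp B E) (Submodule.span ℂ
    {T : CompactOp B E | ∃ ξ ∈ R, ∃ η : E, T.op = rankOne B ξ η} : Set (CompactOp B E))

/-- The map `j`: the completion of the linear span of `R(E)` in `E`. -/
noncomputable def ofCompacts (R : Submodule ℂ (CompactOp B E)) : Submodule ℂ E :=
  completion μ B (Submodule.span ℂ {x : E | ∃ T ∈ R, ∃ η : E, x = T.op η} : Set E)

end SquareIntegrability

end SquareIntegrable

open SquareIntegrable (CStarAction HilbertModule HilbertAction CompactOp contSubspaces toCompacts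
  ofCompacts IsExactGroup)

set_option linter.unusedSectionVars false

/-! An element ξ is square-integrable exactly when |ξ⟩⟩ extends to an adjointable operator L²(G,B) →
E, whose adjoint is then ⟨⟨ξ| (`isKet_ket`, `IsKet.mem`). Relative continuity says that the products
adj|ξ⟩⟩ ∘ |η⟩⟩ lie in C*_r(G,B) (`isRelativelyContinuous_iff`), and the theorem becomes algebra with
kets. Three identities drive it: |Tξ⟩⟩ = T|ξ⟩⟩ for equivariant adjointable T, |ξ∗K⟩⟩ = |ξ⟩⟩ρ_K, and
|ξb⟩⟩ = |ξ⟩⟩M_b with M_b the multiplication operator of b. The second follows from the first,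
because L²(G,B) is itself a Hilbert B,G-module in which elements of C_c(G,B) have the operators ρ_K
as kets (`isKet_toL2`).

Take a bump φ near 1 in G and e from an approximate unit of B. If ⟨⟨ξ|ξ⟩⟩ belongs to C*_r(G,B), then
ξ∗(φ⊗e²) approximates ξ in the norm ‖·‖_si (`IsKet.exists_approx`). Hence a complete relatively
continuous R contains each ξ whose ket is merely a norm limit of kets from R
(`mem_of_ket_mem_closure`), and this yields R·B ⊆ R (`act_mem`).

For the passage between E and K(E), the matrix coefficients of the bra-kets of |ξ⟩⟨η| and |ξ'⟩⟨η'|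
are those of ⟨⟨ξ|ξ'⟩⟩, transported by bounded maps between L²(G,K(E)) and L²(G,B). Kernels in C_c
transport in the same way, so approximability by operators ρ_K passes in both directions
(`IsKet.crossed_ketbra`, `IsKet.crossed_op`). This makes i and j well defined. The rule T|ξ⟩⟨η| =
|Tξ⟩⟨η| together with approximation of T by TS, S of finite rank, gives i∘j = id. The rule |ξ⟩⟨η|ζ =
ξ⟨η,ζ⟩ and R·B ⊆ R give j∘i(R) ⊆ R. More precisely, j∘i(R) only sees R through coefficients in the
closed ideal I generated by the inner products of E (`ofCompacts_toCompacts_le_of`).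

All matrix coefficients of ⟨⟨ξ|ξ⟩⟩ lie in I, so this operator is in the kernel of C*_r(G,B) →
C*_r(G,B/I) (`mem_crossedGraph_zero_iff`). If the kernel is C*_r(G,I), the element e above may be
taken in I; then ξ∗(φ⊗e²) = (ξe)∗(φ⊗e) lies in j∘i(R) and converges to ξ. Conversely, let I be an
ideal for which the kernel J differs from C*_r(G,I). Take E = L²(G,I) and let R consist of the ξ
whose ket lies in J. All kets from j∘i(R) lie in C*_r(G,I). If j∘i(R) were R, then Tρ_K would lie in
C*_r(G,I) for all T in J and all K, and an approximate unit would put T there too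
(`crossedKernel_le_of_eq`). -/

namespace SquareIntegrable

/-! ### Adjointable operators between Hilbert modules -/

section Adjointable

variable {B E F D : Type*} [NonUnitalCStarAlgebra B]
  [NormedAddCommGroup E] [NormedSpace ℂ E] [SMul Bᵐᵒᵖ E] [HilbertModule B E]
  [NormedAddCommGroup F] [NormedSpace ℂ F] [SMul Bᵐᵒᵖ F] [HilbertModule B F]
  [NormedAddCommGroup D] [NormedSpace ℂ D] [SMul Bᵐᵒᵖ D] [HilbertModule B D]

theorem inner_sub_right (x y z : E) : inner B x (y - z) = inner B x y - inner B x z :=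
  (innerL B E x).map_sub y z

theorem inner_sub_left (x y z : E) : inner B (x - y) z = inner B x z - inner B y z := by
  rw [← HilbertModule.star_inner, inner_sub_right, star_sub, HilbertModule.star_inner,
    HilbertModule.star_inner]

theorem inner_zero_right (x : E) : inner B x (0 : E) = 0 := (innerL B E x).map_zero

theorem inner_zero_left (x : E) : inner B (0 : E) x = 0 := by
  rw [← HilbertModule.star_inner, inner_zero_right, star_zero]

theorem continuous_inner {X : Type*} [TopologicalSpace X] {f k : X → E} (hf : Continuous f)
    (hk : Continuous k) : Continuous fun x => inner B (f x) (k x) :=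
  (innerL B E).continuous₂.comp (hf.prodMk hk)

theorem continuous_act {X : Type*} [TopologicalSpace X] {f : X → E} {k : X → B}
    (hf : Continuous f) (hk : Continuous k) : Continuous fun x => f x <• k x :=
  (actL B E).continuous₂.comp (hf.prodMk hk)

theorem act_act (x : E) (a b : B) : (x <• a) <• b = x <• (a * b) :=
  ext_inner (B := B) fun z => by simp only [HilbertModule.inner_act_right, mul_assoc]

theorem act_add (x : E) (a b : B) : x <• (a + b) = x <• a + x <• b := (actL B E x).map_add a b

theorem act_sub (x : E) (a b : B) : x <• (a - b) = x <• a - x <• b := (actL B E x).map_sub a b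

theorem act_zero (x : E) : x <• (0 : B) = 0 := (actL B E x).map_zero

theorem act_smul (c : ℂ) (x : E) (a : B) : x <• (c • a) = c • (x <• a) :=
  (actL B E x).map_smul c a

theorem act_real_smul (c : ℝ) (x : E) (a : B) : x <• (c • a) = c • (x <• a) :=
  (actL B E x).map_smul_of_tower c a

theorem add_act (x y : E) (a : B) : (x + y) <• a = x <• a + y <• a :=
  ((actL B E).flip a).map_add x y

theorem sub_act (x y : E) (a : B) : (x - y) <• a = x <• a - y <• a :=
  ((actL B E).flip a).map_sub x y

theorem smul_act (c : ℂ) (x : E) (a : B) : (c • x) <• a = c • (x <• a) :=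
  ((actL B E).flip a).map_smul c x

theorem norm_le_of_inner {x : E} {C : ℝ} (hC : 0 ≤ C) (h : ‖inner B x x‖ ≤ C * ‖x‖) :
    ‖x‖ ≤ C := by
  rcases (norm_nonneg x).eq_or_lt with h0 | h0
  · rwa [← h0]
  · rw [← HilbertModule.norm_sq_eq, pow_two] at h
    exact le_of_mul_le_mul_right h h0

variable (B) in
/-- `Y` is an adjoint of the operator `X` between two Hilbert `B`-modules. -/
def AdjPair (X : E →L[ℂ] F) (Y : F →L[ℂ] E) : Prop :=
  ∀ (x : E) (y : F), inner B (X x) y = inner B x (Y y)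

namespace AdjPair

theorem symm {X : E →L[ℂ] F} {Y : F →L[ℂ] E} (h : AdjPair B X Y) : AdjPair B Y X := fun x y => by
  rw [← HilbertModule.star_inner, ← h, HilbertModule.star_inner]

theorem unique {X : E →L[ℂ] F} {Y Y' : F →L[ℂ] E} (h : AdjPair B X Y) (h' : AdjPair B X Y') :
    Y = Y' := by
  ext y
  exact ext_inner (B := B) fun z => by rw [← h, h']

theorem comp {X : E →L[ℂ] F} {Y : F →L[ℂ] E} {X' : D →L[ℂ] E} {Y' : E →L[ℂ] D}
    (h : AdjPair B X Y) (h' : AdjPair B X' Y') : AdjPair B (X ∘L X') (Y' ∘L Y) := fun x y => by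
  simp [h _ y, h' x _]

theorem add {X X' : E →L[ℂ] F} {Y Y' : F →L[ℂ] E} (h : AdjPair B X Y) (h' : AdjPair B X' Y') :
    AdjPair B (X + X') (Y + Y') := fun x y => by
  simp [inner_add_left, HilbertModule.inner_add_right, h x y, h' x y]

theorem sub {X X' : E →L[ℂ] F} {Y Y' : F →L[ℂ] E} (h : AdjPair B X Y) (h' : AdjPair B X' Y') :
    AdjPair B (X - X') (Y - Y') := fun x y => by
  simp [inner_sub_left, inner_sub_right, h x y, h' x y]

theorem smul {X : E →L[ℂ] F} {Y : F →L[ℂ] E} (c : ℂ) (h : AdjPair B X Y) :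
    AdjPair B (c • X) (star c • Y) := fun x y => by
  simp [inner_smul_left, HilbertModule.inner_smul_right, h x y]

theorem zero : AdjPair B (0 : E →L[ℂ] F) 0 := fun x y => by
  simp [inner_zero_left, inner_zero_right]

theorem map_act {X : E →L[ℂ] F} {Y : F →L[ℂ] E} (h : AdjPair B X Y) (x : E) (b : B) :
    X (x <• b) = X x <• b :=
  ext_inner (B := B) fun z => by
    rw [← h.symm, HilbertModule.inner_act_right, HilbertModule.inner_act_right, h.symm]

theorem norm_le {X : E →L[ℂ] F} {Y : F →L[ℂ] E} (h : AdjPair B X Y) : ‖Y‖ ≤ ‖X‖ := by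
  refine Y.opNorm_le_bound (norm_nonneg _) fun y => ?_
  refine norm_le_of_inner (B := B) (by positivity) ?_
  rw [← h]
  calc _ ≤ ‖X (Y y)‖ * ‖y‖ := norm_inner_le _ _
    _ ≤ ‖X‖ * ‖Y y‖ * ‖y‖ := by gcongr; exact X.le_opNorm _
    _ = _ := by ring

/-- One half of the C*-identity ‖X*X‖ = ‖X‖², for operators between two different modules. -/
theorem norm_sq_le {X : E →L[ℂ] F} {Y : F →L[ℂ] E} (h : AdjPair B X Y) :
    ‖X‖ ^ 2 ≤ ‖Y ∘L X‖ := by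
  rw [← Real.sqrt_le_sqrt_iff (norm_nonneg _), Real.sqrt_sq (norm_nonneg _)]
  refine X.opNorm_le_bound (Real.sqrt_nonneg _) fun x => ?_
  refine le_of_sq_le_sq (α := ℝ) ?_ (by positivity)
  rw [HilbertModule.norm_sq_eq (B := B), h, mul_pow, Real.sq_sqrt (norm_nonneg _)]
  calc _ ≤ ‖x‖ * ‖(Y ∘L X) x‖ := norm_inner_le _ _
    _ ≤ ‖x‖ * (‖Y ∘L X‖ * ‖x‖) := by gcongr; exact (Y ∘L X).le_opNorm x
    _ = _ := by ring

end AdjPair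

theorem isClosed_adjPair : IsClosed {p : (E →L[ℂ] F) × (F →L[ℂ] E) | AdjPair B p.1 p.2} := by
  have : {p : (E →L[ℂ] F) × (F →L[ℂ] E) | AdjPair B p.1 p.2}
      = ⋂ x : E, ⋂ y : F, {p | innerL B F (p.1 x) y = innerL B E x (p.2 y)} := by
    ext p; simp [AdjPair]
  rw [this]
  refine isClosed_iInter fun x => isClosed_iInter fun y => isClosed_eq ?_ ?_
  · fun_prop
  · fun_prop

theorem cauchySeq_of_norm_sub_le {V W : Type*} [NormedAddCommGroup V] [NormedAddCommGroup W]
    {v : ℕ → V} {w : ℕ → W} {C : ℝ} (hw : CauchySeq w)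
    (h : ∀ n m, ‖v n - v m‖ ≤ C * ‖w n - w m‖) : CauchySeq v := by
  have h' : ∀ n m, ‖v n - v m‖ ≤ (|C| + 1) * ‖w n - w m‖ := fun n m =>
    (h n m).trans (by gcongr; exact (le_abs_self C).trans (by linarith))
  rw [Metric.cauchySeq_iff] at hw ⊢
  intro ε hε
  have hC : 0 < |C| + 1 := by positivity
  obtain ⟨N, hN⟩ := hw (ε / (|C| + 1)) (by positivity)
  refine ⟨N, fun m hm n hn => ?_⟩
  have h1 := hN m hm n hn
  rw [dist_eq_norm] at h1 ⊢
  rw [lt_div_iff₀ hC] at h1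
  exact (h' m n).trans_lt (by linarith)

/-- Passing to adjoints does not increase the norm, so the adjoints of a convergent sequence are
Cauchy, and the relation `AdjPair` is closed. -/
theorem isClosed_adjointable [CompleteSpace E] :
    IsClosed {X : E →L[ℂ] F | ∃ Y, AdjPair B X Y} := by
  refine isClosed_of_closure_subset fun X hX => ?_
  obtain ⟨t, ht, hlim⟩ := mem_closure_iff_seq_limit.1 hX
  choose s hs using ht
  have hcau : CauchySeq s := cauchySeq_of_norm_sub_le (C := 1) hlim.cauchySeq fun n m => by
    rw [one_mul]; exact ((hs n).sub (hs m)).norm_le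
  obtain ⟨Y, hY⟩ := cauchySeq_tendsto_of_complete hcau
  exact ⟨Y, isClosed_adjPair.mem_of_tendsto (hlim.prodMk_nhds hY) (Eventually.of_forall hs)⟩

/-- A bounded operator is adjointable if its adjoint exists on a total set of vectors. -/
theorem exists_adjPair_of_total [CompleteSpace E] (X : E →L[ℂ] F) {S : Set F}
    (hS : Dense (Submodule.span ℂ S : Set F))
    (h : ∀ y ∈ S, ∃ z : E, ∀ x, inner B (X x) y = inner B x z) : ∃ Y, AdjPair B X Y := by
  -- `W` is the domain of the adjoint. On it the adjoint is bounded by ‖X‖ (`hbd`), so `W` is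
  -- closed; containing a total set, it is all of `F`.
  let W : Submodule ℂ F :=
    { carrier := {y | ∃ z : E, ∀ x, inner B (X x) y = inner B x z}
      zero_mem' := ⟨0, fun x => by rw [inner_zero_right, inner_zero_right]⟩
      add_mem' := by
        rintro y y' ⟨z, hz⟩ ⟨z', hz'⟩
        exact ⟨z + z', fun x => by
          rw [HilbertModule.inner_add_right, HilbertModule.inner_add_right, hz, hz']⟩
      smul_mem' := by
        rintro c y ⟨z, hz⟩
        exact ⟨c • z, fun x => by
          rw [HilbertModule.inner_smul_right, HilbertModule.inner_smul_right, hz]⟩ }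
  have hbd : ∀ {y : F} {z : E}, (∀ x, inner B (X x) y = inner B x z) → ‖z‖ ≤ ‖X‖ * ‖y‖ := by
    intro y z hz
    refine norm_le_of_inner (B := B) (by positivity) ?_
    rw [← hz]
    calc _ ≤ ‖X z‖ * ‖y‖ := norm_inner_le _ _
      _ ≤ ‖X‖ * ‖z‖ * ‖y‖ := by gcongr; exact X.le_opNorm _
      _ = _ := by ring
  have hW : ∀ y, y ∈ W := by
    intro y
    have hy : y ∈ closure (W : Set F) := by
      have h1 : (Submodule.span ℂ S : Set F) ⊆ W := Submodule.span_le.2 h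
      exact closure_mono h1 (hS y)
    obtain ⟨t, ht, hlim⟩ := mem_closure_iff_seq_limit.1 hy
    choose s hs using ht
    have hcau : CauchySeq s := cauchySeq_of_norm_sub_le (C := ‖X‖) hlim.cauchySeq fun n m =>
      hbd fun x => by rw [inner_sub_right, inner_sub_right, hs, hs]
    obtain ⟨z, hz⟩ := cauchySeq_tendsto_of_complete hcau
    refine ⟨z, fun x => ?_⟩
    have h1 := ((innerL B F (X x)).continuous.tendsto y).comp hlim
    have h2 := ((innerL B E x).continuous.tendsto z).comp hz
    refine tendsto_nhds_unique h1 (h2.congr fun n => ?_)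
    exact (hs n x).symm
  choose z hz using hW
  refine ⟨LinearMap.mkContinuous
    { toFun := z
      map_add' := fun y y' => ext_inner (B := B) fun x => by
        rw [← hz, HilbertModule.inner_add_right, HilbertModule.inner_add_right, hz, hz]
      map_smul' := fun c y => ext_inner (B := B) fun x => by
        rw [← hz, HilbertModule.inner_smul_right, RingHom.id_apply,
          HilbertModule.inner_smul_right, hz] }
    ‖X‖ (fun y => hbd (hz y)), fun x y => hz y x⟩

/-- If `X` is adjointable, then `⟨X x, X x⟩ ≤ ‖X‖² ⟨x, x⟩`; this is the resulting norm estimate in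
quotients of `B`. -/
theorem norm_map_inner_le {Q : Type*} [NonUnitalCStarAlgebra Q] (π : B →⋆ₙₐ[ℂ] Q)
    (hπ : Function.Surjective π) {X : E →L[ℂ] F} {Y : F →L[ℂ] E} (h : AdjPair B X Y) (x : E) :
    ‖π (inner B (X x) (X x))‖ ≤ ‖X‖ ^ 2 * ‖π (inner B x x)‖ := by
  -- The Q-valued form π⟨y,z⟩ obeys Cauchy–Schwarz. That inequality asks for no algebraic laws of
  -- the action, so `Q` may act through a set-theoretic section of π.
  choose lift hlift using hπ
  have cs : ∀ y z : E, ‖π (inner B y z)‖ ^ 2 ≤ ‖π (inner B y y)‖ * ‖π (inner B z z)‖ := by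
    refine cauchy_schwarz (fun (y : E) (q : Q) => y <• lift q) (fun y z => π (inner B y z))
      (fun y z w => ?_) (fun y z q => ?_) (fun y z => ?_) (fun y => ?_)
    · rw [HilbertModule.inner_add_right, map_add]
    · rw [HilbertModule.inner_act_right, map_mul, hlift]
    · rw [← map_star, HilbertModule.star_inner]
    · obtain ⟨b, hb⟩ := HilbertModule.inner_self_nonneg (B := B) y
      exact ⟨π b, by rw [hb, map_mul, map_star]⟩
  -- Iterated Cauchy–Schwarz for the self-adjoint D = X*X takes the place of the square root of ‖X‖²
  -- − D. With a_n = ‖π⟨x, Dⁿx⟩‖ one has a_n² ≤ a_0 a_{2n}, hence a_1^(2^k) a_0 ≤ a_0^(2^k) a_{2^k}.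
  set D : E →L[ℂ] E := Y ∘L X with hD
  have hDs : ∀ (n : ℕ) (y z : E), inner B ((D ^ n) y) z = inner B y ((D ^ n) z) := by
    intro n
    induction n with
    | zero => intro y z; rfl
    | succ n ih =>
      intro y z
      have h1 : ∀ w, (D ^ (n + 1)) w = D ((D ^ n) w) := fun w => by rw [pow_succ']; rfl
      have h2 : ∀ w, (D ^ (n + 1)) w = (D ^ n) (D w) := fun w => by rw [pow_succ]; rfl
      rw [h1, h2, ← ih]
      exact (h.symm.comp h) _ _
  set d := ‖X‖ ^ 2 with hd
  have hDn : ‖D‖ ≤ d := by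
    calc ‖D‖ ≤ ‖Y‖ * ‖X‖ := Y.opNorm_comp_le X
      _ ≤ ‖X‖ * ‖X‖ := by gcongr; exact h.norm_le
      _ = d := by rw [hd, pow_two]
  set a : ℕ → ℝ := fun n => ‖π (inner B x ((D ^ n) x))‖ with ha
  have ha0 : ∀ n, 0 ≤ a n := fun n => norm_nonneg _
  have hstep : ∀ n, a n ^ 2 ≤ a 0 * a (2 * n) := by
    intro n
    have h1 := cs x ((D ^ n) x)
    rw [hDs, ← mul_apply_eq_comp, ← pow_add, ← two_mul] at h1
    simpa [ha] using h1
  have hpow : ∀ k : ℕ, a 1 ^ (2 ^ k) * a 0 ≤ a 0 ^ (2 ^ k) * a (2 ^ k) := by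
    intro k
    induction k with
    | zero => simp [mul_comm]
    | succ k ih =>
      rcases (ha0 0).eq_or_lt with h0 | h0
      · rw [← h0]; simp
      · have h1 := mul_self_le_mul_self (by positivity) ih
        have h2 := hstep (2 ^ k)
        rw [← pow_succ' 2 k] at h2
        have h3 : a 1 ^ (2 ^ (k + 1)) * a 0 * a 0 ≤ a 0 ^ (2 ^ (k + 1)) * a (2 ^ (k + 1)) * a 0 := by
          calc _ = (a 1 ^ (2 ^ k) * a 0) * (a 1 ^ (2 ^ k) * a 0) := by rw [pow_succ, pow_mul]; ring
            _ ≤ _ := h1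
            _ = a 0 ^ (2 ^ (k + 1)) * a (2 ^ k) ^ 2 := by rw [pow_succ, pow_mul]; ring
            _ ≤ a 0 ^ (2 ^ (k + 1)) * (a 0 * a (2 ^ (k + 1))) := by gcongr
            _ = _ := by ring
        exact le_of_mul_le_mul_right h3 h0
  have hgrow : ∀ n, a n ≤ d ^ n * ‖x‖ ^ 2 := by
    intro n
    calc a n ≤ ‖inner B x ((D ^ n) x)‖ := NonUnitalStarAlgHom.norm_apply_le π _
      _ ≤ ‖x‖ * ‖(D ^ n) x‖ := norm_inner_le _ _
      _ ≤ ‖x‖ * (‖D ^ n‖ * ‖x‖) := by gcongr; exact (D ^ n).le_opNorm x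
      _ ≤ ‖x‖ * (d ^ n * ‖x‖) := by
        gcongr
        rcases Nat.eq_zero_or_pos n with rfl | hn
        · simp only [pow_zero]; exact ContinuousLinearMap.norm_id_le
        · exact (norm_pow_le' D hn).trans (by gcongr)
      _ = _ := by ring
  -- In the limit the crude growth bound a_n ≤ dⁿ‖x‖² suffices: if r = d a_0 / a_1 were below 1,
  -- then a_0 ≤ r^(2^k)‖x‖² → 0, which contradicts a_0 > 0.
  have hgoal : a 1 ≤ d * a 0 := by
    rcases (ha0 0).eq_or_lt with h0 | h0
    · have := hstep 1
      rw [← h0, zero_mul] at this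
      rw [← h0, mul_zero]
      exact le_of_eq (pow_eq_zero_iff two_ne_zero |>.1 (le_antisymm this (sq_nonneg _)))
    · by_contra! hlt
      have hd0 : 0 ≤ d := by positivity
      have h1 : 0 < a 1 := lt_of_le_of_lt (by positivity) hlt
      set r := d * a 0 / a 1 with hr
      have hr0 : 0 ≤ r := by positivity
      have hr1 : r < 1 := by rw [hr, div_lt_one h1]; exact hlt
      have hle : ∀ k : ℕ, a 0 ≤ r ^ (2 ^ k) * ‖x‖ ^ 2 := by
        intro k
        have h2 : a 1 ^ (2 ^ k) * a 0 ≤ a 1 ^ (2 ^ k) * (r ^ (2 ^ k) * ‖x‖ ^ 2) := by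
          calc _ ≤ _ := hpow k
            _ ≤ a 0 ^ (2 ^ k) * (d ^ (2 ^ k) * ‖x‖ ^ 2) := by gcongr; exact hgrow _
            _ = (d * a 0) ^ (2 ^ k) * ‖x‖ ^ 2 := by rw [mul_pow]; ring
            _ = (a 1 * r) ^ (2 ^ k) * ‖x‖ ^ 2 := by rw [hr, mul_div_cancel₀ _ h1.ne']
            _ = _ := by rw [mul_pow]; ring
        exact le_of_mul_le_mul_left h2 (by positivity)
      have hlim : Tendsto (fun k : ℕ => r ^ (2 ^ k) * ‖x‖ ^ 2) atTop (𝓝 (0 * ‖x‖ ^ 2)) :=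
        ((tendsto_pow_atTop_nhds_zero_of_lt_one hr0 hr1).comp
          (tendsto_pow_atTop_atTop_of_one_lt one_lt_two)).mul_const _
      have := ge_of_tendsto' hlim hle
      simp at this
      linarith
  calc _ = a 1 := by rw [h]; simp [ha, hD]
    _ ≤ d * a 0 := hgoal
    _ = _ := by simp [ha]

end Adjointable

end SquareIntegrable

/-! ### L²(G,B) as a Hilbert B-module -/

namespace SquareIntegrable

section L2Module

variable {G : Type*} [TopologicalSpace G] [MeasurableSpace G] [BorelSpace G]
  (μ : Measure G) [IsFiniteMeasureOnCompacts μ] {B : Type*} [NonUnitalCStarAlgebra B]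

theorem norm_ccInner_le (f k : C_c(G, B)) : ‖ccInner μ f k‖ ≤ ccNorm μ f * ccNorm μ k := by
  unfold ccNorm
  rw [← Real.sqrt_mul (norm_nonneg _)]
  exact Real.le_sqrt_of_sq_le (cauchy_schwarz (ccAct (G := G) (B := B)) (ccInner μ)
    (ccInner_add_right μ) (ccInner_act_right μ) (star_ccInner μ) (ccInner_self_nonneg μ) f k)

theorem ccNorm_act_le (f : C_c(G, B)) (b : B) : ccNorm μ (ccAct f b) ≤ ‖b‖ * ccNorm μ f := by
  unfold ccNorm
  rw [Real.sqrt_le_left (by positivity), ccInner_act_right, ← star_ccInner, ccInner_act_right,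
    star_mul, star_ccInner, mul_pow, Real.sq_sqrt (norm_nonneg _)]
  calc _ ≤ ‖star b‖ * ‖ccInner μ f f‖ * ‖b‖ := norm_mul₃_le
    _ = _ := by rw [norm_star]; ring

/-- From this instance and the next two, the completion inherits its inner product and right action
by extension; the module axioms then follow by density. -/
noncomputable instance : Inner B (PreL2 μ B) := ⟨ccInner μ⟩

instance : SMul Bᵐᵒᵖ (PreL2 μ B) := ⟨fun b f => ccAct (G := G) f b.unop⟩

instance : UniformContinuousConstSMul Bᵐᵒᵖ (PreL2 μ B) where
  uniformContinuous_const_smul b := by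
    let A : PreL2 μ B →+ PreL2 μ B :=
      { toFun := fun f => b • f
        map_zero' := by
          refine CompactlySupportedContinuousMap.ext fun g => ?_
          exact zero_mul _
        map_add' := fun f k => by
          refine CompactlySupportedContinuousMap.ext fun g => ?_
          exact add_mul _ _ _ }
    exact AddMonoidHomClass.uniformContinuous_of_bound A ‖b.unop‖ fun f => ccNorm_act_le μ f _

theorem ccInner_add_left (f₁ f₂ k : C_c(G, B)) :
    ccInner μ (f₁ + f₂) k = ccInner μ f₁ k + ccInner μ f₂ k := by
  rw [← star_ccInner, ccInner_add_right, star_add, star_ccInner, star_ccInner]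

theorem ccInner_smul_left (c : ℂ) (f k : C_c(G, B)) :
    ccInner μ (c • f) k = star c • ccInner μ f k := by
  rw [← star_ccInner, ccInner_smul_right, star_smul, star_ccInner]

theorem continuous_preL2_inner :
    Continuous (Function.uncurry (inner B) : PreL2 μ B × PreL2 μ B → B) := by
  let I : PreL2 μ B →ₗ[ℝ] PreL2 μ B →ₗ[ℝ] B := LinearMap.mk₂ ℝ (ccInner μ (B := B) (G := G))
    (ccInner_add_left μ)
    (fun c x y => by
      have := ccInner_smul_left μ (c : ℂ) x y
      rw [RCLike.star_def, Complex.conj_ofReal, Complex.coe_smul] at this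
      exact this)
    (ccInner_add_right μ)
    (fun c x y => by
      have := ccInner_smul_right μ (c : ℂ) x y
      rw [Complex.coe_smul] at this
      exact this)
  exact (LinearMap.mkContinuous₂ I 1 fun x y => by
    rw [one_mul]; exact norm_ccInner_le μ _ _).continuous₂

theorem inner_toL2 (f k : C_c(G, B)) : inner B (toL2 μ f) (toL2 μ k) = ccInner μ f k :=
  (UniformSpace.Completion.isDenseInducing_coe.prodMap
    UniformSpace.Completion.isDenseInducing_coe).extend_eq (continuous_preL2_inner μ) (f, k)

/-- The inner product is only locally uniformly continuous, so its extension to the completion is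
continuous because it is biadditive. -/
theorem continuous_L2_inner :
    Continuous (Function.uncurry (inner B) : L2 μ B × L2 μ B → B) := by
  let I : PreL2 μ B →+ PreL2 μ B →+ B :=
    { toFun := fun x => AddMonoidHom.mk' (ccInner μ (B := B) (G := G) x) (ccInner_add_right μ x)
      map_zero' := by
        ext k
        have := ccInner_smul_left μ 0 (0 : C_c(G, B)) k
        rw [star_zero, zero_smul, zero_smul] at this
        exact this
      map_add' := fun x y => by ext k; exact ccInner_add_left μ x y k }
  have h : Continuous fun p : PreL2 μ B × PreL2 μ B => I p.1 p.2 := continuous_preL2_inner μ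
  exact (UniformSpace.Completion.isDenseInducing_toCompl (PreL2 μ B)).extend_Z_bilin
    (UniformSpace.Completion.isDenseInducing_toCompl (PreL2 μ B)) h

theorem toL2_act (f : C_c(G, B)) (b : B) : toL2 μ f <• b = toL2 μ (ccAct f b) :=
  (UniformSpace.Completion.coe_smul (MulOpposite.op b) (show PreL2 μ B from f)).symm

theorem continuous_L2_inner_comp {X : Type*} [TopologicalSpace X] {f k : X → L2 μ B}
    (hf : Continuous f) (hk : Continuous k) : Continuous fun x => inner B (f x) (k x) :=
  (continuous_L2_inner μ).comp (hf.prodMk hk)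

theorem L2_induction {p : L2 μ B → Prop} (hp : IsClosed {x | p x})
    (h : ∀ f, p (toL2 μ f)) (x : L2 μ B) : p x :=
  (denseRange_toL2 μ).induction_on x hp h

theorem continuous_L2_act (b : B) : Continuous fun y : L2 μ B => y <• b := continuous_const_smul _

theorem L2_inner_add_right (x y z : L2 μ B) :
    inner B x (y + z) = inner B x y + inner B x z := by
  refine L2_induction μ (p := fun x => inner B x (y + z) = inner B x y + inner B x z)
    (isClosed_eq (continuous_L2_inner_comp μ continuous_id continuous_const)
    ((continuous_L2_inner_comp μ continuous_id continuous_const).add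
    (continuous_L2_inner_comp μ continuous_id continuous_const))) (fun x => ?_) x
  refine L2_induction μ
    (p := fun y => inner B (toL2 μ x) (y + z) = inner B (toL2 μ x) y + inner B (toL2 μ x) z)
    (isClosed_eq (continuous_L2_inner_comp μ continuous_const (continuous_id.add continuous_const))
    ((continuous_L2_inner_comp μ continuous_const continuous_id).add continuous_const))
    (fun y => ?_) y
  refine L2_induction μ (p := fun z => inner B (toL2 μ x) (toL2 μ y + z)
      = inner B (toL2 μ x) (toL2 μ y) + inner B (toL2 μ x) z)
    (isClosed_eq (continuous_L2_inner_comp μ continuous_const (continuous_const.add continuous_id))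
    (continuous_const.add (continuous_L2_inner_comp μ continuous_const continuous_id)))
    (fun z => ?_) z
  rw [← map_add, inner_toL2, inner_toL2, inner_toL2, ccInner_add_right]

theorem L2_inner_smul_right (c : ℂ) (x y : L2 μ B) : inner B x (c • y) = c • inner B x y := by
  refine L2_induction μ (p := fun x => inner B x (c • y) = c • inner B x y)
    (isClosed_eq (continuous_L2_inner_comp μ continuous_id continuous_const)
    ((continuous_L2_inner_comp μ continuous_id continuous_const).const_smul c)) (fun x => ?_) x
  refine L2_induction μ (p := fun y => inner B (toL2 μ x) (c • y) = c • inner B (toL2 μ x) y)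
    (isClosed_eq (continuous_L2_inner_comp μ continuous_const (continuous_id.const_smul c))
    ((continuous_L2_inner_comp μ continuous_const continuous_id).const_smul c)) (fun y => ?_) y
  rw [← map_smul, inner_toL2, inner_toL2, ccInner_smul_right]

theorem L2_inner_act_right (x y : L2 μ B) (b : B) : inner B x (y <• b) = inner B x y * b := by
  refine L2_induction μ (p := fun x => inner B x (y <• b) = inner B x y * b)
    (isClosed_eq (continuous_L2_inner_comp μ continuous_id continuous_const)
    ((continuous_L2_inner_comp μ continuous_id continuous_const).mul continuous_const))
    (fun x => ?_) x
  refine L2_induction μ (p := fun y => inner B (toL2 μ x) (y <• b) = inner B (toL2 μ x) y * b)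
    (isClosed_eq (continuous_L2_inner_comp μ continuous_const
    (continuous_L2_act μ b)) ((continuous_L2_inner_comp μ continuous_const continuous_id).mul
    continuous_const)) (fun y => ?_) y
  rw [toL2_act, inner_toL2, inner_toL2, ccInner_act_right]

theorem L2_star_inner (x y : L2 μ B) : star (inner B x y) = inner B y x := by
  refine L2_induction μ (p := fun x => star (inner B x y) = inner B y x)
    (isClosed_eq (continuous_L2_inner_comp μ continuous_id
    continuous_const).star (continuous_L2_inner_comp μ continuous_const continuous_id))
    (fun x => ?_) x
  refine L2_induction μ (p := fun y => star (inner B (toL2 μ x) y) = inner B y (toL2 μ x))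
    (isClosed_eq (continuous_L2_inner_comp μ continuous_const
    continuous_id).star (continuous_L2_inner_comp μ continuous_id continuous_const)) (fun y => ?_) y
  rw [inner_toL2, inner_toL2, star_ccInner]

theorem L2_inner_self_nonneg (x : L2 μ B) : ∃ b : B, inner B x x = star b * b := by
  let _ := CStarAlgebra.spectralOrder B
  have _ := CStarAlgebra.spectralOrderedRing B
  rw [← CStarAlgebra.nonneg_iff_eq_star_mul_self]
  refine L2_induction μ (p := fun x => 0 ≤ inner B x x) (isClosed_le continuous_const
    (continuous_L2_inner_comp μ continuous_id continuous_id)) (fun x => ?_) x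
  rw [inner_toL2, CStarAlgebra.nonneg_iff_eq_star_mul_self]
  exact ccInner_self_nonneg μ x

theorem L2_norm_sq_eq (x : L2 μ B) : ‖x‖ ^ 2 = ‖inner B x x‖ := by
  refine L2_induction μ (p := fun x => ‖x‖ ^ 2 = ‖inner B x x‖) (isClosed_eq (by fun_prop)
    (continuous_L2_inner_comp μ continuous_id continuous_id).norm) (fun x => ?_) x
  rw [inner_toL2, norm_toL2]; rfl

noncomputable instance : HilbertModule B (L2 μ B) where
  inner_add_right := L2_inner_add_right μ
  inner_smul_right := L2_inner_smul_right μ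
  inner_act_right := L2_inner_act_right μ
  star_inner := L2_star_inner μ
  inner_self_nonneg := L2_inner_self_nonneg μ
  norm_sq_eq := L2_norm_sq_eq μ

theorem ext_inner_toL2 {x y : L2 μ B} (h : ∀ f, inner B (toL2 μ f) x = inner B (toL2 μ f) y) :
    x = y :=
  ext_inner (B := B) fun z => L2_induction μ (p := fun z => inner B z x = inner B z y)
    (isClosed_eq (continuous_inner continuous_id continuous_const)
      (continuous_inner continuous_id continuous_const)) h z

theorem clm_ext_toL2 {X : Type*} [NormedAddCommGroup X] [NormedSpace ℂ X] {S T : L2 μ B →L[ℂ] X}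
    (h : ∀ f, S (toL2 μ f) = T (toL2 μ f)) : S = T :=
  ContinuousLinearMap.ext fun x => L2_induction μ (p := fun x => S x = T x)
    (isClosed_eq S.continuous T.continuous) h x

theorem adjPair_of_toL2 {E : Type*} [NormedAddCommGroup E] [NormedSpace ℂ E] [SMul Bᵐᵒᵖ E]
    [HilbertModule B E] {X : L2 μ B →L[ℂ] E} {Y : E →L[ℂ] L2 μ B}
    (h : ∀ f y, inner B (X (toL2 μ f)) y = inner B (toL2 μ f) (Y y)) : AdjPair B X Y :=
  fun x y => L2_induction μ (p := fun x => inner B (X x) y = inner B x (Y y))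
    (isClosed_eq (continuous_inner X.continuous continuous_const)
      (continuous_inner continuous_id continuous_const)) (fun f => h f y) x

theorem adjPair_of_toL2_toL2 {X Y : L2 μ B →L[ℂ] L2 μ B}
    (h : ∀ f k, inner B (X (toL2 μ f)) (toL2 μ k) = inner B (toL2 μ f) (Y (toL2 μ k))) :
    AdjPair B X Y := adjPair_of_toL2 μ fun f y =>
  L2_induction μ
    (p := fun y => inner B (X (toL2 μ f)) y = inner B (toL2 μ f) (Y y))
    (isClosed_eq (continuous_inner continuous_const continuous_id)
      (continuous_inner continuous_const Y.continuous)) (h f) y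

theorem opNorm_le_of_toL2 {X : Type*} [NormedAddCommGroup X] [NormedSpace ℂ X]
    {T : L2 μ B →L[ℂ] X} {C : ℝ} (hC : 0 ≤ C) (h : ∀ f, ‖T (toL2 μ f)‖ ≤ C * ‖toL2 μ f‖) :
    ‖T‖ ≤ C :=
  T.opNorm_le_bound hC fun x => L2_induction μ (p := fun x => ‖T x‖ ≤ C * ‖x‖)
    (isClosed_le (by fun_prop) (by fun_prop)) h x

/-- An operator on `L²(G, B)` is bounded by `C` if its matrix coefficients are. -/
theorem opNorm_le_of_inner_toL2 {T : L2 μ B →L[ℂ] L2 μ B} {C : ℝ} (hC : 0 ≤ C)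
    (h : ∀ f k, ‖inner B (toL2 μ f) (T (toL2 μ k))‖ ≤ C * ‖toL2 μ f‖ * ‖toL2 μ k‖) : ‖T‖ ≤ C := by
  refine opNorm_le_of_toL2 μ hC fun k => ?_
  refine norm_le_of_inner (B := B) (by positivity) ?_
  refine L2_induction μ
    (p := fun x => ‖inner B x (T (toL2 μ k))‖ ≤ C * ‖toL2 μ k‖ * ‖x‖) ?_ (fun f => ?_) _
  · exact isClosed_le (continuous_inner continuous_id continuous_const).norm (by fun_prop)
  · calc _ ≤ _ := h f k
      _ = _ := by ring

variable {X : Type*} [NormedAddCommGroup X] [NormedSpace ℂ X] [CompleteSpace X]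

/-- The bounded extension to `L²(G, B)` of a linear map on `C_c(G, B)`. -/
noncomputable def extendL2 (A : C_c(G, B) →ₗ[ℂ] X) : L2 μ B →L[ℂ] X := A.extendOfNorm (toL2 μ)

theorem extendL2_toL2 {A : C_c(G, B) →ₗ[ℂ] X} {C : ℝ} (h : ∀ f, ‖A f‖ ≤ C * ‖toL2 μ f‖)
    (f : C_c(G, B)) : extendL2 μ A (toL2 μ f) = A f := by
  have := LinearMap.extendOfNorm_eq (f := A) (e := toL2 μ) (denseRange_toL2 μ) ⟨C, h⟩ f
  unfold extendL2
  exact this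

theorem norm_extendL2_le {A : C_c(G, B) →ₗ[ℂ] X} {C : ℝ} (hC : 0 ≤ C)
    (h : ∀ f, ‖A f‖ ≤ C * ‖toL2 μ f‖) : ‖extendL2 μ A‖ ≤ C := by
  have := LinearMap.opNorm_extendOfNorm_le (f := A) (e := toL2 μ) (denseRange_toL2 μ) hC h
  unfold extendL2
  exact this

end L2Module

end SquareIntegrable

/-! ### Cut-off functions and weak tests for membership in L²(G,B) -/

namespace SquareIntegrable

/-- The 3ε-argument: uniformly bounded operators that converge strongly on a dense set converge
strongly. -/
theorem tendsto_apply_of_dense {ι V W : Type*} [NormedAddCommGroup V] [NormedSpace ℂ V]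
    [NormedAddCommGroup W] [NormedSpace ℂ W] {l : Filter ι} {A : ι → V →L[ℂ] W} {A₀ : V →L[ℂ] W}
    {C : ℝ} (hC : ∀ᶠ i in l, ‖A i‖ ≤ C) {S : Set V} (hS : Dense S)
    (h : ∀ x ∈ S, Tendsto (fun i => A i x) l (𝓝 (A₀ x))) (x : V) :
    Tendsto (fun i => A i x) l (𝓝 (A₀ x)) := by
  rw [Metric.tendsto_nhds]
  intro ε hε
  set D := |C| + ‖A₀‖ + 1 with hD
  have hD0 : 0 < D := by positivity
  obtain ⟨y, hy, hxy⟩ := Metric.mem_closure_iff.1 (hS x) (ε / (2 * D)) (by positivity)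
  filter_upwards [hC, Metric.tendsto_nhds.1 (h y hy) (ε / 2) (by positivity)] with i hi hi'
  rw [dist_eq_norm] at hxy hi' ⊢
  have h1 : A i x - A₀ x = (A i y - A₀ y) + (A i (x - y) - A₀ (x - y)) := by
    simp only [map_sub]; abel
  rw [h1]
  have h2 : ‖A i (x - y)‖ ≤ |C| * ‖x - y‖ :=
    ((A i).le_opNorm _).trans (by gcongr; exact hi.trans (le_abs_self C))
  have h3 : ‖A₀ (x - y)‖ ≤ ‖A₀‖ * ‖x - y‖ := A₀.le_opNorm _
  have h4 : (|C| + ‖A₀‖) * ‖x - y‖ ≤ D * ‖x - y‖ := by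
    gcongr; rw [hD]; linarith
  have h5 : D * ‖x - y‖ < ε / 2 := by
    calc D * ‖x - y‖ < D * (ε / (2 * D)) := by gcongr
      _ = ε / 2 := by field_simp
  calc _ ≤ ‖A i y - A₀ y‖ + ‖A i (x - y) - A₀ (x - y)‖ := norm_add_le _ _
    _ ≤ ‖A i y - A₀ y‖ + (‖A i (x - y)‖ + ‖A₀ (x - y)‖) := by gcongr; exact norm_sub_le _ _
    _ < ε := by linarith

section Represent

variable {G : Type*} [TopologicalSpace G] [LocallyCompactSpace G] [T2Space G]

theorem exists_cutoff {K : Set G} (hK : IsCompact K) :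
    ∃ χ : C_c(G, ℝ), (∀ g ∈ K, χ g = 1) ∧ ∀ g, χ g ∈ Set.Icc (0 : ℝ) 1 := by
  obtain ⟨f, hf1, -, hfc, hf⟩ := exists_continuous_one_zero_of_isCompact hK isClosed_empty
    (Set.disjoint_empty K)
  exact ⟨⟨f, hfc⟩, hf1, hf⟩

theorem eventually_cutoffs_mem : ∀ᶠ χ in cutoffs G, ∀ g, χ g ∈ Set.Icc (0 : ℝ) 1 :=
  mem_inf_of_right (mem_principal_self _)

theorem eventually_cutoffs_near {K : Set G} (hK : IsCompact K) {ε : ℝ} (hε : 0 < ε) :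
    ∀ᶠ χ in cutoffs G, ∀ g ∈ K, |χ g - 1| < ε := by
  have h1 : Tendsto (fun χ : C_c(G, ℝ) => (χ.toContinuousMap : C(G, ℝ))) (cutoffs G) (𝓝 1) :=
    tendsto_comap.mono_left inf_le_left
  have h2 := ContinuousMap.tendsto_iff_forall_isCompact_tendstoUniformlyOn.1 h1 K hK
  filter_upwards [Metric.tendstoUniformlyOn_iff.1 h2 ε hε] with χ hχ g hg
  have := hχ g hg
  rw [dist_comm, Real.dist_eq] at this
  exact this

/-- Urysohn functions indexed by the compact subsets converge along this filter. Nontriviality makes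
the element of L² represented by a function unique. -/
instance : (cutoffs G).NeBot := by
  choose χ hχ1 hχ using fun K : TopologicalSpace.Compacts G => exists_cutoff K.isCompact
  have h : Tendsto χ atTop (cutoffs G) := by
    refine tendsto_inf.2 ⟨tendsto_comap_iff.2 ?_, tendsto_principal.2 (Eventually.of_forall hχ)⟩
    refine ContinuousMap.tendsto_iff_forall_isCompact_tendstoUniformlyOn.2 fun K hK => ?_
    refine Metric.tendstoUniformlyOn_iff.2 fun ε hε => ?_
    filter_upwards [eventually_ge_atTop (⟨K, hK⟩ : TopologicalSpace.Compacts G)] with L hL g hg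
    have h1 : χ L g = 1 := hχ1 L g (hL hg)
    change dist (1 : ℝ) (χ L g) < ε
    rw [h1, dist_self]; exact hε
  exact h.neBot

variable [MeasurableSpace G] [BorelSpace G] (μ : Measure G) [IsFiniteMeasureOnCompacts μ]

theorem tendsto_integral_cutoffs {X : Type*} [NormedAddCommGroup X] [NormedSpace ℝ X]
    (u : C_c(G, X)) : Tendsto (fun χ : C_c(G, ℝ) => ∫ g, χ g • u g ∂μ) (cutoffs G)
      (𝓝 (∫ g, u g ∂μ)) := by
  rw [Metric.tendsto_nhds]
  intro ε hε
  set D := ∫ g, ‖u g‖ ∂μ with hD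
  have hD0 : 0 ≤ D := integral_nonneg fun g => norm_nonneg _
  filter_upwards [eventually_cutoffs_near u.hasCompactSupport.isCompact
    (show 0 < ε / (D + 1) by positivity)] with χ hχ
  have hint : Integrable (fun g => χ g • u g) μ :=
    (χ.continuous.smul u.continuous).integrable_of_hasCompactSupport
      u.hasCompactSupport.smul_left
  rw [dist_eq_norm, ← integral_sub hint (integrable_cc μ u)]
  calc _ ≤ ∫ g, ‖χ g • u g - u g‖ ∂μ := norm_integral_le_integral_norm _
    _ ≤ ∫ g, ε / (D + 1) * ‖u g‖ ∂μ := by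
      refine integral_mono (hint.sub (integrable_cc μ u)).norm
        ((integrable_cc μ u).norm.const_mul _) fun g => ?_
      by_cases hg : g ∈ tsupport u
      · have h1 : χ g • u g - u g = (χ g - 1) • u g := by rw [sub_smul, one_smul]
        simp only [h1, norm_smul, Real.norm_eq_abs]
        gcongr
        exact (hχ g hg).le
      · simp [image_eq_zero_of_notMem_tsupport hg]
    _ = ε / (D + 1) * D := by rw [integral_const_mul]
    _ < ε := by
      rw [div_mul_eq_mul_div, div_lt_iff₀ (by positivity)]
      nlinarith

variable {B : Type*} [NonUnitalCStarAlgebra B]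

/-- Domination in the order of `B`, not merely in norm, because the norm of L² is taken after
integrating. -/
theorem norm_toL2_le_of_le [PartialOrder B] [StarOrderedRing B] {f k : C_c(G, B)} {M : ℝ}
    (hM : 0 ≤ M) (h : ∀ g, star (f g) * f g ≤ M ^ 2 • (star (k g) * k g)) :
    ‖toL2 μ f‖ ≤ M * ‖toL2 μ k‖ := by
  refine le_of_sq_le_sq (α := ℝ) ?_ (by positivity)
  rw [mul_pow, norm_toL2, norm_toL2]
  have hf : Integrable (fun g => star (f g) * f g) μ := integrable_cc μ (star f * f)
  have hk : Integrable (fun g => star (k g) * k g) μ := integrable_cc μ (star k * k)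
  have h1 : ∫ g, star (f g) * f g ∂μ ≤ M ^ 2 • ∫ g, star (k g) * k g ∂μ := by
    rw [← integral_smul]
    exact integral_mono hf (hk.smul (M ^ 2)) h
  have h2 := CStarAlgebra.norm_le_norm_of_nonneg_of_le
    (integral_nonneg fun g => star_mul_self_nonneg (f g)) h1
  rwa [norm_smul, Real.norm_of_nonneg (by positivity)] at h2

/-- Pointwise multiplication by a real function on `C_c(G, B)`. -/
noncomputable def cutLin (χ : C_c(G, ℝ)) : C_c(G, B) →ₗ[ℂ] C_c(G, B) where
  toFun f := cutMul χ (f.toContinuousMap)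
  map_add' f k := by
    refine CompactlySupportedContinuousMap.ext fun g => ?_
    exact smul_add (χ g) (f g) (k g)
  map_smul' c f := by
    refine CompactlySupportedContinuousMap.ext fun g => ?_
    exact smul_comm (χ g) c (f g)

/-- The case c = 0 bounds multiplication by a cut-off function; the case c = 1 gives its convergence
to the identity. -/
theorem norm_cutLin_sub_le {χ : C_c(G, ℝ)} {f : C_c(G, B)} {M : ℝ} (c : ℝ)
    (h : ∀ g ∈ tsupport f, |χ g - c| ≤ M) (hM : 0 ≤ M) :
    ‖toL2 μ (cutLin χ f) - (c : ℂ) • toL2 μ f‖ ≤ M * ‖toL2 μ f‖ := by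
  let _ := CStarAlgebra.spectralOrder B
  have _ := CStarAlgebra.spectralOrderedRing B
  rw [← map_smul, ← map_sub]
  refine norm_toL2_le_of_le μ hM fun g => ?_
  have h1 : (cutLin χ f - (c : ℂ) • f) g = (χ g - c) • f g := by
    rw [sub_smul]
    change χ g • f g - (c : ℂ) • f g = _
    rw [Complex.coe_smul]
  rw [h1, star_smul, smul_mul_smul_comm, star_trivial]
  by_cases hg : g ∈ tsupport f
  · refine smul_le_smul_of_nonneg_right ?_ (star_mul_self_nonneg _)
    rw [← pow_two]
    exact sq_le_sq' (by linarith [abs_le.1 (h g hg)]) (abs_le.1 (h g hg)).2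
  · simp [image_eq_zero_of_notMem_tsupport hg]

/-- Multiplication by a real function on `L²(G, B)`. -/
noncomputable def cutL2 (χ : C_c(G, ℝ)) : L2 μ B →L[ℂ] L2 μ B :=
  extendL2 μ ((toL2 μ).comp (cutLin χ))

theorem norm_cutLin_le {χ : C_c(G, ℝ)} (h : ∀ g, χ g ∈ Set.Icc (0 : ℝ) 1) (f : C_c(G, B)) :
    ‖(toL2 μ).comp (cutLin χ) f‖ ≤ 1 * ‖toL2 μ f‖ := by
  have := norm_cutLin_sub_le (M := 1) μ 0 (χ := χ) (f := f)
    (fun g _ => by rw [sub_zero, abs_of_nonneg (h g).1]; exact (h g).2) zero_le_one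
  simpa using this

theorem cutL2_toL2 {χ : C_c(G, ℝ)} (h : ∀ g, χ g ∈ Set.Icc (0 : ℝ) 1) (f : C_c(G, B)) :
    cutL2 μ χ (toL2 μ f) = toL2 μ (cutLin χ f) := extendL2_toL2 μ (norm_cutLin_le μ h) f

theorem tendsto_cutL2 (F : L2 μ B) : Tendsto (fun χ => cutL2 μ χ F) (cutoffs G) (𝓝 F) := by
  refine tendsto_apply_of_dense (A₀ := ContinuousLinearMap.id ℂ (L2 μ B)) (C := 1) ?_
    (denseRange_toL2 μ) ?_ F
  · filter_upwards [eventually_cutoffs_mem] with χ hχ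
    exact norm_extendL2_le μ zero_le_one (norm_cutLin_le μ hχ)
  · rintro _ ⟨f, rfl⟩
    rw [Metric.tendsto_nhds]
    intro ε hε
    set D := ‖toL2 μ f‖
    filter_upwards [eventually_cutoffs_mem, eventually_cutoffs_near f.hasCompactSupport.isCompact
      (show 0 < ε / (D + 1) by positivity)] with χ hχ hχ'
    rw [cutL2_toL2 μ hχ, dist_eq_norm]
    have := norm_cutLin_sub_le (M := ε / (D + 1)) μ 1 (χ := χ) (f := f)
      (fun g hg => (hχ' g hg).le) (by positivity)
    rw [Complex.ofReal_one, one_smul] at this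
    refine this.trans_lt ?_
    rw [div_mul_eq_mul_div, div_lt_iff₀ (by positivity)]
    have : 0 ≤ D := norm_nonneg _
    nlinarith

/-- The product of the adjoint of a continuous function with a compactly supported one. -/
def starMul (f : C(G, B)) (k : C_c(G, B)) : C_c(G, B) where
  toFun g := star (f g) * k g
  continuous_toFun := by fun_prop
  hasCompactSupport' := k.hasCompactSupport.mul_left

theorem inner_cutMul (χ : C_c(G, ℝ)) (f : C(G, B)) (k : C_c(G, B)) :
    inner B (toL2 μ (cutMul χ f)) (toL2 μ k) = ∫ g, χ g • starMul f k g ∂μ := by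
  rw [inner_toL2]
  refine integral_congr_ae (Eventually.of_forall fun g => ?_)
  change star (χ g • f g) * k g = χ g • (star (f g) * k g)
  rw [star_smul, star_trivial, smul_mul_assoc]

variable {μ} in
theorem RepresentsL2.inner_eq {f : C(G, B)} {F : L2 μ B} (h : RepresentsL2 μ f F)
    (k : C_c(G, B)) : inner B F (toL2 μ k) = ∫ g, star (f g) * k g ∂μ := by
  have h1 := tendsto_integral_cutoffs μ (starMul f k)
  have h2 : Tendsto (fun χ => inner B (toL2 μ (cutMul χ f)) (toL2 μ k)) (cutoffs G)
      (𝓝 (inner B F (toL2 μ k))) :=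
    ((continuous_inner continuous_id continuous_const).tendsto F).comp h
  refine tendsto_nhds_unique h2 (h1.congr fun χ => ?_)
  rw [inner_cutMul]

/-- Multiplication by χ is self-adjoint on L², so χF and χf have the same pairings with C_c(G,B) and
coincide; and χF → F. With `RepresentsL2.inner_eq`, convergence of χf can thus be tested weakly. -/
theorem representsL2_of_inner {f : C(G, B)} {F : L2 μ B}
    (h : ∀ k : C_c(G, B), inner B F (toL2 μ k) = ∫ g, star (f g) * k g ∂μ) :
    RepresentsL2 μ f F := by
  refine (tendsto_cutL2 μ F).congr' ?_
  filter_upwards [eventually_cutoffs_mem] with χ hχ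
  refine ext_inner_toL2 μ fun k => ?_
  have hadj : AdjPair B (cutL2 μ χ : L2 μ B →L[ℂ] L2 μ B) (cutL2 μ χ) := by
    refine adjPair_of_toL2_toL2 μ fun f k => ?_
    rw [cutL2_toL2 μ hχ, cutL2_toL2 μ hχ, inner_toL2, inner_toL2]
    refine integral_congr_ae (Eventually.of_forall fun g => ?_)
    change star (χ g • f g) * k g = star (f g) * (χ g • k g)
    rw [star_smul, star_trivial, smul_mul_assoc, mul_smul_comm]
  rw [← hadj, ← HilbertModule.star_inner, ← HilbertModule.star_inner (B := B) _ (toL2 μ k),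
    cutL2_toL2 μ hχ, h, inner_cutMul]
  congr 1
  refine integral_congr_ae (Eventually.of_forall fun g => ?_)
  change star (f g) * (χ g • k g) = χ g • (star (f g) * k g)
  rw [mul_smul_comm]

variable {μ} in
theorem RepresentsL2.unique {f : C(G, B)} {F F' : L2 μ B} (h : RepresentsL2 μ f F)
    (h' : RepresentsL2 μ f F') : F = F' := tendsto_nhds_unique h h'

end Represent

end SquareIntegrable

/-! ### Square-integrable elements as adjointable kets -/

namespace SquareIntegrable

section Adj

variable {B E F : Type*} [NonUnitalCStarAlgebra B]
  [NormedAddCommGroup E] [NormedSpace ℂ E] [SMul Bᵐᵒᵖ E] [HilbertModule B E]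
  [NormedAddCommGroup F] [NormedSpace ℂ F] [SMul Bᵐᵒᵖ F] [HilbertModule B F]

variable (B) in
open Classical in
/-- The adjoint of an adjointable operator. -/
noncomputable def adj (X : E →L[ℂ] F) : F →L[ℂ] E :=
  if h : ∃ Y, AdjPair B X Y then h.choose else 0

protected theorem AdjPair.adj {X : E →L[ℂ] F} {Y : F →L[ℂ] E} (h : AdjPair B X Y) :
    AdjPair B X (adj B X) := by
  have h' : ∃ Y, AdjPair B X Y := ⟨Y, h⟩
  rw [SquareIntegrable.adj, dif_pos h']
  exact h'.choose_spec

theorem AdjPair.adj_eq {X : E →L[ℂ] F} {Y : F →L[ℂ] E} (h : AdjPair B X Y) :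
    SquareIntegrable.adj B X = Y := h.adj.unique h

end Adj

section Ket

variable {G : Type*} [Group G] [TopologicalSpace G] [IsTopologicalGroup G]
  [LocallyCompactSpace G] [T2Space G] [MeasurableSpace G] [BorelSpace G]
  (μ : Measure G) [IsFiniteMeasureOnCompacts μ]
  {B : Type*} {E : Type*} [NonUnitalCStarAlgebra B] [CStarAction G B]
  [NormedAddCommGroup E] [NormedSpace ℂ E] [CompleteSpace E] [SMul Bᵐᵒᵖ E]
  [HilbertModule B E] [HilbertAction G B E]

/-- The function `g ↦ γ_g(ξ) f(g)`. -/
noncomputable def ketFun (ξ : E) (f : C_c(G, B)) : C_c(G, E) where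
  toFun g := gact B g ξ <• f g
  continuous_toFun := continuous_act (continuous_gact B ξ) f.continuous
  hasCompactSupport' :=
    HasCompactSupport.intro f.hasCompactSupport.isCompact fun g hg => by
      rw [image_eq_zero_of_notMem_tsupport hg, act_zero]

theorem ketFun_apply (ξ : E) (f : C_c(G, B)) (g : G) : ketFun ξ f g = gact B g ξ <• f g := rfl

theorem ketLin_apply (ξ : E) (f : C_c(G, B)) : ketLin μ B ξ f = ∫ g, ketFun ξ f g ∂μ := rfl

theorem inner_ketLin (η ξ : E) (f : C_c(G, B)) :
    inner B η (ketLin μ B ξ f) = ∫ g, inner B η (gact B g ξ) * f g ∂μ := by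
  have h := (innerL B E η).integral_comp_comm (integrable_cc μ (ketFun ξ f))
  rw [ketLin_apply, ← innerL_apply, ← h]
  refine integral_congr_ae (Eventually.of_forall fun g => ?_)
  change inner B η (gact B g ξ <• f g) = _
  rw [HilbertModule.inner_act_right]

theorem inner_ketLin_eq (η ξ : E) (f : C_c(G, B)) :
    inner B η (ketLin μ B ξ f) = ∫ g, star (bra B ξ η g) * f g ∂μ := by
  rw [inner_ketLin]
  refine integral_congr_ae (Eventually.of_forall fun g => ?_)
  change _ = star (inner B (gact B g ξ) η) * f g
  rw [HilbertModule.star_inner]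

/-- `X` is the adjointable operator `|ξ⟩⟩` on `L²(G, B)`. -/
def IsKet (ξ : E) (X : L2 μ B →L[ℂ] E) : Prop :=
  (∃ Y, AdjPair B X Y) ∧ ∀ f, X (toL2 μ f) = ketLin μ B ξ f

variable {μ}

protected theorem IsKet.adj {ξ : E} {X : L2 μ B →L[ℂ] E} (h : IsKet μ ξ X) : AdjPair B X (adj B X) :=
  h.1.choose_spec.adj

/-- The adjoint of |ξ⟩⟩ is ⟨⟨ξ|, since both have the same pairings with C_c(G,B). -/
theorem IsKet.represents {ξ : E} {X : L2 μ B →L[ℂ] E} (h : IsKet μ ξ X) (η : E) :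
    RepresentsL2 μ (bra B ξ η) (SquareIntegrable.adj B X η) := by
  refine representsL2_of_inner μ fun k => ?_
  rw [h.adj.symm, h.2, inner_ketLin_eq]

theorem IsKet.mem {ξ : E} {X : L2 μ B →L[ℂ] E} (h : IsKet μ ξ X) : ξ ∈ squareIntegrable μ B :=
  fun η => ⟨_, h.represents η⟩

theorem IsKet.ket_eq {ξ : E} {X : L2 μ B →L[ℂ] E} (h : IsKet μ ξ X) : ket μ B ξ = X := by
  have h1 : ∀ f, ‖ketLin μ B ξ f‖ ≤ ‖X‖ * ‖toL2 μ f‖ := fun f => by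
    rw [← h.2]; exact X.le_opNorm _
  exact clm_ext_toL2 μ fun f => by rw [h.2]; exact extendL2_toL2 μ h1 f

/-- The tool for proving new elements square-integrable: once the ket is bounded on C_c(G,B), its
adjoint need only be found on a total set of η. -/
theorem isKet_of_bound {ξ : E} {C : ℝ} (hC : ∀ f, ‖ketLin μ B ξ f‖ ≤ C * ‖toL2 μ f‖) {S : Set E}
    (hS : Dense (Submodule.span ℂ S : Set E))
    (h : ∀ η ∈ S, ∃ F : L2 μ B, RepresentsL2 μ (bra B ξ η) F) : IsKet μ ξ (ket μ B ξ) := by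
  have h1 : ∀ f, ket μ B ξ (toL2 μ f) = ketLin μ B ξ f := extendL2_toL2 μ hC
  refine ⟨exists_adjPair_of_total _ hS fun η hη => ?_, h1⟩
  obtain ⟨F, hF⟩ := h η hη
  refine ⟨F, fun x => L2_induction μ (p := fun x => inner B (ket μ B ξ x) η = inner B x F)
    (isClosed_eq (continuous_inner (ket μ B ξ).continuous continuous_const)
      (continuous_inner continuous_id continuous_const)) (fun f => ?_) x⟩
  rw [← HilbertModule.star_inner, ← HilbertModule.star_inner (B := B) F, h1, hF.inner_eq,
    inner_ketLin_eq]

/-- The bra η ↦ ⟨⟨ξ|η is everywhere defined and linear, and its pairings with C_c(G,B) are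
continuous in η. Hence its graph is closed and it is bounded; its bound is also a bound for the ket.
-/
theorem isKet_ket {ξ : E} (h : ξ ∈ squareIntegrable μ B) : IsKet μ ξ (ket μ B ξ) := by
  choose Y hY using h
  have hY' : ∀ η f, inner B (Y η) (toL2 μ f) = inner B η (ketLin μ B ξ f) := fun η f => by
    rw [(hY η).inner_eq, inner_ketLin_eq]
  let L : E →ₗ[ℂ] L2 μ B :=
    { toFun := Y
      map_add' := fun η η' => ext_inner_toL2 μ fun f => by
        rw [← HilbertModule.star_inner, hY', inner_add_left, star_add,
          HilbertModule.inner_add_right, ← hY', ← hY', HilbertModule.star_inner,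
          HilbertModule.star_inner]
      map_smul' := fun c η => ext_inner_toL2 μ fun f => by
        rw [← HilbertModule.star_inner, hY', inner_smul_left, star_smul, star_star,
          RingHom.id_apply, HilbertModule.inner_smul_right, ← hY', HilbertModule.star_inner] }
  have hL : ∀ (u : ℕ → E) (x : E) (y : L2 μ B), Tendsto u atTop (𝓝 x) →
      Tendsto (L ∘ u) atTop (𝓝 y) → y = L x := by
    intro u x y hu hy
    refine ext_inner_toL2 μ fun f => ?_
    have h1 : Tendsto (fun n => inner B (toL2 μ f) (L (u n))) atTop (𝓝 (inner B (toL2 μ f) y)) :=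
      ((continuous_inner continuous_const continuous_id).tendsto y).comp hy
    have h2 : Tendsto (fun n => inner B (ketLin μ B ξ f) (u n)) atTop
        (𝓝 (inner B (ketLin μ B ξ f) x)) :=
      ((continuous_inner continuous_const continuous_id).tendsto x).comp hu
    have h3 : ∀ η, inner B (toL2 μ f) (L η) = inner B (ketLin μ B ξ f) η := fun η => by
      rw [← HilbertModule.star_inner, ← HilbertModule.star_inner (B := B) η]
      exact congrArg star (hY' η f)
    simp only [h3] at h1 ⊢
    exact tendsto_nhds_unique h1 h2
  let Yc : E →L[ℂ] L2 μ B := ContinuousLinearMap.ofSeqClosedGraph hL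
  have hYc : ∀ η, Yc η = Y η := fun η => rfl
  refine isKet_of_bound (C := ‖Yc‖) (S := Set.univ) (fun f => ?_) ?_ fun η _ => ⟨_, hY η⟩
  · refine norm_le_of_inner (B := B) (by positivity) ?_
    rw [← hY', ← hYc]
    calc _ ≤ ‖Yc (ketLin μ B ξ f)‖ * ‖toL2 μ f‖ := norm_inner_le _ _
      _ ≤ ‖Yc‖ * ‖ketLin μ B ξ f‖ * ‖toL2 μ f‖ := by gcongr; exact Yc.le_opNorm _
      _ = _ := by ring
  · rw [Submodule.span_univ]; exact dense_univ

theorem ketLin_add (ξ η : E) (f : C_c(G, B)) :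
    ketLin μ B (ξ + η) f = ketLin μ B ξ f + ketLin μ B η f := by
  rw [ketLin_apply, ketLin_apply, ketLin_apply,
    ← integral_add (integrable_cc μ _) (integrable_cc μ _)]
  refine integral_congr_ae (Eventually.of_forall fun g => ?_)
  simp only [ketFun_apply, map_add, add_act]

theorem ketLin_smul (c : ℂ) (ξ : E) (f : C_c(G, B)) :
    ketLin μ B (c • ξ) f = c • ketLin μ B ξ f := by
  rw [ketLin_apply, ketLin_apply, ← integral_smul]
  refine integral_congr_ae (Eventually.of_forall fun g => ?_)
  simp only [ketFun_apply, map_smul, smul_act]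

theorem IsKet.add {ξ η : E} {X Y : L2 μ B →L[ℂ] E} (h : IsKet μ ξ X) (h' : IsKet μ η Y) :
    IsKet μ (ξ + η) (X + Y) :=
  ⟨⟨_, h.adj.add h'.adj⟩, fun f => by
    rw [ketLin_add, add_apply, h.2, h'.2]⟩

theorem IsKet.smul {ξ : E} {X : L2 μ B →L[ℂ] E} (c : ℂ) (h : IsKet μ ξ X) :
    IsKet μ (c • ξ) (c • X) :=
  ⟨⟨_, h.adj.smul c⟩, fun f => by
    rw [ketLin_smul, smul_apply, h.2]⟩

theorem isKet_zero : IsKet μ (0 : E) (0 : L2 μ B →L[ℂ] E) :=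
  ⟨⟨_, AdjPair.zero⟩, fun f => by
    have := ketLin_smul (μ := μ) 0 (0 : E) f
    rw [zero_smul, zero_smul] at this
    rw [this]; rfl⟩

theorem IsKet.sub {ξ η : E} {X Y : L2 μ B →L[ℂ] E} (h : IsKet μ ξ X) (h' : IsKet μ η Y) :
    IsKet μ (ξ - η) (X - Y) := by
  have := h.add (h'.smul (-1))
  simpa [sub_eq_add_neg] using this

theorem IsKet.siNorm_eq {ξ : E} {X : L2 μ B →L[ℂ] E} (h : IsKet μ ξ X) :
    siNorm μ B ξ = ‖ξ‖ + ‖X‖ := by rw [siNorm, h.ket_eq]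

/-- The L²-element that represents a given continuous function is unique, so a bra-ket can only be
the product of operators. -/
theorem isBraKet_iff {ξ η : E} {X Y : L2 μ B →L[ℂ] E} (hξ : IsKet μ ξ X) (hη : IsKet μ η Y)
    {T : L2 μ B →L[ℂ] L2 μ B} : IsBraKet μ B ξ η T ↔ T = SquareIntegrable.adj B X ∘L Y := by
  constructor
  · intro h
    refine ContinuousLinearMap.ext fun F => ?_
    have h1 := h F
    rw [hη.ket_eq] at h1
    rw [ContinuousLinearMap.comp_apply]
    exact h1.unique (hξ.represents (Y F))
  · intro h F
    rw [hη.ket_eq, h, ContinuousLinearMap.comp_apply]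
    exact hξ.represents (Y F)

end Ket

end SquareIntegrable

/-! ### Weighted integrals and the diagonal action on L²(G,B) -/

namespace SquareIntegrable

section Integrals

variable {B : Type*} [NonUnitalCStarAlgebra B] {X : Type*} [MeasurableSpace X] {μ : Measure X}

theorem integral_mul_left_of_integrable {u : X → B} (hu : Integrable u μ) (a : B) :
    ∫ x, a * u x ∂μ = a * ∫ x, u x ∂μ :=
  (ContinuousLinearMap.mul ℝ B a).integral_comp_comm hu

theorem integral_mul_right_of_integrable {u : X → B} (hu : Integrable u μ) (a : B) :
    ∫ x, u x * a ∂μ = (∫ x, u x ∂μ) * a :=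
  ((ContinuousLinearMap.mul ℝ B).flip a).integral_comp_comm hu

theorem integral_star (u : X → B) : ∫ x, star (u x) ∂μ = star (∫ x, u x ∂μ) := by
  have := (starL' ℝ (A := B)).integral_comp_comm (μ := μ) u
  simpa using this

/-- A `⋆`-homomorphism as a bounded linear map. -/
noncomputable def homL {C : Type*} [NonUnitalCStarAlgebra C] (π : B →⋆ₙₐ[ℂ] C) : B →L[ℂ] C :=
  LinearMap.mkContinuous
    { toFun := π
      map_add' := map_add π
      map_smul' := map_smul π } 1 fun b => by
        rw [one_mul]; exact NonUnitalStarAlgHom.norm_apply_le π b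

theorem homL_apply {C : Type*} [NonUnitalCStarAlgebra C] (π : B →⋆ₙₐ[ℂ] C) (b : B) :
    homL π b = π b := rfl

theorem integral_hom {C : Type*} [NonUnitalCStarAlgebra C] (π : B →⋆ₙₐ[ℂ] C) {u : X → B}
    (hu : Integrable u μ) : ∫ x, π (u x) ∂μ = π (∫ x, u x ∂μ) :=
  (homL π).integral_comp_comm hu

end Integrals

section Weighted

variable {G : Type*} [TopologicalSpace G] [MeasurableSpace G] [BorelSpace G]
  (μ : Measure G) [IsFiniteMeasureOnCompacts μ] {B : Type*} [NonUnitalCStarAlgebra B]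

/-- A Cauchy-Schwarz inequality for weighted integrals in the order of a C⋆-algebra. -/
theorem star_integral_mul_integral_le [PartialOrder B] [StarOrderedRing B] {w : C_c(G, ℝ)}
    (hw : ∀ g, 0 ≤ w g) (y : C_c(G, B)) {c : ℝ} (hc : 0 < c) (hwc : ∫ g, w g ∂μ ≤ c) :
    star (∫ g, w g • y g ∂μ) * (∫ g, w g • y g ∂μ)
      ≤ c • ∫ g, w g • (star (y g) * y g) ∂μ := by
  have hiy : Integrable (fun g => w g • y g) μ :=
    (w.continuous.smul y.continuous).integrable_of_hasCompactSupport y.hasCompactSupport.smul_left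
  have hiS : Integrable (fun g => w g • (star (y g) * y g)) μ :=
    (w.continuous.smul (y.continuous.star.mul y.continuous)).integrable_of_hasCompactSupport
      w.hasCompactSupport.smul_right
  set z := ∫ g, w g • y g ∂μ with hz
  set S := ∫ g, w g • (star (y g) * y g) ∂μ with hS
  set d := ∫ g, w g ∂μ with hd
  -- The integrand is a positive square for each scale c; expanding it and using ∫w ≤ c gives the
  -- estimate after division by c. The form c·y − z avoids dividing by ∫w, which may vanish.
  have h1 : 0 ≤ ∫ g, w g • (star (c • y g - z) * (c • y g - z)) ∂μ :=
    integral_nonneg fun g => smul_nonneg (hw g) (star_mul_self_nonneg _)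
  have hexp : ∀ g, w g • (star (c • y g - z) * (c • y g - z))
      = (c * c) • (w g • (star (y g) * y g)) - c • (star (w g • y g) * z)
        - c • (star z * (w g • y g)) + w g • (star z * z) := fun g => by
    simp only [star_sub, star_smul, star_trivial, sub_mul, mul_sub, smul_mul_assoc,
      mul_smul_comm]
    module
  have hst : Integrable (fun g => star (w g • y g)) μ :=
    (starL' ℝ (A := B)).toContinuousLinearMap.integrable_comp hiy
  have hi2 : Integrable (fun g => star (w g • y g) * z) μ :=
    ((ContinuousLinearMap.mul ℝ B).flip z).integrable_comp hst
  have hi3 : Integrable (fun g => star z * (w g • y g)) μ :=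
    (ContinuousLinearMap.mul ℝ B (star z)).integrable_comp hiy
  have hi4 : Integrable (fun g => w g • (star z * z)) μ := (integrable_cc μ w).smul_const _
  have hval : ∫ g, w g • (star (c • y g - z) * (c • y g - z)) ∂μ
      = (c * c) • S - c • (star z * z) - c • (star z * z) + d • (star z * z) := by
    simp only [hexp]
    have hA : Integrable (fun g => (c * c) • (w g • (star (y g) * y g))) μ := hiS.smul (c * c)
    have hB : Integrable (fun g => c • (star (w g • y g) * z)) μ := hi2.smul c
    have hC : Integrable (fun g => c • (star z * (w g • y g))) μ := hi3.smul c
    have hAB : Integrable (fun g => (c * c) • (w g • (star (y g) * y g))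
      - c • (star (w g • y g) * z)) μ := hA.sub hB
    have hABC : Integrable (fun g => (c * c) • (w g • (star (y g) * y g))
      - c • (star (w g • y g) * z) - c • (star z * (w g • y g))) μ := hAB.sub hC
    rw [integral_add hABC hi4, integral_sub hAB hC, integral_sub hA hB, integral_smul,
      integral_smul, integral_smul, integral_smul_const, integral_mul_left_of_integrable hiy]
    have h5 : ∫ g, star (w g • y g) * z ∂μ = star z * z := by
      rw [integral_mul_right_of_integrable hst, integral_star]
    rw [h5]
  rw [hval] at h1
  have h2 : d • (star z * z) ≤ c • (star z * z) :=
    smul_le_smul_of_nonneg_right hwc (star_mul_self_nonneg z)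
  have h3 : c • (star z * z) ≤ (c * c) • S := by
    have h4 : (c * c) • S - c • (star z * z)
        = ((c * c) • S - c • (star z * z) - c • (star z * z) + d • (star z * z))
          + (c • (star z * z) - d • (star z * z)) := by abel
    rw [← sub_nonneg, h4]
    exact add_nonneg h1 (sub_nonneg.2 h2)
  have h4 := smul_le_smul_of_nonneg_left h3 (inv_nonneg.2 hc.le)
  rwa [smul_smul, smul_smul, inv_mul_cancel₀ hc.ne', one_smul, ← mul_assoc,
    inv_mul_cancel₀ hc.ne', one_mul] at h4

variable {X : Type*} [NormedAddCommGroup X] [NormedSpace ℝ X]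

theorem continuous_integral_of_support {P : Type*} [TopologicalSpace P] {F : P → G → X}
    (hF : Continuous F.uncurry) {K : Set G} (hK : IsCompact K)
    (h : ∀ p g, g ∉ K → F p g = 0) : Continuous fun p => ∫ g, F p g ∂μ := by
  rw [← continuousOn_univ]
  exact continuousOn_integral_of_compact_support hK hF.continuousOn fun p g _ hg => h p g hg

end Weighted

section Translate

variable {G : Type*} [Group G] [TopologicalSpace G] [IsTopologicalGroup G]
  [LocallyCompactSpace G] [T2Space G] [MeasurableSpace G] [BorelSpace G]
  (μ : Measure G) [μ.IsHaarMeasure]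
  {B : Type*} [NonUnitalCStarAlgebra B] [CStarAction G B]

theorem cact_mul (g h : G) (b : B) :
    CStarAction.act (g * h) b = CStarAction.act g (CStarAction.act h b) := by
  rw [map_mul]; rfl

theorem cact_one (b : B) : CStarAction.act (1 : G) b = b := by rw [map_one]; rfl

theorem cact_cact_inv (g : G) (b : B) : CStarAction.act g (CStarAction.act g⁻¹ b) = b := by
  rw [← cact_mul, mul_inv_cancel, cact_one]

/-- The diagonal action `(γ_g f)(h) = β_g(f(g⁻¹ h))` on `C_c(G, B)`. -/
noncomputable def transLin (g : G) : C_c(G, B) →ₗ[ℂ] C_c(G, B) where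
  toFun f :=
    { toFun := fun h => CStarAction.act g (f (g⁻¹ * h))
      continuous_toFun := continuous_cstarAct continuous_const (f.continuous.comp (by fun_prop))
      hasCompactSupport' := by
        refine HasCompactSupport.intro (f.hasCompactSupport.isCompact.smul g) fun h hh => ?_
        have : g⁻¹ * h ∉ tsupport f := fun h' => hh ⟨g⁻¹ * h, h', by simp⟩
        rw [image_eq_zero_of_notMem_tsupport this, map_zero] }
  map_add' f k := by
    refine CompactlySupportedContinuousMap.ext fun h => ?_
    exact map_add (CStarAction.act g) _ _
  map_smul' c f := by
    refine CompactlySupportedContinuousMap.ext fun h => ?_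
    exact map_smul (CStarAction.act g) _ _

theorem transLin_apply (g h : G) (f : C_c(G, B)) :
    transLin g f h = CStarAction.act g (f (g⁻¹ * h)) := rfl

theorem ccInner_trans (g : G) (f k : C_c(G, B)) :
    ccInner μ (transLin g f) (transLin g k) = CStarAction.act g (ccInner μ f k) := by
  refine Eq.trans ?_
    (integral_hom (CStarAction.act g) (integrable_cc μ (starMul f.toContinuousMap k)))
  rw [← integral_mul_left_eq_self _ g⁻¹]
  refine integral_congr_ae (Eventually.of_forall fun h => ?_)
  change _ = CStarAction.act g (star (f (g⁻¹ * h)) * k (g⁻¹ * h))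
  simp only [transLin_apply, map_mul, map_star]

theorem norm_toL2_trans (g : G) (f : C_c(G, B)) : ‖toL2 μ (transLin g f)‖ = ‖toL2 μ f‖ := by
  have h : ‖toL2 μ (transLin g f)‖ ^ 2 = ‖toL2 μ f‖ ^ 2 := by
    rw [HilbertModule.norm_sq_eq (B := B), HilbertModule.norm_sq_eq (B := B), inner_toL2,
      inner_toL2, ccInner_trans, norm_cstarAct]
  exact (sq_eq_sq₀ (norm_nonneg _) (norm_nonneg _)).1 h

theorem continuous_ccInner_trans (f k : C_c(G, B)) :
    Continuous fun g : G => ccInner μ (transLin g f) k := by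
  refine continuous_integral_of_support μ ?_ k.hasCompactSupport.isCompact fun g h hh => ?_
  · have h1 : Continuous fun p : G × G => f (p.1⁻¹ * p.2) := f.continuous.comp (by fun_prop)
    exact (continuous_cstarAct continuous_fst h1).star.mul (k.continuous.comp continuous_snd)
  · rw [image_eq_zero_of_notMem_tsupport hh, mul_zero]

/-- The operator on `L²(G, B)` extending `transLin`. -/
noncomputable def transL2 (g : G) : L2 μ B →L[ℂ] L2 μ B := extendL2 μ ((toL2 μ).comp (transLin g))

theorem transL2_toL2 (g : G) (f : C_c(G, B)) :
    transL2 μ g (toL2 μ f) = toL2 μ (transLin g f) :=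
  extendL2_toL2 μ (A := (toL2 μ).comp (transLin g)) (C := 1)
    (fun f => by rw [one_mul]; exact (norm_toL2_trans μ g f).le) f

theorem norm_transL2 (g : G) (x : L2 μ B) : ‖transL2 μ g x‖ = ‖x‖ :=
  L2_induction μ (p := fun x => ‖transL2 μ g x‖ = ‖x‖)
    (isClosed_eq (by fun_prop) (by fun_prop))
    (fun f => by rw [transL2_toL2, norm_toL2_trans]) x

theorem transL2_one (x : L2 μ B) : transL2 μ (1 : G) x = x := by
  refine L2_induction μ (p := fun x => transL2 μ (1 : G) x = x)
    (isClosed_eq (transL2 μ (1 : G)).continuous continuous_id) (fun f => ?_) x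
  rw [transL2_toL2]
  congr 1
  refine CompactlySupportedContinuousMap.ext fun h => ?_
  rw [transLin_apply, cact_one, inv_one, one_mul]

theorem transL2_mul (g g' : G) (x : L2 μ B) :
    transL2 μ (g * g') x = transL2 μ g (transL2 μ g' x) := by
  refine L2_induction μ (p := fun x => transL2 μ (g * g') x = transL2 μ g (transL2 μ g' x))
    (isClosed_eq (transL2 μ _).continuous ((transL2 μ g).continuous.comp
      (transL2 μ g').continuous)) (fun f => ?_) x
  rw [transL2_toL2, transL2_toL2, transL2_toL2]
  congr 1
  refine CompactlySupportedContinuousMap.ext fun h => ?_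
  rw [transLin_apply, transLin_apply, transLin_apply, cact_mul, mul_inv_rev, mul_assoc]

/-- The diagonal action of `G` on `L²(G, B)`. -/
noncomputable def transRep : Representation ℂ G (L2 μ B) where
  toFun g := (transL2 μ g).toLinearMap
  map_one' := LinearMap.ext (transL2_one μ)
  map_mul' g g' := LinearMap.ext (transL2_mul μ g g')

/-- With this action L²(G,B) is itself a Hilbert B,G-module, so statements about kets apply to its
own elements. -/
noncomputable instance : HilbertAction G B (L2 μ B) where
  act := transRep μ
  act_smul g x b := by
    refine L2_induction μ
      (p := fun x => transL2 μ g (x <• b) = transL2 μ g x <• CStarAction.act g b)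
      (isClosed_eq ((transL2 μ g).continuous.comp (continuous_L2_act μ b))
        ((continuous_L2_act μ _).comp (transL2 μ g).continuous)) (fun f => ?_) x
    rw [toL2_act, transL2_toL2, transL2_toL2, toL2_act]
    congr 1
    refine CompactlySupportedContinuousMap.ext fun h => ?_
    exact map_mul (CStarAction.act g) _ _
  inner_act g x y := by
    have hc : Continuous fun b : B => CStarAction.act g b := (homL (CStarAction.act g)).continuous
    refine L2_induction μ
      (p := fun x => inner B (transL2 μ g x) (transL2 μ g y) = CStarAction.act g (inner B x y))
      (isClosed_eq (continuous_inner (transL2 μ g).continuous continuous_const)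
        (hc.comp (continuous_inner continuous_id continuous_const))) (fun f => ?_) x
    refine L2_induction μ (p := fun y => inner B (transL2 μ g (toL2 μ f)) (transL2 μ g y)
        = CStarAction.act g (inner B (toL2 μ f) y))
      (isClosed_eq (continuous_inner continuous_const (transL2 μ g).continuous)
        (hc.comp (continuous_inner continuous_const continuous_id))) (fun k => ?_) y
    rw [transL2_toL2, transL2_toL2, inner_toL2, inner_toL2, ccInner_trans]
  continuous_act x := by
    change Continuous fun g => transL2 μ g x
    rw [continuous_iff_continuousAt]
    intro g₀
    have hmul : ∀ g : G, ‖transL2 μ g (B := B)‖ ≤ 1 := fun g =>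
      ContinuousLinearMap.opNorm_le_bound _ zero_le_one fun x => by rw [norm_transL2, one_mul]
    refine tendsto_apply_of_dense (Eventually.of_forall hmul) (denseRange_toL2 μ) ?_ x
    rintro _ ⟨f, rfl⟩
    rw [tendsto_iff_norm_sub_tendsto_zero]
    -- Expanding the square leaves only inner products of translates, each continuous in g by a
    -- compactly supported integral.
    have h1 : Tendsto (fun g => ‖transL2 μ g (toL2 μ f) - transL2 μ g₀ (toL2 μ f)‖ ^ 2) (𝓝 g₀)
        (𝓝 0) := by
      have h2 : ∀ g, ‖transL2 μ g (toL2 μ f) - transL2 μ g₀ (toL2 μ f)‖ ^ 2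
          = ‖CStarAction.act g (ccInner μ f f) - star (ccInner μ (transLin g f) (transLin g₀ f))
            - (ccInner μ (transLin g f) (transLin g₀ f) - CStarAction.act g₀ (ccInner μ f f))‖ := by
        intro g
        rw [HilbertModule.norm_sq_eq (B := B), inner_sub_right, inner_sub_left, inner_sub_left,
          transL2_toL2, transL2_toL2, inner_toL2, inner_toL2, inner_toL2, inner_toL2,
          ccInner_trans, ccInner_trans, star_ccInner]
      simp only [h2]
      have hc := continuous_ccInner_trans μ f (transLin g₀ f)
      have h3 : Continuous fun g : G =>
          ‖CStarAction.act g (ccInner μ f f) - star (ccInner μ (transLin g f) (transLin g₀ f))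
            - (ccInner μ (transLin g f) (transLin g₀ f) - CStarAction.act g₀ (ccInner μ f f))‖ :=
        (((CStarAction.continuous_act _).sub hc.star).sub (hc.sub continuous_const)).norm
      have h4 := h3.tendsto g₀
      rw [← h2 g₀, sub_self, norm_zero] at h4
      simpa using h4
    have h5 := h1.sqrt
    simpa [Real.sqrt_sq] using h5

theorem gact_toL2 (g : G) (f : C_c(G, B)) :
    gact B g (toL2 μ f) = toL2 μ (transLin g f) := transL2_toL2 μ g f

end Translate

end SquareIntegrable

/-! ### Boundedness of the operators ρ_K -/

namespace SquareIntegrable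

section Rho

variable {G : Type*} [Group G] [TopologicalSpace G] [IsTopologicalGroup G]
  [LocallyCompactSpace G] [T2Space G] [MeasurableSpace G] [BorelSpace G]
  (μ : Measure G) [μ.IsHaarMeasure]
  {B : Type*} [NonUnitalCStarAlgebra B] [CStarAction G B]

/-- Left translation on `C_c(G, X)`. -/
noncomputable def shift {X : Type*} [TopologicalSpace X] [Zero X] (g : G) (f : C_c(G, X)) :
    C_c(G, X) where
  toFun h := f (g⁻¹ * h)
  continuous_toFun := f.continuous.comp (by fun_prop)
  hasCompactSupport' := by
    refine HasCompactSupport.intro (f.hasCompactSupport.isCompact.smul g) fun h hh => ?_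
    have : g⁻¹ * h ∉ tsupport f := fun h' => hh ⟨g⁻¹ * h, h', by simp⟩
    exact image_eq_zero_of_notMem_tsupport this

/-- Inversion on `C_c(G, X)`. -/
noncomputable def invert {X : Type*} [TopologicalSpace X] [Zero X] (f : C_c(G, X)) :
    C_c(G, X) where
  toFun h := f h⁻¹
  continuous_toFun := f.continuous.comp continuous_inv
  hasCompactSupport' := f.hasCompactSupport.comp_homeomorph (Homeomorph.inv G)

theorem hasCompactSupport_kernel {X : Type*} [Zero X] {F : G × G → X} {S T : Set G}
    (hS : IsCompact S) (hT : IsCompact T) (h : ∀ g h, F (g, h) ≠ 0 → g⁻¹ * h ∈ S ∧ h ∈ T) :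
    HasCompactSupport F := by
  refine HasCompactSupport.intro ((hT.mul hS.inv).prod hT) fun p hp => ?_
  by_contra hne
  obtain ⟨h1, h2⟩ := h p.1 p.2 hne
  exact hp ⟨Set.mem_mul.2 ⟨p.2, h2, (p.1⁻¹ * p.2)⁻¹, Set.inv_mem_inv.2 h1, by group⟩, h2⟩

/-- A Schur type estimate for the operators `ρ_K`. -/
theorem norm_rhoFun_le {K : C_c(G, B)} {φ : C_c(G, ℝ)} {L : C(G, B)} {M c c' : ℝ}
    (hφ : ∀ x, 0 ≤ φ x) (hL : ∀ x, ‖L x‖ ≤ M) (hK : ∀ x, K x = φ x • L x) (hc0 : 0 < c)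
    (hc : ∫ x, φ x ∂μ ≤ c) (hc' : ∫ x, φ x⁻¹ ∂μ ≤ c') (f : C_c(G, B)) :
    ‖toL2 μ (rhoFun μ K f)‖ ≤ M * √(c * c') * ‖toL2 μ f‖ := by
  let _ := CStarAlgebra.spectralOrder B
  have _ := CStarAlgebra.spectralOrderedRing B
  have hM : 0 ≤ M := (norm_nonneg _).trans (hL 1)
  have hc'0 : 0 ≤ c' := (integral_nonneg fun x => hφ x⁻¹).trans hc'
  let F : G → G → B := fun g h => φ (g⁻¹ * h) • (star (f h) * f h)
  have hFc : Continuous F.uncurry := by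
    have h1 : Continuous fun p : G × G => φ (p.1⁻¹ * p.2) := φ.continuous.comp (by fun_prop)
    have h2 : Continuous fun p : G × G => f p.2 := f.continuous.comp continuous_snd
    exact h1.smul (h2.star.mul h2)
  have hFs : HasCompactSupport F.uncurry := by
    refine hasCompactSupport_kernel φ.hasCompactSupport.isCompact f.hasCompactSupport.isCompact
      fun g h hne => ⟨?_, ?_⟩
    · by_contra h1
      exact hne (by simp [F, Function.uncurry, image_eq_zero_of_notMem_tsupport h1])
    · by_contra h1
      exact hne (by simp [F, Function.uncurry, image_eq_zero_of_notMem_tsupport h1])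
  -- First half of the Schur test: the weighted Cauchy–Schwarz inequality with weight h ↦ φ(g⁻¹h),
  -- whose integral is ∫φ by left invariance.
  have hpt : ∀ g, star (rhoFun μ K f g) * rhoFun μ K f g ≤ (c * M ^ 2) • ∫ h, F g h ∂μ := by
    intro g
    let y : C_c(G, B) :=
      { toFun := fun h => CStarAction.act g (L (g⁻¹ * h)) * f h
        continuous_toFun := (continuous_cstarAct continuous_const
          (L.continuous.comp (by fun_prop))).mul f.continuous
        hasCompactSupport' := f.hasCompactSupport.mul_left }
    have h1 := star_integral_mul_integral_le μ (w := shift g φ) (fun h => hφ _) y hc0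
      (by rw [← integral_mul_left_eq_self _ g⁻¹] at hc; exact hc)
    have h2 : rhoFun μ K f g = ∫ h, shift g φ h • y h ∂μ := by
      rw [rhoFun_apply]
      refine integral_congr_ae (Eventually.of_forall fun h => ?_)
      change _ = φ (g⁻¹ * h) • (CStarAction.act g (L (g⁻¹ * h)) * f h)
      simp only [hK]
      have h3 := (homL (CStarAction.act g : B →⋆ₙₐ[ℂ] B)).map_smul_of_tower (φ (g⁻¹ * h))
        (L (g⁻¹ * h))
      simp only [homL_apply] at h3
      rw [h3, smul_mul_assoc]
    rw [h2]
    refine h1.trans ?_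
    rw [mul_smul]
    refine smul_le_smul_of_nonneg_left ?_ hc0.le
    rw [← integral_smul]
    refine integral_mono ?_ ?_ fun h => ?_
    · exact ((shift g φ).continuous.smul
        (y.continuous.star.mul y.continuous)).integrable_of_hasCompactSupport
        (shift g φ).hasCompactSupport.smul_right
    · refine Integrable.smul (M ^ 2) ?_
      exact ((shift g φ).continuous.smul
        (f.continuous.star.mul f.continuous)).integrable_of_hasCompactSupport
        (shift g φ).hasCompactSupport.smul_right
    · change φ (g⁻¹ * h) • (star (y h) * y h) ≤ M ^ 2 • (φ (g⁻¹ * h) • (star (f h) * f h))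
      rw [smul_comm]
      refine smul_le_smul_of_nonneg_left ?_ (hφ _)
      set a := CStarAction.act g (L (g⁻¹ * h)) with ha
      have hya : y h = a * f h := rfl
      rw [hya, star_mul, mul_assoc, ← mul_assoc (star a)]
      have h4 := CStarAlgebra.star_left_conjugate_le_norm_smul (a := f h) (b := star a * a)
        (hb := IsSelfAdjoint.star_mul_self a)
      rw [mul_assoc] at h4
      refine h4.trans (smul_le_smul_of_nonneg_right ?_ (star_mul_self_nonneg _))
      rw [CStarRing.norm_star_mul_self, ← pow_two, ha, norm_cstarAct]
      gcongr
      exact hL _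
  -- Second half: integrating φ(g⁻¹h) over g gives ∫φ(x⁻¹)dx. As `G` need not be unimodular, this is
  -- a second constant, independent of ∫φ.
  have hswap : ∫ g, ∫ h, F g h ∂μ ∂μ = (∫ x, φ x⁻¹ ∂μ) • ∫ h, star (f h) * f h ∂μ := by
    rw [integral_integral_swap_of_hasCompactSupport hFc hFs, ← integral_smul]
    refine integral_congr_ae (Eventually.of_forall fun h => ?_)
    change ∫ g, φ (g⁻¹ * h) • (star (f h) * f h) ∂μ = _
    rw [integral_smul_const]
    congr 1
    have := integral_mul_left_eq_self (μ := μ) (fun x => φ x⁻¹) h⁻¹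
    simpa [mul_inv_rev] using this
  have hFi : Integrable (fun g => ∫ h, F g h ∂μ) μ := by
    refine Continuous.integrable_of_hasCompactSupport ?_ ?_
    · refine continuous_integral_of_support μ hFc f.hasCompactSupport.isCompact fun g h hh => ?_
      simp [F, image_eq_zero_of_notMem_tsupport hh]
    · refine HasCompactSupport.intro (hFs.isCompact.image continuous_fst) fun g hg => ?_
      refine integral_eq_zero_of_ae (Eventually.of_forall fun h => ?_)
      by_contra hne
      exact hg ⟨(g, h), subset_tsupport _ hne, rfl⟩
  refine le_of_sq_le_sq (α := ℝ) ?_ (by positivity)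
  rw [mul_pow, mul_pow, Real.sq_sqrt (by positivity), norm_toL2, norm_toL2]
  have h1 : ∫ g, star (rhoFun μ K f g) * rhoFun μ K f g ∂μ
      ≤ (c * M ^ 2 * c') • ∫ h, star (f h) * f h ∂μ := by
    have h2 : ∫ g, star (rhoFun μ K f g) * rhoFun μ K f g ∂μ
        ≤ ∫ g, (c * M ^ 2) • ∫ h, F g h ∂μ ∂μ :=
      integral_mono (integrable_cc μ (star (rhoFun μ K f) * rhoFun μ K f))
        (hFi.smul (c * M ^ 2)) hpt
    refine h2.trans ?_
    rw [integral_smul, hswap, mul_smul (c * M ^ 2) c']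
    refine smul_le_smul_of_nonneg_left ?_ (by positivity)
    exact smul_le_smul_of_nonneg_right hc' (integral_nonneg fun h => star_mul_self_nonneg _)
  have h2 := CStarAlgebra.norm_le_norm_of_nonneg_of_le
    (integral_nonneg fun g => star_mul_self_nonneg _) h1
  rw [norm_smul, Real.norm_of_nonneg (by positivity)] at h2
  calc _ ≤ _ := h2
    _ = _ := by ring

/-- The constant depends only on the compact set that carries the kernel, so uniform convergence of
kernels with common compact support gives norm convergence of the operators. The Schur weight is a
cut-off function equal to 1 on `S`. -/
theorem exists_bound_rhoFun {S : Set G} (hS : IsCompact S) :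
    ∃ C > 0, ∀ K : C_c(G, B), (∀ x, x ∉ S → K x = 0) → ∀ M, (∀ x, ‖K x‖ ≤ M) →
      ∀ f, ‖toL2 μ (rhoFun μ K f)‖ ≤ C * M * ‖toL2 μ f‖ := by
  obtain ⟨χ, hχ1, hχ⟩ := exists_cutoff hS
  have h0 : 0 ≤ ∫ x, χ x ∂μ := integral_nonneg fun x => (hχ x).1
  have h0' : 0 ≤ ∫ x, χ x⁻¹ ∂μ := integral_nonneg fun x => (hχ x⁻¹).1
  refine ⟨√((∫ x, χ x ∂μ + 1) * (∫ x, χ x⁻¹ ∂μ + 1)), by positivity, fun K hK M hM f => ?_⟩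
  have := norm_rhoFun_le μ (K := K) (φ := χ) (L := K.toContinuousMap) (M := M)
    (c := ∫ x, χ x ∂μ + 1) (c' := ∫ x, χ x⁻¹ ∂μ + 1) (fun x => (hχ x).1) hM (fun x => ?_)
    (by positivity) (by linarith) (by linarith) f
  · rwa [mul_comm M] at this
  · change K x = χ x • K x
    by_cases hx : x ∈ S
    · rw [hχ1 x hx, one_smul]
    · rw [hK x hx, smul_zero]

theorem exists_norm_bound_cc {X : Type*} [NormedAddCommGroup X] (K : C_c(G, X)) :
    ∃ M, ∀ x, ‖K x‖ ≤ M :=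
  K.hasCompactSupport.exists_bound_of_continuous K.continuous

theorem rhoFun_bounded (K : C_c(G, B)) :
    ∃ C, ∀ f, ‖(toL2 μ).comp (rhoLin μ K) f‖ ≤ C * ‖toL2 μ f‖ := by
  obtain ⟨C, -, h⟩ := exists_bound_rhoFun μ (B := B) K.hasCompactSupport.isCompact
  obtain ⟨M, hM⟩ := exists_norm_bound_cc K
  exact ⟨C * M, h K (fun x hx => image_eq_zero_of_notMem_tsupport hx) M hM⟩

theorem rho_toL2 (K f : C_c(G, B)) : rho μ K (toL2 μ f) = toL2 μ (rhoFun μ K f) := by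
  obtain ⟨C, hC⟩ := rhoFun_bounded μ K
  exact extendL2_toL2 μ hC f

theorem exists_norm_rho_le {S : Set G} (hS : IsCompact S) :
    ∃ C > 0, ∀ K : C_c(G, B), (∀ x, x ∉ S → K x = 0) → ∀ M, (∀ x, ‖K x‖ ≤ M) →
      ‖rho μ K‖ ≤ C * M := by
  obtain ⟨C, hC, h⟩ := exists_bound_rhoFun μ (B := B) hS
  refine ⟨C, hC, fun K hK M hM => ?_⟩
  have hM0 : 0 ≤ M := (norm_nonneg _).trans (hM 1)
  exact opNorm_le_of_toL2 μ (by positivity) fun f => by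
    rw [rho_toL2]; exact h K hK M hM f

theorem rho_add (K K' : C_c(G, B)) : rho μ (K + K') = rho μ K + rho μ K' := by
  refine clm_ext_toL2 μ fun f => ?_
  rw [add_apply, rho_toL2, rho_toL2, rho_toL2, ← map_add]
  congr 1
  refine CompactlySupportedContinuousMap.ext fun g => ?_
  refine Eq.trans ?_ (integral_add (integrable_rho μ K f g) (integrable_rho μ K' f g))
  refine integral_congr_ae (Eventually.of_forall fun h => ?_)
  change CStarAction.act g (K (g⁻¹ * h) + K' (g⁻¹ * h)) * f h = _
  simp only [map_add, add_mul]

theorem rho_smul (c : ℂ) (K : C_c(G, B)) : rho μ (c • K) = c • rho μ K := by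
  refine clm_ext_toL2 μ fun f => ?_
  rw [smul_apply, rho_toL2, rho_toL2, ← map_smul]
  congr 1
  refine CompactlySupportedContinuousMap.ext fun g => ?_
  refine Eq.trans ?_ (integral_smul c fun h => CStarAction.act g (K (g⁻¹ * h)) * f h)
  refine integral_congr_ae (Eventually.of_forall fun h => ?_)
  change CStarAction.act g (c • K (g⁻¹ * h)) * f h = _
  simp only [map_smul, smul_mul_assoc]

theorem rho_zero : rho μ (0 : C_c(G, B)) = 0 := by
  have := rho_smul μ 0 (0 : C_c(G, B))
  rwa [zero_smul, zero_smul] at this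

theorem rho_sub (K K' : C_c(G, B)) : rho μ (K - K') = rho μ K - rho μ K' := by
  have := rho_add μ K ((-1 : ℂ) • K')
  rw [rho_smul] at this
  simpa [sub_eq_add_neg] using this

end Rho

end SquareIntegrable

/-! ### Kets, convolution and the algebra of C*_r(G,B) -/

namespace SquareIntegrable

section Equivariant

variable {G : Type*} [Group G] [TopologicalSpace G] [IsTopologicalGroup G]
  [LocallyCompactSpace G] [T2Space G] [MeasurableSpace G] [BorelSpace G]
  {μ : Measure G} [μ.IsHaarMeasure]
  {B : Type*} [NonUnitalCStarAlgebra B] [CStarAction G B]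
  {E F : Type*} [NormedAddCommGroup E] [NormedSpace ℂ E] [CompleteSpace E] [SMul Bᵐᵒᵖ E]
  [HilbertModule B E] [HilbertAction G B E]
  [NormedAddCommGroup F] [NormedSpace ℂ F] [CompleteSpace F] [SMul Bᵐᵒᵖ F]
  [HilbertModule B F] [HilbertAction G B F]

/-- The involution `K ↦ K†`, `K†(g) = β_g(K(g⁻¹))`, on `C_c(G, B)`. -/
noncomputable def dagger (K : C_c(G, B)) : C_c(G, B) where
  toFun g := CStarAction.act g (K g⁻¹)
  continuous_toFun := continuous_cstarAct continuous_id (invert K).continuous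
  hasCompactSupport' :=
    HasCompactSupport.intro (invert K).hasCompactSupport.isCompact fun g hg => by
      have : K g⁻¹ = 0 := image_eq_zero_of_notMem_tsupport (f := invert K) hg
      rw [this, map_zero]

theorem dagger_apply (K : C_c(G, B)) (g : G) : dagger K g = CStarAction.act g (K g⁻¹) := rfl

theorem dagger_dagger (K : C_c(G, B)) : dagger (dagger K) = K :=
  CompactlySupportedContinuousMap.ext fun g => by
    rw [dagger_apply, dagger_apply, cact_cact_inv, inv_inv]

/-- The integral kernel of ρ at K† is the transpose of the one at K; this is what adjoints and kets
on L²(G,B) amount to. -/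
theorem act_dagger (K : C_c(G, B)) (g h : G) :
    CStarAction.act g (dagger K (g⁻¹ * h)) = CStarAction.act h (K (h⁻¹ * g)) := by
  rw [dagger_apply, ← cact_mul, mul_inv_cancel_left, mul_inv_rev, inv_inv]

/-- Convolution is evaluation of the ket at K†, hence depends on ξ only through |ξ⟩⟩. -/
theorem convAct_eq (ξ : E) (K : C_c(G, B)) : convAct μ B ξ K = ketLin μ B ξ (dagger K) := by
  rw [ketLin_apply]
  refine integral_congr_ae (Eventually.of_forall fun g => ?_)
  exact gact_smul B g ξ (K g⁻¹)

theorem IsKet.apply_dagger {ξ : E} {X : L2 μ B →L[ℂ] E} (h : IsKet μ ξ X) (K : C_c(G, B)) :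
    X (toL2 μ (dagger K)) = convAct μ B ξ K := by rw [h.2, convAct_eq]

/-- An adjointable operator is automatically `B`-linear and passes through the integral;
equivariance moves it past γ_g. -/
protected theorem IsKet.map {ξ : E} {X : L2 μ B →L[ℂ] E} (h : IsKet μ ξ X) {T : E →L[ℂ] F} {S : F →L[ℂ] E}
    (hT : AdjPair B T S) (hTg : ∀ (g : G) x, T (gact B g x) = gact B g (T x)) :
    IsKet μ (T ξ) (T ∘L X) := by
  refine ⟨⟨_, hT.comp h.adj⟩, fun f => ?_⟩
  rw [ContinuousLinearMap.comp_apply, h.2, ketLin_apply, ketLin_apply,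
    ← T.integral_comp_comm (integrable_cc μ (ketFun ξ f))]
  refine integral_congr_ae (Eventually.of_forall fun g => ?_)
  simp only [ketFun_apply, hT.map_act, hTg]

theorem ketLin_transLin (ξ : E) (g : G) (f : C_c(G, B)) :
    ketLin μ B ξ (transLin g f) = gact B g (ketLin μ B ξ f) := by
  rw [ketLin_apply, ketLin_apply, ← (gact B g).integral_comp_comm (integrable_cc μ (ketFun ξ f)),
    ← integral_mul_left_eq_self _ g]
  refine integral_congr_ae (Eventually.of_forall fun h => ?_)
  simp only [ketFun_apply, transLin_apply, gact_smul, inv_mul_cancel_left, gact_mul]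
  rfl

theorem IsKet.equivariant {ξ : E} {X : L2 μ B →L[ℂ] E} (h : IsKet μ ξ X) (g : G) (x : L2 μ B) :
    X (gact B g x) = gact B g (X x) :=
  L2_induction μ (p := fun x => X (gact B g x) = gact B g (X x))
    (isClosed_eq (X.continuous.comp (gact B g).continuous)
      ((gact B g).continuous.comp X.continuous))
    (fun f => by rw [gact_toL2, h.2, h.2, ketLin_transLin]) x

/-- Paired with l in C_c(G,B), both sides are iterated integrals of one compactly supported function
of two variables, so Fubini applies. -/
theorem ketLin_toL2 (k f : C_c(G, B)) :
    ketLin μ B (toL2 μ k) f = toL2 μ (rhoFun μ (dagger k) f) := by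
  refine ext_inner_toL2 μ fun l => ?_
  rw [inner_ketLin, inner_toL2]
  let Φ : G → G → B := fun g h => star (l h) * CStarAction.act g (k (g⁻¹ * h)) * f g
  have hc : Continuous Φ.uncurry := by
    have h1 : Continuous fun p : G × G => k (p.1⁻¹ * p.2) := k.continuous.comp (by fun_prop)
    exact ((l.continuous.comp continuous_snd).star.mul
      (continuous_cstarAct continuous_fst h1)).mul (f.continuous.comp continuous_fst)
  have hs : HasCompactSupport Φ.uncurry := by
    refine HasCompactSupport.intro
      (f.hasCompactSupport.isCompact.prod l.hasCompactSupport.isCompact) fun p hp => ?_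
    by_cases h1 : p.1 ∈ tsupport f
    · have h2 : p.2 ∉ tsupport l := fun h2 => hp ⟨h1, h2⟩
      simp [Φ, Function.uncurry, image_eq_zero_of_notMem_tsupport h2]
    · simp [Φ, Function.uncurry, image_eq_zero_of_notMem_tsupport h1]
  have h1 : ∀ g, inner B (toL2 μ l) (gact B g (toL2 μ k)) * f g = ∫ h, Φ g h ∂μ := by
    intro g
    rw [gact_toL2, inner_toL2]
    exact (integral_mul_right_of_integrable
      (integrable_cc μ (starMul l.toContinuousMap (transLin g k))) (f g)).symm
  have h2 : ∀ h, star (l h) * rhoFun μ (dagger k) f h = ∫ g, Φ g h ∂μ := by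
    intro h
    rw [rhoFun_apply, ← integral_mul_left_of_integrable (integrable_rho μ (dagger k) f h)]
    refine integral_congr_ae (Eventually.of_forall fun g => ?_)
    simp only [Φ, act_dagger, mul_assoc]
  simp only [h1, ccInner, h2]
  exact integral_integral_swap_of_hasCompactSupport hc hs

theorem adjPair_rho (K : C_c(G, B)) : AdjPair B (rho μ K) (rho μ (star (dagger K))) := by
  refine adjPair_of_toL2_toL2 μ fun f k => ?_
  rw [rho_toL2, rho_toL2, inner_toL2, inner_toL2]
  let Φ : G → G → B := fun g h => star (CStarAction.act g (K (g⁻¹ * h)) * f h) * k g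
  have hc : Continuous Φ.uncurry := by
    have h1 : Continuous fun p : G × G => K (p.1⁻¹ * p.2) := K.continuous.comp (by fun_prop)
    exact ((continuous_cstarAct continuous_fst h1).mul
      (f.continuous.comp continuous_snd)).star.mul (k.continuous.comp continuous_fst)
  have hs : HasCompactSupport Φ.uncurry := by
    refine HasCompactSupport.intro
      (k.hasCompactSupport.isCompact.prod f.hasCompactSupport.isCompact) fun p hp => ?_
    by_cases h1 : p.1 ∈ tsupport k
    · have h2 : p.2 ∉ tsupport f := fun h2 => hp ⟨h1, h2⟩
      simp [Φ, Function.uncurry, image_eq_zero_of_notMem_tsupport h2]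
    · simp [Φ, Function.uncurry, image_eq_zero_of_notMem_tsupport h1]
  have h1 : ∀ g, star (rhoFun μ K f g) * k g = ∫ h, Φ g h ∂μ := by
    intro g
    rw [rhoFun_apply, ← integral_star]
    have hi : Integrable (fun h => star (CStarAction.act g (K (g⁻¹ * h)) * f h)) μ :=
      (starL' ℝ (A := B)).toContinuousLinearMap.integrable_comp (integrable_rho μ K f g)
    rw [← integral_mul_right_of_integrable hi]
  have h2 : ∀ h, star (f h) * rhoFun μ (star (dagger K)) k h = ∫ g, Φ g h ∂μ := by
    intro h
    rw [rhoFun_apply, ← integral_mul_left_of_integrable (integrable_rho μ (star (dagger K)) k h)]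
    refine integral_congr_ae (Eventually.of_forall fun g => ?_)
    change star (f h) * (CStarAction.act h (star (dagger K (h⁻¹ * g))) * k g) = _
    simp only [Φ, map_star, act_dagger, star_mul, mul_assoc]
  simp only [h1, ccInner, h2]
  exact integral_integral_swap_of_hasCompactSupport hc hs

/-- The operators ρ_K are thus themselves kets, so their algebra can be read off from the rules for
kets. -/
theorem isKet_toL2 (k : C_c(G, B)) : IsKet μ (toL2 μ k) (rho μ (dagger k)) :=
  ⟨⟨_, adjPair_rho _⟩, fun f => by rw [rho_toL2, ketLin_toL2]⟩

theorem isKet_toL2_dagger (K : C_c(G, B)) : IsKet μ (toL2 μ (dagger K)) (rho μ K) := by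
  have := isKet_toL2 (μ := μ) (dagger K)
  rwa [dagger_dagger] at this

/-- Apply the equivariant operator |ξ⟩⟩ to K† in L²(G,B), whose ket is ρ_K. -/
protected theorem IsKet.convAct {ξ : E} {X : L2 μ B →L[ℂ] E} (h : IsKet μ ξ X) (K : C_c(G, B)) :
    IsKet μ (convAct μ B ξ K) (X ∘L rho μ K) := by
  have := (isKet_toL2_dagger (μ := μ) K).map h.adj h.equivariant
  rwa [h.apply_dagger] at this

theorem IsKet.unique {ξ : E} {X Y : L2 μ B →L[ℂ] E} (h : IsKet μ ξ X) (h' : IsKet μ ξ Y) :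
    X = Y := by rw [← h.ket_eq, h'.ket_eq]

/-- Both sides are kets of the element ρ_L(K†) of L²(G,B), so no computation with a triple integral
is needed. -/
theorem rho_comp_rho (L K : C_c(G, B)) :
    rho μ L ∘L rho μ K = rho μ (dagger (rhoFun μ L (dagger K))) := by
  have h := (isKet_toL2_dagger (μ := μ) K).map (adjPair_rho L)
    (isKet_toL2_dagger (μ := μ) L).equivariant
  rw [rho_toL2] at h
  exact h.unique (isKet_toL2 _)

/-- The multiplication operator `f ↦ (g ↦ β_g(b) f(g))` on `C_c(G, B)`. -/
noncomputable def mulLin (b : B) : C_c(G, B) →ₗ[ℂ] C_c(G, B) where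
  toFun f :=
    { toFun := fun g => CStarAction.act g b * f g
      continuous_toFun := (CStarAction.continuous_act b).mul f.continuous
      hasCompactSupport' := f.hasCompactSupport.mul_left }
  map_add' f k := CompactlySupportedContinuousMap.ext fun g => mul_add _ (f g) (k g)
  map_smul' c f := CompactlySupportedContinuousMap.ext fun g => mul_smul_comm c _ (f g)

theorem mulLin_apply (b : B) (f : C_c(G, B)) (g : G) :
    mulLin b f g = CStarAction.act g b * f g := rfl

theorem norm_toL2_mulLin_le (b : B) (f : C_c(G, B)) :
    ‖(toL2 μ).comp (mulLin b) f‖ ≤ ‖b‖ * ‖toL2 μ f‖ := by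
  let _ := CStarAlgebra.spectralOrder B
  have _ := CStarAlgebra.spectralOrderedRing B
  refine norm_toL2_le_of_le μ (norm_nonneg b) fun g => ?_
  rw [mulLin_apply, star_mul, mul_assoc, ← mul_assoc (star (CStarAction.act g b))]
  have h4 := CStarAlgebra.star_left_conjugate_le_norm_smul (a := f g)
    (b := star (CStarAction.act g b) * CStarAction.act g b)
    (hb := IsSelfAdjoint.star_mul_self _)
  rwa [mul_assoc, CStarRing.norm_star_mul_self, ← pow_two, norm_cstarAct] at h4

variable (μ) in
/-- The bounded operator `M_b` on `L²(G, B)` with `(M_b f)(g) = β_g(b) f(g)`. -/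
noncomputable def mulL2 (b : B) : L2 μ B →L[ℂ] L2 μ B := extendL2 μ ((toL2 μ).comp (mulLin b))

theorem mulL2_toL2 (b : B) (f : C_c(G, B)) : mulL2 μ b (toL2 μ f) = toL2 μ (mulLin b f) :=
  extendL2_toL2 μ (norm_toL2_mulLin_le b) f

theorem norm_mulL2_le (b : B) : ‖mulL2 μ b‖ ≤ ‖b‖ :=
  norm_extendL2_le μ (norm_nonneg b) (norm_toL2_mulLin_le b)

theorem adjPair_mulL2 (b : B) : AdjPair B (mulL2 μ b) (mulL2 μ (star b)) := by
  refine adjPair_of_toL2_toL2 μ fun f k => ?_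
  rw [mulL2_toL2, mulL2_toL2, inner_toL2, inner_toL2]
  refine integral_congr_ae (Eventually.of_forall fun g => ?_)
  simp only [mulLin_apply, star_mul, map_star, mul_assoc]

theorem mulL2_sub (a b : B) : mulL2 μ (a - b) = mulL2 μ a - mulL2 μ b := by
  refine clm_ext_toL2 μ fun f => ?_
  rw [sub_apply, mulL2_toL2, mulL2_toL2, mulL2_toL2, ← map_sub]
  congr 1
  refine CompactlySupportedContinuousMap.ext fun g => ?_
  change CStarAction.act g (a - b) * f g = CStarAction.act g a * f g - CStarAction.act g b * f g
  rw [map_sub, sub_mul]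

protected theorem IsKet.act {ξ : E} {X : L2 μ B →L[ℂ] E} (h : IsKet μ ξ X) (b : B) :
    IsKet μ (ξ <• b) (X ∘L mulL2 μ b) := by
  refine ⟨⟨_, h.adj.comp (adjPair_mulL2 b)⟩, fun f => ?_⟩
  rw [ContinuousLinearMap.comp_apply, mulL2_toL2, h.2]
  refine integral_congr_ae (Eventually.of_forall fun g => ?_)
  simp only [mulLin_apply, gact_smul, act_act]

/-- The function `x ↦ K(x) β_x(b)`. -/
noncomputable def mulAct (K : C_c(G, B)) (b : B) : C_c(G, B) where
  toFun x := K x * CStarAction.act x b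
  continuous_toFun := K.continuous.mul (CStarAction.continuous_act b)
  hasCompactSupport' := K.hasCompactSupport.mul_right

/-- M_b acts as a right multiplier on kernels, so it preserves the operators ρ_K. -/
theorem rho_comp_mulL2 (K : C_c(G, B)) (b : B) :
    rho μ K ∘L mulL2 μ b = rho μ (mulAct K b) := by
  refine clm_ext_toL2 μ fun f => ?_
  rw [ContinuousLinearMap.comp_apply, mulL2_toL2, rho_toL2, rho_toL2]
  congr 1
  refine CompactlySupportedContinuousMap.ext fun g => ?_
  refine integral_congr_ae (Eventually.of_forall fun h => ?_)
  change _ = CStarAction.act g (K (g⁻¹ * h) * CStarAction.act (g⁻¹ * h) b) * f h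
  rw [map_mul (CStarAction.act g), ← cact_mul, mul_inv_cancel_left, mul_assoc]
  rfl

end Equivariant

section Crossed

variable {G : Type*} [Group G] [TopologicalSpace G] [IsTopologicalGroup G]
  [LocallyCompactSpace G] [T2Space G] [MeasurableSpace G] [BorelSpace G]
  {μ : Measure G} [μ.IsHaarMeasure]
  {B : Type*} [NonUnitalCStarAlgebra B] [CStarAction G B]

variable (μ B) in
/-- The reduced crossed product as a closed subspace of the bounded operators. -/
noncomputable def crossedSubmodule : Submodule ℂ (L2 μ B →L[ℂ] L2 μ B) :=
  (LinearMap.range ({ toFun := rho μ, map_add' := rho_add μ, map_smul' := rho_smul μ } :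
    C_c(G, B) →ₗ[ℂ] L2 μ B →L[ℂ] L2 μ B)).topologicalClosure

theorem mem_crossedSubmodule {T : L2 μ B →L[ℂ] L2 μ B} :
    T ∈ crossedSubmodule μ B ↔ T ∈ reducedCrossedProduct μ B := Iff.rfl

theorem rho_mem_crossed (K : C_c(G, B)) : rho μ K ∈ crossedSubmodule μ B :=
  subset_closure ⟨K, rfl⟩

theorem isClosed_crossed : IsClosed (crossedSubmodule μ B : Set (L2 μ B →L[ℂ] L2 μ B)) :=
  isClosed_closure

theorem crossed_comp {S T : L2 μ B →L[ℂ] L2 μ B} (hS : S ∈ crossedSubmodule μ B)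
    (hT : T ∈ crossedSubmodule μ B) : S ∘L T ∈ crossedSubmodule μ B := by
  refine map_mem_closure₂ (f := fun S T : L2 μ B →L[ℂ] L2 μ B => S ∘L T) (by fun_prop) hS hT ?_
  rintro _ ⟨K, rfl⟩ _ ⟨L, rfl⟩
  exact ⟨_, (rho_comp_rho K L).symm⟩

/-- If ρ_K is near S, then its adjoint, again of the form ρ_L, is equally near the adjoint of S. -/
theorem mem_crossed_of_adjPair {S T : L2 μ B →L[ℂ] L2 μ B} (h : AdjPair B S T)
    (hS : S ∈ crossedSubmodule μ B) : T ∈ crossedSubmodule μ B := by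
  rw [mem_crossedSubmodule, reducedCrossedProduct, Metric.mem_closure_iff] at hS ⊢
  intro ε hε
  obtain ⟨_, ⟨K, rfl⟩, hK⟩ := hS ε hε
  refine ⟨_, ⟨star (dagger K), rfl⟩, ?_⟩
  rw [dist_eq_norm] at hK ⊢
  exact (h.sub (adjPair_rho K)).norm_le.trans_lt hK

end Crossed

end SquareIntegrable

/-! ### Complete subspaces and completions -/

namespace SquareIntegrable

section Completion

variable {G : Type*} [Group G] [TopologicalSpace G] [IsTopologicalGroup G]
  [LocallyCompactSpace G] [T2Space G] [MeasurableSpace G] [BorelSpace G]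
  {μ : Measure G} [μ.IsHaarMeasure]
  {B : Type*} [NonUnitalCStarAlgebra B] [CStarAction G B]
  {E : Type*} [NormedAddCommGroup E] [NormedSpace ℂ E] [CompleteSpace E] [SMul Bᵐᵒᵖ E]
  [HilbertModule B E] [HilbertAction G B E]
  {V : Type*} [NormedAddCommGroup V] [NormedSpace ℂ V]

variable (μ B) in
/-- The subspace of all `ξ ∈ E_si` for which the operator `ι ∘ |ξ⟩⟩` belongs to `D`. -/
def ketSubmodule (ι : E →L[ℂ] V) (D : Submodule ℂ (L2 μ B →L[ℂ] V)) : Submodule ℂ E where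
  carrier := {ξ | ∃ X, IsKet μ ξ X ∧ ι ∘L X ∈ D}
  add_mem' := by
    rintro ξ η ⟨X, hX, hXD⟩ ⟨Y, hY, hYD⟩
    refine ⟨_, hX.add hY, ?_⟩
    rw [ContinuousLinearMap.comp_add]
    exact D.add_mem hXD hYD
  zero_mem' := ⟨0, isKet_zero, by rw [ContinuousLinearMap.comp_zero]; exact D.zero_mem⟩
  smul_mem' := by
    rintro c ξ ⟨X, hX, hXD⟩
    refine ⟨_, hX.smul c, ?_⟩
    rw [ContinuousLinearMap.comp_smul]
    exact D.smul_mem c hXD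

theorem mem_ketSubmodule {ι : E →L[ℂ] V} {D : Submodule ℂ (L2 μ B →L[ℂ] V)} {ξ : E}
    {X : L2 μ B →L[ℂ] E} (hX : IsKet μ ξ X) : ξ ∈ ketSubmodule μ B ι D ↔ ι ∘L X ∈ D :=
  ⟨fun ⟨_, hY, hYD⟩ => hX.unique hY ▸ hYD, fun h => ⟨_, hX, h⟩⟩

theorem norm_ket_sub_le {ξ η : E} {X Y : L2 μ B →L[ℂ] E} (h : IsKet μ ξ X) (h' : IsKet μ η Y) :
    ‖X - Y‖ ≤ siNorm μ B (ξ - η) := by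
  rw [(h.sub h').siNorm_eq]
  linarith [norm_nonneg (ξ - η)]

/-- By minimality of the completion, each closed condition on kets that is stable under right
multiplication by ρ_K passes from a set to its completion. The map ι allows conditions on kets in a
larger ambient module. -/
theorem isCompleteSubspace_ketSubmodule (ι : E →L[ℂ] V) {D : Submodule ℂ (L2 μ B →L[ℂ] V)}
    (hD : IsClosed (D : Set (L2 μ B →L[ℂ] V))) (hrho : ∀ X ∈ D, ∀ K, X ∘L rho μ K ∈ D) :
    IsCompleteSubspace μ B (ketSubmodule μ B ι D) where
  subset_si := fun ξ ⟨X, hX, _⟩ => hX.mem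
  closed_si ξ hξ h := by
    refine ⟨_, isKet_ket hξ, hD.closure_subset_iff.2 le_rfl ?_⟩
    rw [Metric.mem_closure_iff]
    intro ε hε
    obtain ⟨η, ⟨Y, hY, hYD⟩, hη⟩ := h (ε / (‖ι‖ + 1)) (by positivity)
    refine ⟨_, hYD, ?_⟩
    rw [dist_eq_norm, ← ContinuousLinearMap.comp_sub]
    have h1 := norm_ket_sub_le (isKet_ket hξ) hY
    calc _ ≤ ‖ι‖ * ‖ket μ B ξ - Y‖ := ContinuousLinearMap.opNorm_comp_le _ _
      _ ≤ (‖ι‖ + 1) * siNorm μ B (ξ - η) := by gcongr; linarith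
      _ < (‖ι‖ + 1) * (ε / (‖ι‖ + 1)) := by gcongr
      _ = ε := by field_simp
  conv_mem := by
    rintro ξ ⟨X, hX, hXD⟩ K
    exact ⟨_, hX.convAct K, hrho _ hXD K⟩

theorem ketSubmodule_top : (ketSubmodule μ B (ContinuousLinearMap.id ℂ E) ⊤ : Set E)
    = squareIntegrable μ B := by
  ext ξ
  exact ⟨fun ⟨_, hX, _⟩ => hX.mem, fun h => ⟨_, isKet_ket h, trivial⟩⟩

/-- An intersection of complete subspaces is complete once the family is nonempty; E_si itself, the
case where `D` is everything, supplies a member. -/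
theorem isComplete_completion {X : Set E} (hX : X ⊆ squareIntegrable μ B) :
    IsCompleteSubspace μ B (completion μ B X) := by
  have h0 : IsCompleteSubspace μ B (ketSubmodule μ B (ContinuousLinearMap.id ℂ E) ⊤) :=
    isCompleteSubspace_ketSubmodule _ isClosed_univ fun _ _ _ => trivial
  refine ⟨fun ξ hξ => ?_, fun ξ hξ h => ?_, fun ξ hξ K => ?_⟩
  · have := (Submodule.mem_sInf.1 hξ) _ ⟨h0, by rwa [ketSubmodule_top]⟩
    rwa [← SetLike.mem_coe, ketSubmodule_top] at this
  · refine Submodule.mem_sInf.2 fun S hS => hS.1.closed_si ξ hξ fun ε hε => ?_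
    obtain ⟨η, hη, h'⟩ := h ε hε
    exact ⟨η, Submodule.mem_sInf.1 hη S hS, h'⟩
  · exact Submodule.mem_sInf.2 fun S hS => hS.1.conv_mem ξ (Submodule.mem_sInf.1 hξ S hS) K

theorem subset_completion (X : Set E) : X ⊆ completion μ B X :=
  fun _ hξ => Submodule.mem_sInf.2 fun _ hS => hS.2 hξ

theorem completion_le {X : Set E} {S : Submodule ℂ E} (hS : IsCompleteSubspace μ B S)
    (h : X ⊆ S) : completion μ B X ≤ S := sInf_le ⟨hS, h⟩

theorem isRelativelyContinuous_iff {R : Set E} (hR : R ⊆ squareIntegrable μ B) :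
    IsRelativelyContinuous μ B R ↔ ∀ ξ ∈ R, ∀ η ∈ R, ∀ X Y : L2 μ B →L[ℂ] E,
      IsKet μ ξ X → IsKet μ η Y → adj B X ∘L Y ∈ crossedSubmodule μ B := by
  constructor
  · rintro ⟨-, h⟩ ξ hξ η hη X Y hX hY
    obtain ⟨T, hT, hbk⟩ := h ξ hξ η hη
    rwa [← (isBraKet_iff hX hY).1 hbk]
  · intro h
    exact ⟨hR, fun ξ hξ η hη => ⟨_, h ξ hξ η hη _ _ (isKet_ket (hR hξ)) (isKet_ket (hR hη)),
      (isBraKet_iff (isKet_ket (hR hξ)) (isKet_ket (hR hη))).2 rfl⟩⟩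

variable (μ) in
/-- The subspace of all operators `X` with `Y ∘ X ∈ C⋆_r(G, B)`. -/
noncomputable def relSubmodule (Y : E →L[ℂ] L2 μ B) : Submodule ℂ (L2 μ B →L[ℂ] E) :=
  (crossedSubmodule μ B).comap
    (ContinuousLinearMap.compL ℂ (L2 μ B) E (L2 μ B) Y).toLinearMap

theorem isClosed_relSubmodule (Y : E →L[ℂ] L2 μ B) :
    IsClosed (relSubmodule μ Y : Set (L2 μ B →L[ℂ] E)) :=
  isClosed_crossed.preimage (ContinuousLinearMap.compL ℂ (L2 μ B) E (L2 μ B) Y).continuous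

theorem isComplete_relSubmodule (Y : E →L[ℂ] L2 μ B) : IsCompleteSubspace μ B
    (ketSubmodule μ B (ContinuousLinearMap.id ℂ E) (relSubmodule μ Y)) :=
  isCompleteSubspace_ketSubmodule _ (isClosed_relSubmodule Y)
    fun _ hX K => crossed_comp hX (rho_mem_crossed K)

/-- With one entry fixed, membership of the bra-ket in C*_r(G,B) is a closed condition on the ket of
the other. Extend one entry to the completion, exchange the entries by adjoints, and extend the
other. -/
theorem isRelativelyContinuous_completion {R : Set E} (hR : IsRelativelyContinuous μ B R) :
    IsRelativelyContinuous μ B (completion μ B R : Set E) := by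
  have hrel := (isRelativelyContinuous_iff hR.1).1 hR
  have hc := isComplete_completion hR.1
  have h1 : ∀ ξ ∈ R, ∀ η ∈ completion μ B R, ∀ X Y : L2 μ B →L[ℂ] E,
      IsKet μ ξ X → IsKet μ η Y → adj B X ∘L Y ∈ crossedSubmodule μ B := by
    intro ξ hξ η hη X Y hX hY
    refine (mem_ketSubmodule hY).1 (completion_le (isComplete_relSubmodule (adj B X)) ?_ hη)
    intro ζ hζ
    exact ⟨_, isKet_ket (hR.1 hζ), hrel ξ hξ ζ hζ _ _ hX (isKet_ket (hR.1 hζ))⟩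
  refine (isRelativelyContinuous_iff hc.subset_si).2 fun ξ hξ η hη X Y hX hY => ?_
  refine (mem_ketSubmodule hY).1 (completion_le (isComplete_relSubmodule (adj B X)) ?_ hη)
  intro ζ hζ
  have hZ := isKet_ket (hR.1 hζ)
  exact ⟨_, hZ, mem_crossed_of_adjPair (hZ.adj.symm.comp hX.adj)
    (h1 ζ hζ ξ hξ _ _ hZ hX)⟩

end Completion

end SquareIntegrable

/-! ### Approximate units and bump functions -/

namespace SquareIntegrable

/-- Convergence at finitely many centres becomes uniform on a compact set, because right
multiplication by e is a contraction. -/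
theorem exists_approxUnit {B : Type*} [NonUnitalCStarAlgebra B] (I : NonUnitalStarSubalgebra ℂ B)
    (hI : IsClosed (I : Set B)) {C : Set B} (hC : IsCompact C) (hCI : C ⊆ I) {ε : ℝ} (hε : 0 < ε) :
    ∃ e ∈ I, ‖e‖ ≤ 1 ∧ star e = e ∧ ∀ c ∈ C, ‖c - c * e‖ < ε := by
  have _ : IsClosed (I : Set B) := hI
  let _ : PartialOrder I := CStarAlgebra.spectralOrder I
  have _ : StarOrderedRing I := CStarAlgebra.spectralOrderedRing I
  have hl := CStarAlgebra.increasingApproximateUnit I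
  obtain ⟨t, htC, ht, hcov⟩ := hC.finite_cover_balls (show 0 < ε / 3 by positivity)
  have h1 : ∀ c ∈ t, ∀ᶠ e : I in CStarAlgebra.approximateUnit I, ‖c - c * (e : B)‖ < ε / 3 := by
    intro c hc
    have h2 := hl.tendsto_mul_left ⟨c, hCI (htC hc)⟩
    have h3 := Metric.tendsto_nhds.1 h2 (ε / 3) (by positivity)
    filter_upwards [h3] with e he
    rw [dist_comm, dist_eq_norm] at he
    exact he
  have h2 := (Filter.eventually_all_finite ht).2 h1
  obtain ⟨e, he1, he2, he3⟩ := (h2.and (hl.eventually_norm.and hl.eventually_nonneg)).exists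
  refine ⟨e, e.2, he2, congrArg Subtype.val (IsSelfAdjoint.of_nonneg he3), fun c hc => ?_⟩
  obtain ⟨d, hd, hcd⟩ := Set.mem_iUnion₂.1 (hcov hc)
  rw [Metric.mem_ball, dist_eq_norm] at hcd
  have h4 : c - c * (e : B) = (c - d) + (d - d * (e : B)) - (c - d) * (e : B) := by
    rw [sub_mul]; abel
  have he2' : ‖(e : B)‖ ≤ 1 := he2
  have h5 : ‖(c - d) * (e : B)‖ ≤ ‖c - d‖ := (norm_mul_le _ _).trans
    (mul_le_of_le_one_right (norm_nonneg _) he2')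
  rw [h4]
  calc _ ≤ ‖c - d‖ + ‖d - d * (e : B)‖ + ‖(c - d) * (e : B)‖ :=
        (norm_sub_le _ _).trans (by gcongr; exact norm_add_le _ _)
    _ < ε := by linarith [he1 d hd]

section Bump

variable {G : Type*} [Group G] [TopologicalSpace G] [IsTopologicalGroup G]
  [LocallyCompactSpace G] [T2Space G] [MeasurableSpace G] [BorelSpace G]
  (μ : Measure G) [μ.IsHaarMeasure]

/-- A nonnegative symmetric function with integral `1`. -/
structure IsBump (φ : C_c(G, ℝ)) : Prop where
  nonneg : ∀ x, 0 ≤ φ x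
  symm : ∀ x, φ x⁻¹ = φ x
  integral_eq : ∫ x, φ x ∂μ = 1

/-- Symmetrise a Urysohn function as f(x) + f(x⁻¹) and normalise. Symmetry makes both Schur
constants equal to 1 without a modular function. -/
theorem exists_isBump {U : Set G} (hU : U ∈ 𝓝 (1 : G)) :
    ∃ φ : C_c(G, ℝ), IsBump μ φ ∧ ∀ x, φ x ≠ 0 → x ∈ U := by
  have hU' : U ∩ U⁻¹ ∈ 𝓝 (1 : G) := inter_mem hU (inv_mem_nhds_one G hU)
  obtain ⟨W, hWU, hWo, hW1⟩ := mem_nhds_iff.1 hU'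
  obtain ⟨f, hf1, hf0, hfc, hf⟩ := exists_continuous_one_zero_of_isCompact
    (isCompact_singleton (x := (1 : G))) hWo.isClosed_compl
    (Set.disjoint_left.2 fun x hx hx' => hx' (by rw [Set.mem_singleton_iff.1 hx]; exact hW1))
  let f0 : C_c(G, ℝ) := ⟨f, hfc⟩
  let f1 : C_c(G, ℝ) := f0 + invert f0
  have hf1a : ∀ x, f1 x = f x + f x⁻¹ := fun x => rfl
  have hnn : ∀ x, 0 ≤ f1 x := fun x => add_nonneg (hf x).1 (hf x⁻¹).1
  have hpos : 0 < ∫ x, f1 x ∂μ := by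
    refine f1.continuous.integral_pos_of_hasCompactSupport_nonneg_nonzero f1.hasCompactSupport
      hnn (x := 1) ?_
    rw [hf1a, inv_one, hf1 (Set.mem_singleton _)]
    norm_num
  refine ⟨(∫ x, f1 x ∂μ)⁻¹ • f1, ⟨fun x => ?_, fun x => ?_, ?_⟩, fun x hx => ?_⟩
  · exact mul_nonneg (inv_nonneg.2 hpos.le) (hnn x)
  · change _ * f1 x⁻¹ = _ * f1 x
    rw [hf1a, hf1a, inv_inv, add_comm]
  · change ∫ x, (∫ x, f1 x ∂μ)⁻¹ * f1 x ∂μ = 1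
    rw [integral_const_mul, inv_mul_cancel₀ hpos.ne']
  · have h1 : f1 x ≠ 0 := fun h => hx (by change _ * f1 x = 0; rw [h, mul_zero])
    by_contra hxU
    have h2 : f x = 0 := hf0 fun h => hxU (hWU h).1
    have h3 : f x⁻¹ = 0 := hf0 fun h => hxU (by simpa using (hWU h).2)
    exact h1 (by rw [hf1a, h2, h3, add_zero])

variable {μ}

theorem IsBump.norm_integral_sub_le {φ : C_c(G, ℝ)} (hφ : IsBump μ φ) {X : Type*}
    [NormedAddCommGroup X] [NormedSpace ℝ X] [CompleteSpace X] {F : G → X} (hF : Continuous F)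
    {x₀ : X} {M : ℝ} (h : ∀ g, φ g ≠ 0 → ‖F g - x₀‖ ≤ M) : ‖∫ g, φ g • F g ∂μ - x₀‖ ≤ M := by
  have hi : Integrable (fun g => φ g • F g) μ :=
    (φ.continuous.smul hF).integrable_of_hasCompactSupport φ.hasCompactSupport.smul_right
  have h1 : ∫ g, φ g • F g ∂μ - x₀ = ∫ g, φ g • (F g - x₀) ∂μ := by
    have hj : Integrable (fun g => φ g • x₀) μ := (integrable_cc μ φ).smul_const x₀
    simp only [smul_sub]
    rw [integral_sub hi hj, integral_smul_const, hφ.integral_eq, one_smul]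
  rw [h1]
  calc _ ≤ ∫ g, φ g * M ∂μ := by
        refine norm_integral_le_of_norm_le ((integrable_cc μ φ).mul_const M)
          (Eventually.of_forall fun g => ?_)
        rw [norm_smul, Real.norm_of_nonneg (hφ.nonneg g)]
        by_cases hg : φ g = 0
        · rw [hg, zero_mul, zero_mul]
        · exact mul_le_mul_of_nonneg_left (h g hg) (hφ.nonneg g)
    _ = M := by rw [integral_mul_const, hφ.integral_eq, one_mul]

/-- The function `g ↦ φ(g) b`. -/
noncomputable def tensor {B : Type*} [NonUnitalCStarAlgebra B] (φ : C_c(G, ℝ)) (b : B) :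
    C_c(G, B) where
  toFun g := φ g • b
  continuous_toFun := φ.continuous.smul continuous_const
  hasCompactSupport' := φ.hasCompactSupport.smul_right

open scoped Pointwise in
-- Uniform continuity from the right. Restricting h to a compact neighbourhood `V` leaves only the
-- compact set tsupport L · V⁻¹ of relevant x.
theorem eventually_norm_shift_sub_le {X : Type*} [NormedAddCommGroup X] (L : C_c(G, X)) {ε : ℝ}
    (hε : 0 < ε) : ∀ᶠ h in 𝓝 (1 : G), ∀ x, ‖L (x * h) - L x‖ < ε := by
  obtain ⟨V, hV, hV1⟩ := exists_compact_mem_nhds (1 : G)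
  have h1 : ∀ᶠ h in 𝓝 (1 : G), ∀ x ∈ tsupport L * V⁻¹, ‖L (x * h) - L x‖ < ε := by
    refine IsCompact.eventually_forall_of_forall_eventually
      (L.hasCompactSupport.isCompact.mul hV.inv) fun x _ => ?_
    have hc : Continuous fun p : G × G => ‖L (p.2 * p.1) - L p.2‖ :=
      ((L.continuous.comp (continuous_snd.mul continuous_fst)).sub
        (L.continuous.comp continuous_snd)).norm
    have := hc.tendsto ((1 : G), x)
    simp only [mul_one, sub_self, norm_zero] at this
    exact this.eventually (gt_mem_nhds hε)
  filter_upwards [h1, hV1] with h hh hhV x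
  by_cases hx : x ∈ tsupport L * V⁻¹
  · exact hh x hx
  · have h2 : x ∉ tsupport L := fun h' =>
      hx (Set.mem_mul.2 ⟨x, h', 1, by simpa using mem_of_mem_nhds hV1, mul_one x⟩)
    have h3 : x * h ∉ tsupport L := fun h' =>
      hx (Set.mem_mul.2 ⟨x * h, h', h⁻¹, Set.inv_mem_inv.2 hhV, by simp⟩)
    rw [image_eq_zero_of_notMem_tsupport h2, image_eq_zero_of_notMem_tsupport h3]
    simpa using hε

variable {B : Type*} [NonUnitalCStarAlgebra B] [CStarAction G B]

theorem IsBump.norm_rho_tensor_le {φ : C_c(G, ℝ)} (hφ : IsBump μ φ) (b : B) :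
    ‖rho μ (tensor φ b)‖ ≤ ‖b‖ := by
  refine opNorm_le_of_toL2 μ (norm_nonneg b) fun f => ?_
  have := norm_rhoFun_le μ (K := tensor φ b) (φ := φ) (L := ContinuousMap.const G b) (M := ‖b‖)
    (c := 1) (c' := 1) hφ.nonneg (fun _ => le_rfl) (fun _ => rfl) one_pos hφ.integral_eq.le
    (by simp only [hφ.symm]; exact hφ.integral_eq.le) f
  rw [rho_toL2]
  simpa using this

theorem IsBump.convAct_tensor {E : Type*} [NormedAddCommGroup E] [NormedSpace ℂ E]
    [CompleteSpace E] [SMul Bᵐᵒᵖ E] [HilbertModule B E] [HilbertAction G B E] {φ : C_c(G, ℝ)}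
    (hφ : IsBump μ φ) (ξ : E) (b : B) :
    convAct μ B ξ (tensor φ b) = ∫ g, φ g • gact B g (ξ <• b) ∂μ := by
  refine integral_congr_ae (Eventually.of_forall fun g => ?_)
  change gact B g (ξ <• (φ g⁻¹ • b)) = _
  simp only [act_real_smul, hφ.symm]
  exact (gact B g).map_smul_of_tower (φ g) (ξ <• b)

/-- The kernel of ρ_L ρ_{φ⊗b} is an average over the bump of L(xh)β_{xh}(b), which is near L(x) when
φ is concentrated near 1 and b acts almost as a unit. -/
theorem IsBump.dagger_rhoFun_tensor {φ : C_c(G, ℝ)} (hφ : IsBump μ φ) (L : C_c(G, B)) (b : B)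
    (x : G) : dagger (rhoFun μ L (dagger (tensor φ b))) x
      = ∫ h, φ h • (L (x * h) * CStarAction.act (x * h) b) ∂μ := by
  rw [dagger_apply, rhoFun_apply, ← integral_hom (CStarAction.act x) (integrable_rho μ L _ _)]
  refine integral_congr_ae (Eventually.of_forall fun h => ?_)
  have h1 : dagger (tensor φ b) h = φ h • CStarAction.act h b := by
    change CStarAction.act h (φ h⁻¹ • b) = _
    rw [hφ.symm]
    exact (homL (CStarAction.act h : B →⋆ₙₐ[ℂ] B)).map_smul_of_tower (φ h) b
  have h2 := (homL (CStarAction.act x : B →⋆ₙₐ[ℂ] B)).map_smul_of_tower (φ h)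
    (CStarAction.act h b)
  simp only [homL_apply] at h2
  simp only [inv_inv]
  rw [h1, map_mul (CStarAction.act x), cact_cact_inv, h2, mul_smul_comm, cact_mul]

end Bump

end SquareIntegrable

/-! ### Approximating a square-integrable element by ξ∗(φ⊗e²) -/

namespace SquareIntegrable

section Approx

variable {G : Type*} [Group G] [TopologicalSpace G] [IsTopologicalGroup G]
  [LocallyCompactSpace G] [T2Space G] [MeasurableSpace G] [BorelSpace G]
  {μ : Measure G} [μ.IsHaarMeasure]
  {B : Type*} [NonUnitalCStarAlgebra B] [CStarAction G B]
  {E : Type*} [NormedAddCommGroup E] [NormedSpace ℂ E] [CompleteSpace E] [SMul Bᵐᵒᵖ E]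
  [HilbertModule B E] [HilbertAction G B E]

/-- With a = ⟨ξ,ξ⟩, the square of ξ − ξe is (a − ae) − e*(a − ae). An approximate unit that works on
⟨ξ,ξ⟩ therefore works on ξ. -/
theorem norm_sub_act_sq_le (ξ : E) {e : B} (he : ‖e‖ ≤ 1) :
    ‖ξ - ξ <• e‖ ^ 2 ≤ 2 * ‖inner B ξ ξ - inner B ξ ξ * e‖ := by
  rw [HilbertModule.norm_sq_eq (B := B)]
  set a := inner B ξ ξ
  have h1 : inner B (ξ - ξ <• e) (ξ - ξ <• e) = (a - a * e) - star e * (a - a * e) := by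
    rw [inner_sub_right, inner_sub_left, inner_sub_left, HilbertModule.inner_act_right,
      HilbertModule.inner_act_right, inner_act_left, mul_sub, mul_assoc]
    abel
  rw [h1]
  calc _ ≤ ‖a - a * e‖ + ‖star e * (a - a * e)‖ := norm_sub_le _ _
    _ ≤ ‖a - a * e‖ + 1 * ‖a - a * e‖ := by
      gcongr
      refine (norm_mul_le _ _).trans ?_
      gcongr
      rwa [norm_star]
    _ = _ := by ring

theorem norm_sub_mul_self_le {c e : B} (he : ‖e‖ ≤ 1) :
    ‖c - c * (e * e)‖ ≤ 2 * ‖c - c * e‖ := by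
  have h1 : c - c * (e * e) = (c - c * e) + (c - c * e) * e := by
    rw [sub_mul, mul_assoc]; abel
  rw [h1]
  calc _ ≤ ‖c - c * e‖ + ‖(c - c * e) * e‖ := norm_add_le _ _
    _ ≤ ‖c - c * e‖ + ‖c - c * e‖ * 1 := by
      gcongr
      exact (norm_mul_le _ _).trans (by gcongr)
    _ = _ := by ring

/-- Pulling back by β_y⁻¹ turns the y-dependent factor β_y(b) into one fixed b, to be controlled on
the compact set of values β_y⁻¹(L(y)). -/
theorem norm_act_sub_le (L : C_c(G, B)) {b : B} {δ : ℝ} (hδ : 0 ≤ δ)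
    (h : ∀ c ∈ (fun y : G => CStarAction.act y⁻¹ (L y)) '' tsupport L, ‖c - c * b‖ ≤ δ) (y : G) :
    ‖L y * CStarAction.act y b - L y‖ ≤ δ := by
  by_cases hy : y ∈ tsupport L
  · have h1 : L y * CStarAction.act y b - L y
        = -CStarAction.act y (CStarAction.act y⁻¹ (L y) - CStarAction.act y⁻¹ (L y) * b) := by
      rw [map_sub, map_mul, cact_cact_inv]; abel
    rw [h1, norm_neg, norm_cstarAct]
    exact h _ ⟨y, hy, rfl⟩
  · rw [image_eq_zero_of_notMem_tsupport hy, zero_mul, sub_zero, norm_zero]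
    exact hδ

theorem isCompact_act_image (L : C_c(G, B)) :
    IsCompact ((fun y : G => CStarAction.act y⁻¹ (L y)) '' tsupport L) :=
  L.hasCompactSupport.isCompact.image (continuous_cstarAct continuous_inv L.continuous)

open scoped Pointwise in
-- The two errors, from b and from shifting by h, are at most ε/(4C) each; `C` bounds ρ for kernels
-- carried by tsupport L · V⁻¹, which contains the supports involved. The tolerance δ depends on L
-- alone, so b can be chosen afterwards.
theorem exists_bump_rho_near (L : C_c(G, B)) {ε : ℝ} (hε : 0 < ε) :
    ∃ δ > 0, ∀ b : B, (∀ y, ‖L y * CStarAction.act y b - L y‖ ≤ δ) →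
      ∃ U ∈ 𝓝 (1 : G), ∀ φ : C_c(G, ℝ), IsBump μ φ → (∀ x, φ x ≠ 0 → x ∈ U) →
        ‖rho μ L - rho μ L ∘L rho μ (tensor φ b)‖ < ε := by
  obtain ⟨V, hV, hV1⟩ := exists_compact_mem_nhds (1 : G)
  obtain ⟨C, hC, hbound⟩ := exists_norm_rho_le μ (B := B)
    (L.hasCompactSupport.isCompact.mul hV.inv)
  refine ⟨ε / (4 * C), by positivity, fun b hb =>
    ⟨{h | ∀ x, ‖L (x * h) - L x‖ < ε / (4 * C)} ∩ V,
    inter_mem (eventually_norm_shift_sub_le L (by positivity)) hV1, fun φ hφ hφU => ?_⟩⟩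
  rw [rho_comp_rho, ← rho_sub]
  have hcont : ∀ x : G, Continuous fun h => L (x * h) * CStarAction.act (x * h) b := fun x =>
    (L.continuous.mul (CStarAction.continuous_act b)).comp (continuous_const_mul x)
  have key : ‖rho μ (dagger (rhoFun μ L (dagger (tensor φ b))) - L)‖ ≤ C * (ε / (2 * C)) := by
    refine hbound _ (fun x hx => ?_) _ fun x => ?_
    · rw [← norm_le_zero_iff]
      change ‖dagger (rhoFun μ L (dagger (tensor φ b))) x - L x‖ ≤ 0
      rw [hφ.dagger_rhoFun_tensor]
      refine hφ.norm_integral_sub_le (hcont x) fun h hh => ?_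
      have h2 : x ∉ tsupport L := fun h' =>
        hx (Set.mem_mul.2 ⟨x, h', 1, by simpa using mem_of_mem_nhds hV1, mul_one x⟩)
      have h3 : x * h ∉ tsupport L := fun h' =>
        hx (Set.mem_mul.2 ⟨x * h, h', h⁻¹, Set.inv_mem_inv.2 (hφU h hh).2, by simp⟩)
      rw [image_eq_zero_of_notMem_tsupport h2, image_eq_zero_of_notMem_tsupport h3]
      simp
    · change ‖dagger (rhoFun μ L (dagger (tensor φ b))) x - L x‖ ≤ _
      rw [hφ.dagger_rhoFun_tensor]
      refine hφ.norm_integral_sub_le (hcont x) fun h hh => ?_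
      have h1 : L (x * h) * CStarAction.act (x * h) b - L x
          = (L (x * h) * CStarAction.act (x * h) b - L (x * h)) + (L (x * h) - L x) := by abel
      have h2 : ε / (2 * C) = ε / (4 * C) + ε / (4 * C) := by field_simp; norm_num
      rw [h1, h2]
      exact (norm_add_le _ _).trans (add_le_add (hb _) ((hφU h hh).1 x).le)
  have hlast : C * (ε / (2 * C)) = ε / 2 := by field_simp
  rw [rho_sub, ← norm_neg, neg_sub, ← rho_sub] at key
  linarith

theorem exists_bump_convAct_near (ξ : E) (b : B) {ε : ℝ} (hε : 0 < ε) :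
    ∃ U ∈ 𝓝 (1 : G), ∀ φ : C_c(G, ℝ), IsBump μ φ → (∀ x, φ x ≠ 0 → x ∈ U) →
      ‖convAct μ B ξ (tensor φ b) - ξ <• b‖ ≤ ε := by
  have h1 := (continuous_gact B (G := G) (ξ <• b)).tendsto 1
  rw [gact_one] at h1
  refine ⟨_, Metric.tendsto_nhds.1 h1 ε hε, fun φ hφ hU => ?_⟩
  rw [hφ.convAct_tensor]
  refine hφ.norm_integral_sub_le (continuous_gact B _) fun g hg => ?_
  have := hU g hg
  rw [Set.mem_ofPred_eq, dist_eq_norm] at this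
  exact this.le

/-- The approximate unit `φ ⊗ e²` of `C_c(G, I)` for a closed invariant subalgebra `I`. -/
theorem exists_approxUnit_cc (I : NonUnitalStarSubalgebra ℂ B) (hI : IsClosed (I : Set B))
    (hinv : ∀ (g : G), ∀ b ∈ I, CStarAction.act g b ∈ I) {T : L2 μ B →L[ℂ] L2 μ B}
    (hT : T ∈ crossedIdeal μ (I : Set B)) {ξ : E} (hξ : inner B ξ ξ ∈ I) {ε : ℝ} (hε : 0 < ε) :
    ∃ (φ : C_c(G, ℝ)) (e : B), e ∈ I ∧ ‖rho μ (tensor φ (e * e))‖ ≤ 1 ∧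
      ‖T - T ∘L rho μ (tensor φ (e * e))‖ < ε ∧ ‖ξ - convAct μ B ξ (tensor φ (e * e))‖ < ε := by
  obtain ⟨_, ⟨L, hL, rfl⟩, hLT⟩ := Metric.mem_closure_iff.1 hT (ε / 3) (by positivity)
  obtain ⟨δ, hδ, hU⟩ := exists_bump_rho_near (μ := μ) L (show 0 < ε / 3 by positivity)
  -- Replacing e by e² doubles each error: δ/2 becomes δ, and ‖ξ − ξe²‖² ≤ 2·2·ε²/16 = (ε/2)². The
  -- square lets one factor e be moved onto ξ later.
  obtain ⟨e, heI, he, -, hC⟩ := exists_approxUnit I hI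
    ((isCompact_act_image L).union (isCompact_singleton (x := inner B ξ ξ)))
    (Set.union_subset (by rintro _ ⟨y, -, rfl⟩; exact hinv _ _ (hL y)) (by simpa using hξ))
    (show 0 < min (δ / 2) (ε ^ 2 / 16) by positivity)
  have hee : ‖e * e‖ ≤ 1 := (norm_mul_le _ _).trans (mul_le_one₀ he (norm_nonneg _) he)
  obtain ⟨U, hU1, hU⟩ := hU (e * e) (norm_act_sub_le L hδ.le fun c hc => by
    have h1 := hC c (Or.inl hc)
    have h2 := norm_sub_mul_self_le (c := c) he
    linarith [min_le_left (δ / 2) (ε ^ 2 / 16)])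
  obtain ⟨U', hU1', hU'⟩ := exists_bump_convAct_near (μ := μ) ξ (e * e)
    (show 0 < ε / 4 by positivity)
  obtain ⟨φ, hφ, hφU⟩ := exists_isBump μ (inter_mem hU1 hU1')
  have hρ : ‖rho μ (tensor φ (e * e))‖ ≤ 1 := (hφ.norm_rho_tensor_le _).trans hee
  refine ⟨φ, e, heI, hρ, ?_, ?_⟩
  · have h1 := hU φ hφ fun x hx => (hφU x hx).1
    rw [dist_eq_norm] at hLT
    set P := rho μ (tensor φ (e * e))
    have h2 : T - T ∘L P = (T - rho μ L) + (rho μ L - rho μ L ∘L P) - (T - rho μ L) ∘L P := by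
      rw [ContinuousLinearMap.sub_comp]; abel
    have h3 : ‖(T - rho μ L) ∘L P‖ ≤ ‖T - rho μ L‖ :=
      (ContinuousLinearMap.opNorm_comp_le _ _).trans (mul_le_of_le_one_right (norm_nonneg _) hρ)
    rw [h2]
    calc _ ≤ ‖T - rho μ L‖ + ‖rho μ L - rho μ L ∘L P‖ + ‖(T - rho μ L) ∘L P‖ :=
          (norm_sub_le _ _).trans (by gcongr; exact norm_add_le _ _)
      _ < ε := by linarith
  · have h1 := hU' φ hφ fun x hx => (hφU x hx).2
    have h2 := norm_sub_act_sq_le ξ hee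
    have h3 := hC _ (Or.inr rfl)
    have h4 := norm_sub_mul_self_le (c := inner B ξ ξ) he
    have h5 : ‖ξ - ξ <• (e * e)‖ ≤ ε / 2 := by
      refine le_of_sq_le_sq (α := ℝ) ?_ (by positivity)
      nlinarith [min_le_right (δ / 2) (ε ^ 2 / 16)]
    calc _ = ‖(ξ - ξ <• (e * e)) - (convAct μ B ξ (tensor φ (e * e)) - ξ <• (e * e))‖ := by
          congr 1; abel
      _ ≤ _ := norm_sub_le _ _
      _ < ε := by linarith

/-- The operator analogue of `norm_sub_act_sq_le`: a contraction that approximately fixes X*X from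
the right approximately fixes X. -/
theorem norm_sub_comp_sq_le {F : Type*} [NormedAddCommGroup F] [NormedSpace ℂ F] [SMul Bᵐᵒᵖ F]
    [HilbertModule B F] {X : F →L[ℂ] E} {Y : E →L[ℂ] F} (h : AdjPair B X Y) {P P' : F →L[ℂ] F}
    (hP : AdjPair B P P') (hP1 : ‖P‖ ≤ 1) :
    ‖X - X ∘L P‖ ^ 2 ≤ 2 * ‖Y ∘L X - (Y ∘L X) ∘L P‖ := by
  have h1 := (h.sub (h.comp hP)).norm_sq_le
  have h2 : (Y - P' ∘L Y) ∘L (X - X ∘L P) = (Y ∘L X - (Y ∘L X) ∘L P)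
      - P' ∘L (Y ∘L X - (Y ∘L X) ∘L P) := by
    simp only [ContinuousLinearMap.sub_comp, ContinuousLinearMap.comp_sub,
      ContinuousLinearMap.comp_assoc]
    abel
  refine h1.trans ?_
  rw [h2]
  calc _ ≤ ‖Y ∘L X - (Y ∘L X) ∘L P‖ + ‖P' ∘L (Y ∘L X - (Y ∘L X) ∘L P)‖ := norm_sub_le _ _
    _ ≤ ‖Y ∘L X - (Y ∘L X) ∘L P‖ + 1 * ‖Y ∘L X - (Y ∘L X) ∘L P‖ := by
      gcongr
      exact (ContinuousLinearMap.opNorm_comp_le _ _).trans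
        (by gcongr; exact hP.norm_le.trans hP1)
    _ = _ := by ring

/-- One φ⊗e² serves for the ket and for the vector, which is convergence in ‖·‖_si. The coefficients
stay in `I` when ⟨⟨ξ|ξ⟩⟩ and ⟨ξ,ξ⟩ come from `I`; exactness will supply this. -/
theorem IsKet.exists_approx {ξ : E} {X : L2 μ B →L[ℂ] E} (hX : IsKet μ ξ X)
    (I : NonUnitalStarSubalgebra ℂ B) (hI : IsClosed (I : Set B))
    (hinv : ∀ (g : G), ∀ b ∈ I, CStarAction.act g b ∈ I)
    (hT : adj B X ∘L X ∈ crossedIdeal μ (I : Set B)) (hξ : inner B ξ ξ ∈ I) {ε : ℝ} (hε : 0 < ε) :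
    ∃ (φ : C_c(G, ℝ)) (e : B), e ∈ I ∧ ‖X - X ∘L rho μ (tensor φ (e * e))‖ < ε ∧
      ‖ξ - convAct μ B ξ (tensor φ (e * e))‖ < ε := by
  obtain ⟨φ, e, he, h1, h2, h3⟩ := exists_approxUnit_cc I hI hinv hT hξ
    (show 0 < min ε (ε ^ 2 / 2) by positivity)
  refine ⟨φ, e, he, ?_, h3.trans_le (min_le_left _ _)⟩
  have h4 := norm_sub_comp_sq_le hX.adj (adjPair_rho (tensor φ (e * e))) h1
  refine lt_of_pow_lt_pow_left₀ 2 hε.le ?_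
  linarith [min_le_right ε (ε ^ 2 / 2)]

theorem crossedIdeal_top : crossedIdeal μ ((⊤ : NonUnitalStarSubalgebra ℂ B) : Set B)
    = crossedSubmodule μ B := by
  have : {T | ∃ K : C_c(G, B), (∀ g, K g ∈ ((⊤ : NonUnitalStarSubalgebra ℂ B) : Set B)) ∧
      T = rho μ K} = Set.range (rho μ (B := B)) := by
    ext T
    exact ⟨fun ⟨K, _, h⟩ => ⟨K, h.symm⟩, fun ⟨K, h⟩ => ⟨K, fun _ => trivial, h.symm⟩⟩
  rw [crossedIdeal, this]; rfl

theorem IsKet.exists_approx_top {ξ : E} {X : L2 μ B →L[ℂ] E} (hX : IsKet μ ξ X)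
    (hT : adj B X ∘L X ∈ crossedSubmodule μ B) {ε : ℝ} (hε : 0 < ε) :
    ∃ K : C_c(G, B), ‖X - X ∘L rho μ K‖ < ε ∧ ‖ξ - convAct μ B ξ K‖ < ε := by
  obtain ⟨φ, e, -, h⟩ := hX.exists_approx ⊤ isClosed_univ (fun _ _ _ => trivial)
    (by rw [crossedIdeal_top]; exact hT) trivial hε
  exact ⟨_, h⟩

end Approx

end SquareIntegrable

/-! ### Kets determine membership in complete relatively continuous subspaces -/

namespace SquareIntegrable

section RelativelyContinuous

variable {G : Type*} [Group G] [TopologicalSpace G] [IsTopologicalGroup G]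
  [LocallyCompactSpace G] [T2Space G] [MeasurableSpace G] [BorelSpace G]
  {μ : Measure G} [μ.IsHaarMeasure]
  {B : Type*} [NonUnitalCStarAlgebra B] [CStarAction G B]
  {E : Type*} [NormedAddCommGroup E] [NormedSpace ℂ E] [CompleteSpace E] [SMul Bᵐᵒᵖ E]
  [HilbertModule B E] [HilbertAction G B E]

theorem adj_comp_mem_crossed_of_closure {S : Set (L2 μ B →L[ℂ] E)}
    (hadj : ∀ Y ∈ S, AdjPair B Y (adj B Y))
    (hS : ∀ Y ∈ S, ∀ Z ∈ S, adj B Y ∘L Z ∈ crossedSubmodule μ B) {X : L2 μ B →L[ℂ] E}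
    (hXadj : AdjPair B X (adj B X)) (hX : X ∈ closure S) :
    adj B X ∘L X ∈ crossedSubmodule μ B := by
  have h1 : ∀ Z ∈ S, adj B X ∘L Z ∈ crossedSubmodule μ B := fun Z hZ =>
    mem_crossed_of_adjPair ((hadj Z hZ).symm.comp hXadj)
      ((isClosed_relSubmodule (adj B Z)).closure_subset_iff.2 (fun Y hY => hS Z hZ Y hY) hX)
  exact (isClosed_relSubmodule (adj B X)).closure_subset_iff.2 h1 hX

/-- A square-integrable element belongs to a complete relatively continuous subspace `R` if
`|ξ⟩⟩` is a norm limit of operators `|η⟩⟩` with `η ∈ R`. -/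
theorem mem_of_ket_mem_closure {R : Submodule ℂ E} (hc : IsCompleteSubspace μ B R)
    (hr : IsRelativelyContinuous μ B (R : Set E)) {ξ : E} {X : L2 μ B →L[ℂ] E}
    (hX : IsKet μ ξ X) (h : X ∈ closure {Y | ∃ η ∈ R, IsKet μ η Y}) : ξ ∈ R := by
  have hr' := (isRelativelyContinuous_iff hr.1).1 hr
  have hT : adj B X ∘L X ∈ crossedSubmodule μ B := by
    refine adj_comp_mem_crossed_of_closure ?_ ?_ hX.adj h
    · rintro Y ⟨η, -, hY⟩
      exact hY.adj
    · rintro Y ⟨η, hη, hY⟩ Z ⟨ζ, hζ, hZ⟩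
      exact hr' η hη ζ hζ Y Z hY hZ
  -- Norm closeness of kets says nothing about ‖ξ − η‖. After convolution it does: both ξ∗K =
  -- |ξ⟩⟩(K†) and |ξ∗K⟩⟩ = |ξ⟩⟩ρ_K depend continuously on the ket alone.
  have hK : ∀ K, convAct μ B ξ K ∈ R := by
    intro K
    refine hc.closed_si _ (hX.convAct K).mem fun ε hε => ?_
    set D := ‖toL2 μ (dagger K)‖ + ‖rho μ K‖ + 1 with hD
    have hD0 : 0 < D := by positivity
    obtain ⟨Y, ⟨η, hη, hY⟩, hXY⟩ := Metric.mem_closure_iff.1 h (ε / D) (by positivity)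
    rw [dist_eq_norm] at hXY
    refine ⟨_, hc.conv_mem η hη K, ?_⟩
    rw [((hX.convAct K).sub (hY.convAct K)).siNorm_eq, ← hX.apply_dagger, ← hY.apply_dagger,
      ← sub_apply, ← ContinuousLinearMap.sub_comp]
    calc _ ≤ ‖X - Y‖ * ‖toL2 μ (dagger K)‖ + ‖X - Y‖ * ‖rho μ K‖ :=
          add_le_add ((X - Y).le_opNorm _) (ContinuousLinearMap.opNorm_comp_le _ _)
      _ ≤ ‖X - Y‖ * D := by rw [hD]; nlinarith [norm_nonneg (X - Y)]
      _ < ε / D * D := by gcongr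
      _ = ε := by field_simp
  refine hc.closed_si _ hX.mem fun ε hε => ?_
  obtain ⟨K, h1, h2⟩ := hX.exists_approx_top hT (show 0 < ε / 2 by positivity)
  refine ⟨_, hK K, ?_⟩
  rw [(hX.sub (hX.convAct K)).siNorm_eq]
  linarith

/-- |ξb⟩⟩ = |ξ⟩⟩M_b is near |ξ⟩⟩ρ_K M_b, which is the ket of another convolution ξ∗K' in R;
convergence of kets suffices by `mem_of_ket_mem_closure`. -/
theorem act_mem {R : Submodule ℂ E} (hc : IsCompleteSubspace μ B R)
    (hr : IsRelativelyContinuous μ B (R : Set E)) {ξ : E} (hξ : ξ ∈ R) (b : B) : ξ <• b ∈ R := by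
  have hX := isKet_ket (hr.1 hξ)
  refine mem_of_ket_mem_closure hc hr (hX.act b) ?_
  rw [Metric.mem_closure_iff]
  intro ε hε
  have hT := (isRelativelyContinuous_iff hr.1).1 hr ξ hξ ξ hξ _ _ hX hX
  obtain ⟨K, h1, -⟩ := hX.exists_approx_top hT (show 0 < ε / (‖b‖ + 1) by positivity)
  refine ⟨_, ⟨_, hc.conv_mem ξ hξ (mulAct K b), hX.convAct _⟩, ?_⟩
  rw [← rho_comp_mulL2, dist_eq_norm, ← ContinuousLinearMap.comp_assoc,
    ← ContinuousLinearMap.sub_comp]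
  calc _ ≤ ‖ket μ B ξ - ket μ B ξ ∘L rho μ K‖ * ‖mulL2 μ b‖ :=
        ContinuousLinearMap.opNorm_comp_le _ _
    _ ≤ ‖ket μ B ξ - ket μ B ξ ∘L rho μ K‖ * (‖b‖ + 1) := by
      gcongr
      linarith [norm_mulL2_le (μ := μ) b]
    _ < ε / (‖b‖ + 1) * (‖b‖ + 1) := by gcongr
    _ = ε := by field_simp

theorem norm_rho_sub_comp_mulL2 (L : C_c(G, B)) {ε : ℝ} (hε : 0 < ε) :
    ∃ δ > 0, ∀ b : B, (∀ y, ‖L y * CStarAction.act y b - L y‖ ≤ δ) →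
      ‖rho μ L - rho μ L ∘L mulL2 μ b‖ < ε := by
  obtain ⟨C, hC, hbound⟩ := exists_norm_rho_le μ (B := B) L.hasCompactSupport.isCompact
  refine ⟨ε / (2 * C), by positivity, fun b hb => ?_⟩
  rw [rho_comp_mulL2, ← rho_sub]
  have h1 := hbound (L - mulAct L b) (fun x hx => ?_) (ε / (2 * C)) fun x => ?_
  · have h2 : C * (ε / (2 * C)) = ε / 2 := by field_simp
    linarith
  · change L x - L x * _ = 0
    rw [image_eq_zero_of_notMem_tsupport hx, zero_mul, sub_zero]
  · change ‖L x - L x * CStarAction.act x b‖ ≤ _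
    rw [← norm_neg, neg_sub]
    exact hb x

/-- First take e from an approximate unit, which controls both ⟨ξ,ξ⟩ and ⟨⟨ξ|ξ⟩⟩; then move e to a
nearby point of `S`, with an error that |ξ⟩⟩M_b and ξb control linearly. In K(E), `S` will be the
finite rank operators. -/
theorem IsKet.exists_siNorm_sub_act_lt {ξ : E} {X : L2 μ B →L[ℂ] E} (hX : IsKet μ ξ X)
    (hT : adj B X ∘L X ∈ crossedSubmodule μ B) {S : Set B} (hS : Dense S) {ε : ℝ} (hε : 0 < ε) :
    ∃ b ∈ S, siNorm μ B (ξ - ξ <• b) < ε := by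
  set T := adj B X ∘L X with hTdef
  set η := min (ε / 4) ((ε / 4) ^ 2 / 4) with hη
  have hη0 : 0 < η := by positivity
  obtain ⟨_, ⟨L, rfl⟩, hLT⟩ := Metric.mem_closure_iff.1 hT (η / 3) (by positivity)
  rw [dist_eq_norm] at hLT
  change ‖T - rho μ L‖ < _ at hLT
  obtain ⟨δ, hδ, hL⟩ := norm_rho_sub_comp_mulL2 (μ := μ) L (show 0 < η / 3 by positivity)
  obtain ⟨e, -, he, -, hC⟩ := exists_approxUnit (⊤ : NonUnitalStarSubalgebra ℂ B) isClosed_univ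
    ((isCompact_act_image L).union (isCompact_singleton (x := inner B ξ ξ)))
    (Set.subset_univ _) (show 0 < min δ ((ε / 4) ^ 2 / 4) by positivity)
  have hM : ‖mulL2 μ e‖ ≤ 1 := (norm_mulL2_le e).trans he
  have h1 := hL e (norm_act_sub_le L hδ.le fun c hc =>
    (hC c (Or.inl hc)).le.trans (min_le_left _ _))
  have h2 : ‖T - T ∘L mulL2 μ e‖ < η := by
    have h2 : T - T ∘L mulL2 μ e = (T - rho μ L) + (rho μ L - rho μ L ∘L mulL2 μ e)
        - (T - rho μ L) ∘L mulL2 μ e := by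
      rw [ContinuousLinearMap.sub_comp]; abel
    have h3 : ‖(T - rho μ L) ∘L mulL2 μ e‖ ≤ ‖T - rho μ L‖ :=
      (ContinuousLinearMap.opNorm_comp_le _ _).trans (mul_le_of_le_one_right (norm_nonneg _) hM)
    rw [h2]
    calc _ ≤ ‖T - rho μ L‖ + ‖rho μ L - rho μ L ∘L mulL2 μ e‖
          + ‖(T - rho μ L) ∘L mulL2 μ e‖ :=
          (norm_sub_le _ _).trans (by gcongr; exact norm_add_le _ _)
      _ < η := by linarith
  have h3 : ‖X - X ∘L mulL2 μ e‖ ≤ ε / 4 := by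
    refine le_of_sq_le_sq (α := ℝ) ?_ (by positivity)
    have := norm_sub_comp_sq_le hX.adj (adjPair_mulL2 e) hM
    have h4 : η ≤ (ε / 4) ^ 2 / 4 := min_le_right _ _
    nlinarith
  have h4 : ‖ξ - ξ <• e‖ ≤ ε / 4 := by
    refine le_of_sq_le_sq (α := ℝ) ?_ (by positivity)
    have := norm_sub_act_sq_le ξ he
    have h4 := (hC _ (Or.inr rfl)).le.trans (min_le_right _ _)
    nlinarith
  obtain ⟨b, hb, hbe⟩ := Metric.mem_closure_iff.1 (hS e) (ε / (4 * (‖ξ‖ + ‖X‖ + 1)))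
    (by positivity)
  rw [dist_eq_norm] at hbe
  refine ⟨b, hb, ?_⟩
  have h5 : ‖e - b‖ * (‖ξ‖ + ‖X‖ + 1) < ε / 4 := by
    calc _ < ε / (4 * (‖ξ‖ + ‖X‖ + 1)) * (‖ξ‖ + ‖X‖ + 1) := by gcongr
      _ = ε / 4 := by field_simp
  rw [(hX.sub (hX.act b)).siNorm_eq]
  have h6 : ξ - ξ <• b = (ξ - ξ <• e) + ξ <• (e - b) := by rw [act_sub]; abel
  have h7 : X - X ∘L mulL2 μ b = (X - X ∘L mulL2 μ e) + X ∘L mulL2 μ (e - b) := by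
    rw [mulL2_sub, ContinuousLinearMap.comp_sub]; abel
  rw [h6, h7]
  have h8 : ‖ξ <• (e - b)‖ ≤ ‖ξ‖ * ‖e - b‖ := norm_act_le _ _
  have h9 : ‖X ∘L mulL2 μ (e - b)‖ ≤ ‖X‖ * ‖e - b‖ :=
    (ContinuousLinearMap.opNorm_comp_le _ _).trans (by gcongr; exact norm_mulL2_le _)
  have h10 := norm_add_le (ξ - ξ <• e) (ξ <• (e - b))
  have h11 := norm_add_le (X - X ∘L mulL2 μ e) (X ∘L mulL2 μ (e - b))
  nlinarith [norm_nonneg (e - b)]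

end RelativelyContinuous

end SquareIntegrable

/-! ### Rank-one operators in K(E) -/

namespace SquareIntegrable

section KetBra

variable {B E : Type*} [NonUnitalCStarAlgebra B] [NormedAddCommGroup E] [NormedSpace ℂ E]
  [SMul Bᵐᵒᵖ E] [HilbertModule B E]

variable (B) in
/-- The rank-one operator `|ξ⟩⟨η|` as a compact operator. -/
noncomputable def ketbra (ξ η : E) : CompactOp B E :=
  ⟨rankOne B ξ η, subset_closure (Submodule.subset_span ⟨(ξ, η), rfl⟩)⟩

theorem ketbra_apply (ξ η ζ : E) : (ketbra B ξ η).op ζ = ξ <• inner B η ζ := rfl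

theorem norm_ketbra_le (ξ η : E) : ‖ketbra B ξ η‖ ≤ ‖ξ‖ * ‖η‖ := norm_rankOne_le B ξ η

variable (B) in
/-- The map `ξ ↦ |ξ⟩⟨η|`. -/
noncomputable def ketbraL (η : E) : E →L[ℂ] CompactOp B E :=
  LinearMap.mkContinuous
    { toFun := fun ξ => ketbra B ξ η
      map_add' := fun x y => CompactOp.ext (ContinuousLinearMap.ext fun ζ => add_act x y _)
      map_smul' := fun c x => CompactOp.ext (ContinuousLinearMap.ext fun ζ => smul_act c x _) }
    ‖η‖ fun ξ => by rw [mul_comm]; exact norm_ketbra_le ξ η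

theorem ketbraL_apply (ξ η : E) : ketbraL B η ξ = ketbra B ξ η := rfl

theorem ketbra_sub (ξ ξ' η : E) : ketbra B (ξ - ξ') η = ketbra B ξ η - ketbra B ξ' η :=
  (ketbraL B η).map_sub ξ ξ'

theorem continuous_ketbra : Continuous fun p : E × E => ketbra B p.1 p.2 :=
  (continuous_rankOne B).subtype_mk _

variable (B) in
/-- The map `T ↦ T ζ`. -/
noncomputable def evalOp (ζ : E) : CompactOp B E →L[ℂ] E :=
  LinearMap.mkContinuous
    { toFun := fun T => T.op ζ
      map_add' := fun _ _ => rfl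
      map_smul' := fun _ _ => rfl }
    ‖ζ‖ fun T => by rw [mul_comm]; exact T.op.le_opNorm ζ

theorem continuous_op : Continuous (CompactOp.op : CompactOp B E → E →L[ℂ] E) :=
  continuous_subtype_val

theorem norm_le_of_inner_op {T : CompactOp B E} {C : ℝ} (hC : 0 ≤ C)
    (h : ∀ ζ ζ', ‖inner B ζ (T.op ζ')‖ ≤ C * ‖ζ‖ * ‖ζ'‖) : ‖T‖ ≤ C := by
  rw [CompactOp.norm_def]
  refine T.op.opNorm_le_bound hC fun x => norm_le_of_inner (B := B) (by positivity) ?_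
  refine (h _ _).trans (le_of_eq (by ring))

theorem dense_span_ketbra :
    Dense (Submodule.span ℂ {T : CompactOp B E | ∃ ξ η, T = ketbra B ξ η} :
      Set (CompactOp B E)) := by
  intro T
  rw [Metric.mem_closure_iff]
  intro ε hε
  have hT : T.op ∈ closure (finiteRank B E : Set (E →L[ℂ] E)) := T.2
  obtain ⟨S, hS, hST⟩ := Metric.mem_closure_iff.1 hT ε hε
  have hS' : S ∈ Submodule.span ℂ (Set.range fun p : E × E => rankOne B p.1 p.2) := hS
  have key : ∀ S ∈ Submodule.span ℂ (Set.range fun p : E × E => rankOne B p.1 p.2),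
      ∃ T ∈ Submodule.span ℂ {T : CompactOp B E | ∃ ξ η, T = ketbra B ξ η}, T.op = S := by
    intro S hS
    induction hS using Submodule.span_induction with
    | zero => exact ⟨0, Submodule.zero_mem _, rfl⟩
    | add x y _ _ hx hy =>
      obtain ⟨S, hS, rfl⟩ := hx
      obtain ⟨S', hS', rfl⟩ := hy
      exact ⟨_, Submodule.add_mem _ hS hS', rfl⟩
    | smul c x _ hx =>
      obtain ⟨S, hS, rfl⟩ := hx
      exact ⟨_, Submodule.smul_mem _ c hS, rfl⟩
    | mem x hx =>
      obtain ⟨⟨ξ, η⟩, rfl⟩ := hx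
      exact ⟨_, Submodule.subset_span ⟨ξ, η, rfl⟩, rfl⟩
  obtain ⟨S', hS'', rfl⟩ := key S hS'
  exact ⟨S', hS'', hST⟩

/-- Testing |x⟩⟨x| at x gives a*a with a = ⟨x,x⟩. This recovers norms in `E` from norms in K(E). -/
theorem norm_ketbra_self (x : E) : ‖ketbra B x x‖ = ‖x‖ ^ 2 := by
  refine le_antisymm ((norm_ketbra_le x x).trans (le_of_eq (by ring))) ?_
  rcases (norm_nonneg x).eq_or_lt with h0 | h0
  · rw [← h0]; simp
  · set a := inner B x x with ha
    have h1 : inner B x ((ketbra B x x).op x) = star a * a := by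
      rw [ketbra_apply, HilbertModule.inner_act_right, ha, HilbertModule.star_inner]
    have h2 : ‖a‖ = ‖x‖ ^ 2 := (HilbertModule.norm_sq_eq x).symm
    have h3 : ‖star a * a‖ ≤ ‖x‖ * (‖ketbra B x x‖ * ‖x‖) := by
      rw [← h1]
      refine (norm_inner_le _ _).trans ?_
      gcongr
      exact (ketbra B x x).op.le_opNorm x
    rw [CStarRing.norm_star_mul_self, h2] at h3
    have h4 : ‖x‖ ^ 2 * ‖x‖ ^ 2 ≤ ‖x‖ ^ 2 * ‖ketbra B x x‖ := h3.trans (le_of_eq (by ring))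
    exact le_of_mul_le_mul_left h4 (by positivity)

variable [CompleteSpace E]

theorem star_ketbra (ξ η : E) : star (ketbra B ξ η) = ketbra B η ξ :=
  CompactOp.star_eq (isAdjoint_rankOne ξ η)

theorem mul_ketbra (T : CompactOp B E) (ξ η : E) : T * ketbra B ξ η = ketbra B (T.op ξ) η :=
  CompactOp.ext (mul_rankOne (CompactOp.isAdjoint_star T) ξ η)

theorem ketbra_mul_ketbra (ξ η ξ' η' : E) :
    ketbra B ξ η * ketbra B ξ' η' = ketbra B (ξ <• inner B η ξ') η' := mul_ketbra _ _ _

theorem op_act (T : CompactOp B E) (x : E) (b : B) : T.op (x <• b) = T.op x <• b :=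
  AdjPair.map_act (B := B) (Y := (star T).op) (CompactOp.isAdjoint_star T) x b

theorem inner_op_left (T : CompactOp B E) (x y : E) :
    inner B (T.op x) y = inner B x ((star T).op y) := CompactOp.isAdjoint_star T x y

variable {G : Type*} [Group G] [TopologicalSpace G] [CStarAction G B] [HilbertAction G B E]

theorem op_cact (g : G) (T : CompactOp B E) (x : E) :
    (CStarAction.act g T).op x = gact B g (T.op (gact B g⁻¹ x)) := rfl

theorem op_cact_gact (g : G) (T : CompactOp B E) (x : E) :
    (CStarAction.act g T).op (gact B g x) = gact B g (T.op x) := by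
  rw [op_cact, gact_inv_gact]

theorem cact_ketbra (g : G) (ξ η : E) :
    CStarAction.act g (ketbra B ξ η) = ketbra B (gact B g ξ) (gact B g η) :=
  CompactOp.ext (conj_rankOne B g ξ η)

theorem inner_compact (S T : CompactOp B E) : inner (CompactOp B E) S T = star S * T := rfl

theorem act_compact (S T : CompactOp B E) : S <• T = S * T := rfl

end KetBra

section Order

variable {B E : Type*} [NonUnitalCStarAlgebra B] [PartialOrder B] [StarOrderedRing B]
  [NormedAddCommGroup E] [NormedSpace ℂ E] [SMul Bᵐᵒᵖ E] [HilbertModule B E]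

theorem inner_self_nonneg' (x : E) : (0 : B) ≤ inner B x x := by
  obtain ⟨b, hb⟩ := HilbertModule.inner_self_nonneg (B := B) x
  rw [hb]; exact star_mul_self_nonneg b

/-- The Cauchy-Schwarz inequality in the order of `B`. -/
theorem star_inner_mul_inner_le (x y : E) :
    star (inner B x y) * inner B x y ≤ ‖x‖ ^ 2 • inner B y y := by
  set c : B := inner B x y with hc
  rcases eq_or_ne x 0 with rfl | hx
  · rw [hc, inner_zero_left, mul_zero, norm_zero]; simp
  set M := ‖x‖ ^ 2 with hM
  have hM0 : 0 < M := by have := norm_pos_iff.2 hx; positivity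
  have h1 := inner_self_nonneg' (B := B) (x <• c - M • y)
  have hs : ∀ z w : E, inner B (M • z) w = M • (inner B z w : B) := fun z w => by
    have := inner_smul_left (B := B) (M : ℂ) z w
    simpa using this
  have hs' : ∀ z w : E, inner B z (M • w) = M • (inner B z w : B) := fun z w => by
    have := HilbertModule.inner_smul_right (B := B) (M : ℂ) z w
    simpa using this
  have h2 : inner B (x <• c - M • y) (x <• c - M • y)
      = star c * inner B x x * c - (2 * M) • (star c * c) + (M * M) • (inner B y y : B) := by
    have hyx : inner B y x = star c := by rw [hc, HilbertModule.star_inner]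
    simp only [inner_sub_left, inner_sub_right, hs, hs', inner_act_left,
      HilbertModule.inner_act_right, hyx, ← hc, two_mul, add_smul, mul_smul, smul_sub, mul_assoc,
      sub_mul, smul_mul_assoc]
    abel
  have h3 : star c * inner B x x * c ≤ M • (star c * c) := by
    refine (CStarAlgebra.star_left_conjugate_le_norm_smul
      (hb := IsSelfAdjoint.of_nonneg (inner_self_nonneg' x))).trans ?_
    rw [← HilbertModule.norm_sq_eq]
  rw [h2] at h1
  have h4 : (0 : B) ≤ M • (M • (inner B y y : B) - star c * c) := by
    refine h1.trans (le_of_le_of_eq (add_le_add_left (sub_le_sub_right h3 _) _) ?_)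
    rw [two_mul, add_smul, smul_sub, mul_smul]
    abel
  have h5 := smul_nonneg (inv_nonneg.2 hM0.le) h4
  rw [smul_smul, inv_mul_cancel₀ hM0.ne', one_smul] at h5
  exact sub_nonneg.1 h5

end Order

end SquareIntegrable

/-! ### Bounded maps between L²(G,K(E)) and L²(G,B) -/

namespace SquareIntegrable

section Transfer

variable {G : Type*} [Group G] [TopologicalSpace G] [IsTopologicalGroup G]
  [LocallyCompactSpace G] [T2Space G] [MeasurableSpace G] [BorelSpace G]
  {μ : Measure G} [μ.IsHaarMeasure]
  {B : Type*} [NonUnitalCStarAlgebra B] [CStarAction G B]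
  {E : Type*} [NormedAddCommGroup E] [NormedSpace ℂ E] [CompleteSpace E] [SMul Bᵐᵒᵖ E]
  [HilbertModule B E] [HilbertAction G B E]

variable (B) in
/-- The map `f ↦ (g ↦ ⟨γ_g η, f(g) ζ⟩)` from `C_c(G, K(E))` to `C_c(G, B)`. -/
noncomputable def opToFun (η ζ : E) : C_c(G, CompactOp B E) →ₗ[ℂ] C_c(G, B) where
  toFun f :=
    { toFun := fun g => inner B (gact B g η) ((f g).op ζ)
      continuous_toFun := continuous_inner (continuous_gact B η)
        ((evalOp B ζ).continuous.comp f.continuous)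
      hasCompactSupport' := HasCompactSupport.intro f.hasCompactSupport.isCompact fun g hg => by
        rw [image_eq_zero_of_notMem_tsupport hg, CompactOp.op_zero, zero_apply, inner_zero_right] }
  map_add' f k := CompactlySupportedContinuousMap.ext fun g =>
    HilbertModule.inner_add_right _ ((f g).op ζ) ((k g).op ζ)
  map_smul' c f := CompactlySupportedContinuousMap.ext fun g =>
    HilbertModule.inner_smul_right c _ ((f g).op ζ)

theorem opToFun_apply (η ζ : E) (f : C_c(G, CompactOp B E)) (g : G) :
    opToFun B η ζ f g = inner B (gact B g η) ((f g).op ζ) := rfl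

theorem op_integral {X : Type*} [MeasurableSpace X] {ν : Measure X} {u : X → CompactOp B E}
    (hu : Integrable u ν) (ζ : E) : (∫ x, u x ∂ν).op ζ = ∫ x, (u x).op ζ ∂ν :=
  ((evalOp B ζ).integral_comp_comm hu).symm

/-- Pointwise Cauchy–Schwarz in the order of `B` bounds the square by ‖η‖²⟨ζ, f(g)*f(g)ζ⟩;
integrating gives the coefficient of ∫f*f at ζ. -/
theorem norm_opToFun_le (η ζ : E) (f : C_c(G, CompactOp B E)) :
    ‖(toL2 μ).comp (opToFun B η ζ) f‖ ≤ ‖η‖ * ‖ζ‖ * ‖toL2 μ f‖ := by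
  let _ := CStarAlgebra.spectralOrder B
  have _ := CStarAlgebra.spectralOrderedRing B
  refine le_of_sq_le_sq (α := ℝ) ?_ (by positivity)
  have hf : Integrable (fun g => star (f g) * f g) μ := integrable_cc μ (star f * f)
  have h0 : ∀ g, (star (f g) * f g).op ζ = (star (f g)).op ((f g).op ζ) := fun g => rfl
  have hi : Integrable (fun g => (star (f g) * f g).op ζ) μ := (evalOp B ζ).integrable_comp hf
  have h1 : ∫ g, star (opToFun B η ζ f g) * opToFun B η ζ f g ∂μ
      ≤ ‖η‖ ^ 2 • inner B ζ ((∫ g, star (f g) * f g ∂μ).op ζ) := by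
    rw [op_integral hf, ← innerL_apply, ← (innerL B E ζ).integral_comp_comm hi, ← integral_smul]
    refine integral_mono (integrable_cc μ (star (opToFun B η ζ f) * opToFun B η ζ f))
      (((innerL B E ζ).integrable_comp hi).smul (‖η‖ ^ 2)) fun g => ?_
    have := star_inner_mul_inner_le (B := B) (gact B g η) ((f g).op ζ)
    rw [norm_gact, inner_op_left] at this
    exact this
  change ‖toL2 μ (opToFun B η ζ f)‖ ^ 2 ≤ _
  rw [norm_toL2, mul_pow, norm_toL2 μ f]
  have h2 := CStarAlgebra.norm_le_norm_of_nonneg_of_le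
    (integral_nonneg fun g => star_mul_self_nonneg _) h1
  refine h2.trans ?_
  rw [norm_smul, Real.norm_of_nonneg (by positivity)]
  calc _ ≤ ‖η‖ ^ 2 * (‖ζ‖ * (‖∫ g, star (f g) * f g ∂μ‖ * ‖ζ‖)) := by
        gcongr
        refine (norm_inner_le _ _).trans ?_
        gcongr
        exact (∫ g, star (f g) * f g ∂μ).op.le_opNorm ζ
    _ = _ := by ring

variable (μ B) in
/-- The extension of `opToFun` to square-integrable functions. -/
noncomputable def opToFunL2 (η ζ : E) : L2 μ (CompactOp B E) →L[ℂ] L2 μ B :=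
  extendL2 μ ((toL2 μ).comp (opToFun B η ζ))

theorem opToFunL2_toL2 (η ζ : E) (f : C_c(G, CompactOp B E)) :
    opToFunL2 μ B η ζ (toL2 μ f) = toL2 μ (opToFun B η ζ f) :=
  extendL2_toL2 μ (norm_opToFun_le η ζ) f

theorem norm_opToFunL2_le (η ζ : E) (x : L2 μ (CompactOp B E)) :
    ‖opToFunL2 μ B η ζ x‖ ≤ ‖η‖ * ‖ζ‖ * ‖x‖ :=
  (opToFunL2 μ B η ζ).le_of_opNorm_le
    (norm_extendL2_le μ (by positivity) (norm_opToFun_le η ζ)) x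

variable (B) in
/-- The map `f ↦ (g ↦ |γ_g(η) f(g)⟩⟨β|)` from `C_c(G, B)` to `C_c(G, K(E))`. -/
noncomputable def funToOp (η β : E) : C_c(G, B) →ₗ[ℂ] C_c(G, CompactOp B E) where
  toFun f :=
    { toFun := fun g => ketbra B (gact B g η <• f g) β
      continuous_toFun := (ketbraL B β).continuous.comp
        (continuous_act (continuous_gact B η) f.continuous)
      hasCompactSupport' := HasCompactSupport.intro f.hasCompactSupport.isCompact fun g hg => by
        rw [image_eq_zero_of_notMem_tsupport hg, act_zero, ← ketbraL_apply, map_zero] }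
  map_add' f k := CompactlySupportedContinuousMap.ext fun g => by
    change ketbra B (gact B g η <• (f g + k g)) β = _
    rw [act_add, ← ketbraL_apply, map_add]; rfl
  map_smul' c f := CompactlySupportedContinuousMap.ext fun g => by
    change ketbra B (gact B g η <• (c • f g)) β = _
    rw [act_smul, ← ketbraL_apply, map_smul]; rfl

theorem funToOp_apply (η β : E) (f : C_c(G, B)) (g : G) :
    funToOp B η β f g = ketbra B (gact B g η <• f g) β := rfl

theorem integral_ketbra_act {X : Type*} [MeasurableSpace X] {ν : Measure X} {u : X → B}
    (hu : Integrable u ν) (β β' : E) :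
    ∫ x, ketbra B (β <• u x) β' ∂ν = ketbra B (β <• ∫ x, u x ∂ν) β' := by
  have h := ((ketbraL B β').comp (actL B E β)).integral_comp_comm hu
  exact h

variable (B) in
/-- The function `g ↦ ⟨γ_g(η) f(g), γ_g(η) f(g)⟩`. -/
noncomputable def gramFun (η : E) (f : C_c(G, B)) : C_c(G, B) where
  toFun g := inner B (gact B g η <• f g) (gact B g η <• f g)
  continuous_toFun := continuous_inner (continuous_act (continuous_gact B η) f.continuous)
    (continuous_act (continuous_gact B η) f.continuous)
  hasCompactSupport' := HasCompactSupport.intro f.hasCompactSupport.isCompact fun g hg => by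
    rw [image_eq_zero_of_notMem_tsupport hg, act_zero, inner_zero_right]

/-- Because all values share the same right-hand vector β, the K(E)-valued square is rank one around
a single element of `B`. -/
theorem integral_star_funToOp_mul (η β : E) (f : C_c(G, B)) :
    ∫ g, star (funToOp B η β f g) * funToOp B η β f g ∂μ
      = ketbra B (β <• ∫ g, gramFun B η f g ∂μ) β := by
  rw [← integral_ketbra_act (integrable_cc μ (gramFun B η f))]
  refine integral_congr_ae (Eventually.of_forall fun g => ?_)
  simp only [funToOp_apply, star_ketbra, ketbra_mul_ketbra]
  rfl

theorem norm_integral_gramFun_le (η : E) (f : C_c(G, B)) :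
    ‖∫ g, gramFun B η f g ∂μ‖ ≤ ‖η‖ ^ 2 * ‖∫ g, star (f g) * f g ∂μ‖ := by
  let _ := CStarAlgebra.spectralOrder B
  have _ := CStarAlgebra.spectralOrderedRing B
  have h2 : ∫ g, gramFun B η f g ∂μ ≤ ‖η‖ ^ 2 • ∫ g, star (f g) * f g ∂μ := by
    rw [← integral_smul]
    have hf : Integrable (fun g => star (f g) * f g) μ := integrable_cc μ (star f * f)
    refine integral_mono (integrable_cc μ (gramFun B η f)) (hf.smul (‖η‖ ^ 2)) fun g => ?_
    change inner B (gact B g η <• f g) (gact B g η <• f g) ≤ ‖η‖ ^ 2 • (star (f g) * f g)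
    rw [HilbertModule.inner_act_right, inner_act_left]
    refine (CStarAlgebra.star_left_conjugate_le_norm_smul
      (hb := IsSelfAdjoint.of_nonneg (inner_self_nonneg' _))).trans ?_
    rw [← HilbertModule.norm_sq_eq, norm_gact]
  have h3 := CStarAlgebra.norm_le_norm_of_nonneg_of_le
    (integral_nonneg fun g => inner_self_nonneg' _) h2
  rwa [norm_smul, Real.norm_of_nonneg (by positivity)] at h3

theorem norm_toL2_funToOp_sq_le (η β : E) (f : C_c(G, B)) :
    ‖toL2 μ (funToOp B η β f)‖ ^ 2 ≤ (‖η‖ * ‖β‖ * ‖toL2 μ f‖) ^ 2 := by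
  have h1 : ‖ketbra B (β <• ∫ g, gramFun B η f g ∂μ) β‖
      ≤ ‖β‖ * (‖η‖ ^ 2 * ‖toL2 μ f‖ ^ 2) * ‖β‖ := by
    refine (norm_ketbra_le _ _).trans ?_
    gcongr
    refine (norm_act_le _ _).trans ?_
    gcongr
    rw [norm_toL2]
    exact norm_integral_gramFun_le η f
  rw [norm_toL2 μ (funToOp B η β f), integral_star_funToOp_mul]
  exact h1.trans (le_of_eq (by ring))

theorem norm_funToOp_le (η β : E) (f : C_c(G, B)) :
    ‖(toL2 μ (B := CompactOp B E)).comp (funToOp B η β) f‖ ≤ ‖η‖ * ‖β‖ * ‖toL2 μ f‖ := by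
  rw [LinearMap.comp_apply]
  exact le_of_sq_le_sq (norm_toL2_funToOp_sq_le η β f) (by positivity)

variable (μ) in
/-- The extension of `funToOp` to square-integrable functions. -/
noncomputable def funToOpL2 (η β : E) : L2 μ B →L[ℂ] L2 μ (CompactOp B E) :=
  extendL2 μ ((toL2 μ).comp (funToOp B η β))

theorem funToOpL2_toL2 (η β : E) (f : C_c(G, B)) :
    funToOpL2 μ η β (toL2 μ f) = toL2 μ (funToOp B η β f) :=
  extendL2_toL2 μ (norm_funToOp_le η β) f

theorem norm_funToOpL2_le (η β : E) (x : L2 μ B) :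
    ‖funToOpL2 μ η β x‖ ≤ ‖η‖ * ‖β‖ * ‖x‖ :=
  (funToOpL2 μ η β).le_of_opNorm_le
    (norm_extendL2_le μ (by positivity) (norm_funToOp_le η β)) x

/-- The transfer commutes with multiplication by cut-off functions and is bounded, so it respects
the limit defining `RepresentsL2`; the next lemma is its counterpart in the other direction. -/
theorem RepresentsL2.opToFun {f : C(G, CompactOp B E)} {F : L2 μ (CompactOp B E)}
    (h : RepresentsL2 μ f F) (η ζ : E) {k : C(G, B)}
    (hk : ∀ g, k g = inner B (gact B g η) ((f g).op ζ)) :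
    RepresentsL2 μ k (opToFunL2 μ B η ζ F) := by
  refine (((opToFunL2 μ B η ζ).continuous.tendsto F).comp h).congr fun χ => ?_
  rw [Function.comp_apply, opToFunL2_toL2]
  congr 1
  refine CompactlySupportedContinuousMap.ext fun g => ?_
  change inner B (gact B g η) ((χ g • f g).op ζ) = χ g • k g
  rw [hk]
  exact (innerL B E (gact B g η)).map_smul (χ g) ((f g).op ζ)

theorem RepresentsL2.funToOp {f : C(G, B)} {F : L2 μ B} (h : RepresentsL2 μ f F) (η β : E)
    {k : C(G, CompactOp B E)} (hk : ∀ g, k g = ketbra B (gact B g η <• f g) β) :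
    RepresentsL2 μ k (funToOpL2 μ η β F) := by
  refine (((funToOpL2 μ η β).continuous.tendsto F).comp h).congr fun χ => ?_
  rw [Function.comp_apply, funToOpL2_toL2]
  congr 1
  refine CompactlySupportedContinuousMap.ext fun g => ?_
  change ketbra B (gact B g η <• (χ g • f g)) β = χ g • k g
  rw [hk, act_real_smul]
  exact (ketbraL B β).map_smul_of_tower (χ g) _

end Transfer

end SquareIntegrable

/-! ### The ideal of inner products, and kets of |ξ⟩⟨η| and Tη -/

namespace SquareIntegrable

section Span

variable (B E : Type*) [NonUnitalCStarAlgebra B] [NormedAddCommGroup E] [NormedSpace ℂ E]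
  [SMul Bᵐᵒᵖ E] [HilbertModule B E]

/-- The ideal of `B` spanned by the inner products of elements of `E`. -/
noncomputable def innerSpan : NonUnitalStarSubalgebra ℂ B where
  toNonUnitalSubalgebra :=
    { toSubmodule := Submodule.span ℂ {b | ∃ x y : E, b = inner B x y}
      mul_mem' := by
        intro a b ha _
        change a ∈ Submodule.span ℂ _ at ha
        change a * b ∈ Submodule.span ℂ _
        induction ha using Submodule.span_induction with
        | zero => rw [zero_mul]; exact Submodule.zero_mem _
        | add x y _ _ hx hy => rw [add_mul]; exact Submodule.add_mem _ hx hy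
        | smul c x _ hx => rw [smul_mul_assoc]; exact Submodule.smul_mem _ c hx
        | mem x hx =>
          obtain ⟨ξ, η, rfl⟩ := hx
          exact Submodule.subset_span ⟨ξ, η <• b, (HilbertModule.inner_act_right _ _ _).symm⟩ }
  star_mem' := by
    intro a ha
    change a ∈ Submodule.span ℂ _ at ha
    change star a ∈ Submodule.span ℂ _
    induction ha using Submodule.span_induction with
    | zero => rw [star_zero]; exact Submodule.zero_mem _
    | add x y _ _ hx hy => rw [star_add]; exact Submodule.add_mem _ hx hy
    | smul c x _ hx => rw [star_smul]; exact Submodule.smul_mem _ _ hx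
    | mem x hx =>
      obtain ⟨ξ, η, rfl⟩ := hx
      exact Submodule.subset_span ⟨η, ξ, HilbertModule.star_inner _ _⟩

/-- The closed ideal of `B` generated by the inner products of elements of `E`. -/
noncomputable def innerIdeal : NonUnitalStarSubalgebra ℂ B := (innerSpan B E).topologicalClosure

theorem isClosed_innerIdeal : IsClosed (innerIdeal B E : Set B) := isClosed_closure

variable {B E}

theorem mem_innerIdeal {b : B} :
    b ∈ innerIdeal B E ↔ b ∈ closure (Submodule.span ℂ {b | ∃ x y : E, b = inner B x y} : Set B) :=
  Iff.rfl

theorem inner_mem_innerIdeal (x y : E) : inner B x y ∈ innerIdeal B E :=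
  subset_closure (Submodule.subset_span ⟨x, y, rfl⟩)

/-- A closed subspace that contains all inner products contains the ideal they generate. -/
theorem innerIdeal_induction {p : B → Prop} (hc : IsClosed {b | p b}) (h0 : p 0)
    (hadd : ∀ a b, p a → p b → p (a + b)) (hsmul : ∀ (c : ℂ) a, p a → p (c • a))
    (h : ∀ x y : E, p (inner B x y)) {b : B} (hb : b ∈ innerIdeal B E) : p b := by
  refine hc.closure_subset_iff.2 ?_ (mem_innerIdeal.1 hb)
  intro a ha
  induction ha using Submodule.span_induction with
  | zero => exact h0
  | add x y _ _ hx hy => exact hadd _ _ hx hy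
  | smul c x _ hx => exact hsmul _ _ hx
  | mem x hx =>
    obtain ⟨ξ, η, rfl⟩ := hx
    exact h ξ η

theorem innerIdeal_mul_mem {a : B} (ha : a ∈ innerIdeal B E) (b : B) : a * b ∈ innerIdeal B E :=
  innerIdeal_induction (E := E) (p := fun a => a * b ∈ innerIdeal B E)
    ((isClosed_innerIdeal B E).preimage (continuous_mul_const b))
    (by rw [zero_mul]; exact zero_mem _) (fun x y hx hy => by rw [add_mul]; exact add_mem hx hy)
    (fun c x hx => by rw [smul_mul_assoc]; exact SMulMemClass.smul_mem c hx)
    (fun x y => by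
      rw [← HilbertModule.inner_act_right]; exact inner_mem_innerIdeal _ _) ha

theorem mul_innerIdeal_mem {a : B} (ha : a ∈ innerIdeal B E) (b : B) : b * a ∈ innerIdeal B E := by
  have := star_mem (innerIdeal_mul_mem (star_mem ha) (star b))
  simpa using this

theorem cact_mem_innerIdeal {G : Type*} [Group G] [TopologicalSpace G] [CStarAction G B]
    [HilbertAction G B E] (g : G) {b : B} (hb : b ∈ innerIdeal B E) :
    CStarAction.act g b ∈ innerIdeal B E :=
  innerIdeal_induction (E := E) (p := fun b => CStarAction.act g b ∈ innerIdeal B E)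
    ((isClosed_innerIdeal B E).preimage (continuous_cstarAct continuous_const continuous_id))
    (by rw [map_zero]; exact zero_mem _) (fun x y hx hy => by rw [map_add]; exact add_mem hx hy)
    (fun c x hx => by rw [map_smul]; exact SMulMemClass.smul_mem c hx)
    (fun x y => by rw [← inner_gact]; exact inner_mem_innerIdeal _ _) hb

/-- An approximate unit of the closed ideal fixes ξ approximately because ⟨ξ,ξ⟩ lies in that ideal;
then replace it by a nearby finite sum of inner products. -/
theorem exists_act_near [CompleteSpace E] (ξ : E) {ε : ℝ} (hε : 0 < ε) :
    ∃ b ∈ innerSpan B E, ‖ξ - ξ <• b‖ < ε := by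
  obtain ⟨e, heI, he, -, hC⟩ := exists_approxUnit (innerIdeal B E) (isClosed_innerIdeal B E)
    (isCompact_singleton (x := inner B ξ ξ))
    (by rw [Set.singleton_subset_iff]; exact inner_mem_innerIdeal ξ ξ)
    (show 0 < (ε / 2) ^ 2 / 2 by positivity)
  have h1 : ‖ξ - ξ <• e‖ ≤ ε / 2 := by
    refine le_of_sq_le_sq (α := ℝ) ?_ (by positivity)
    have := norm_sub_act_sq_le ξ he
    linarith [hC _ rfl]
  obtain ⟨b, hb, hbe⟩ := Metric.mem_closure_iff.1 (mem_innerIdeal.1 heI) (ε / (2 * (‖ξ‖ + 1)))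
    (by positivity)
  rw [dist_eq_norm] at hbe
  refine ⟨b, hb, ?_⟩
  have h2 : ξ - ξ <• b = (ξ - ξ <• e) + ξ <• (e - b) := by rw [act_sub]; abel
  have h3 : ‖ξ <• (e - b)‖ < ε / 2 := by
    calc _ ≤ ‖ξ‖ * ‖e - b‖ := norm_act_le _ _
      _ ≤ (‖ξ‖ + 1) * ‖e - b‖ := by gcongr; linarith
      _ < (‖ξ‖ + 1) * (ε / (2 * (‖ξ‖ + 1))) := by gcongr
      _ = ε / 2 := by field_simp
  rw [h2]
  exact (norm_add_le _ _).trans_lt (by linarith)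

/-- ξ is a limit of sums of ξ⟨η,ζ⟩ = |ξ⟩⟨η|ζ, so K(E) acts nondegenerately. -/
theorem dense_span_op_apply [CompleteSpace E] :
    Dense (Submodule.span ℂ {x : E | ∃ (S : CompactOp B E) (α : E), x = S.op α} : Set E) := by
  intro ξ
  rw [Metric.mem_closure_iff]
  intro ε hε
  obtain ⟨b, hb, h⟩ := exists_act_near (B := B) ξ hε
  refine ⟨ξ <• b, ?_, by rwa [dist_eq_norm]⟩
  change b ∈ Submodule.span ℂ _ at hb
  change _ ∈ Submodule.span ℂ _
  clear h
  induction hb using Submodule.span_induction with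
  | zero => rw [act_zero]; exact Submodule.zero_mem _
  | add x y _ _ hx hy => rw [act_add]; exact Submodule.add_mem _ hx hy
  | smul c x _ hx => rw [act_smul]; exact Submodule.smul_mem _ c hx
  | mem x hx =>
    obtain ⟨η, ζ, rfl⟩ := hx
    exact Submodule.subset_span ⟨ketbra B ξ η, ζ, rfl⟩

/-- The norm of an element of the ideal spanned by the inner products is determined by its right
action on the module. -/
theorem norm_le_of_norm_act_le {a : B} (ha : a ∈ innerIdeal B E) {c : ℝ} (hc : 0 ≤ c)
    (h : ∀ β : E, ‖β <• a‖ ≤ c * ‖β‖) : ‖a‖ ≤ c := by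
  by_contra! hlt
  have ha0 : 0 < ‖a‖ := hc.trans_lt hlt
  -- Normalise p = aa*/‖a‖²: a self-adjoint element of norm 1 whose action on `E` has norm at most r
  -- < 1. The iterated squares of p keep norm 1 by the C*-identity, but their actions tend to 0.
  set t := (‖a‖ ^ 2)⁻¹ with ht
  set p := t • (a * star a) with hp
  have hpI : p ∈ innerIdeal B E := by
    have := SMulMemClass.smul_mem (t : ℂ) (innerIdeal_mul_mem ha (star a))
    simpa [hp] using this
  have hpn : ‖p‖ = 1 := by
    rw [hp, norm_smul, CStarRing.norm_self_mul_star, Real.norm_of_nonneg (by positivity), ht]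
    field_simp
  have hps : star p = p := by rw [hp, star_smul, star_mul, star_star, star_trivial]
  set r := c / ‖a‖ with hr
  have hr0 : 0 ≤ r := by positivity
  have hr1 : r < 1 := (div_lt_one ha0).2 hlt
  have hpr : ∀ β : E, ‖β <• p‖ ≤ r * ‖β‖ := fun β => by
    rw [hp, act_real_smul, norm_smul, ← act_act, Real.norm_of_nonneg (by positivity)]
    calc _ ≤ t * (‖β <• a‖ * ‖star a‖) := by gcongr; exact norm_act_le _ _
      _ ≤ t * (c * ‖β‖ * ‖a‖) := by rw [norm_star]; gcongr; exact h β
      _ = r * ‖β‖ := by rw [ht, hr]; field_simp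
  obtain ⟨q, hq0, hqs⟩ : ∃ q : ℕ → B, q 0 = p ∧ ∀ n, q (n + 1) = q n * q n :=
    ⟨fun n => Nat.rec p (fun _ x => x * x) n, rfl, fun _ => rfl⟩
  have hqstar : ∀ n, star (q n) = q n := by
    intro n
    induction n with
    | zero => rw [hq0, hps]
    | succ n ih => rw [hqs, star_mul, ih]
  have hqn : ∀ n, ‖q n‖ = 1 := by
    intro n
    induction n with
    | zero => rw [hq0, hpn]
    | succ n ih =>
      have := CStarRing.norm_star_mul_self (x := q n)
      rw [hqstar, ih] at this
      rw [hqs, this, one_mul]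
  have hqp : ∀ n y, ‖q n * y‖ ≤ ‖p * y‖ := by
    intro n
    induction n with
    | zero => exact fun y => by rw [hq0]
    | succ n ih =>
      intro y
      rw [hqs, mul_assoc]
      calc _ ≤ ‖q n‖ * ‖q n * y‖ := norm_mul_le _ _
        _ ≤ ‖p * y‖ := by rw [hqn, one_mul]; exact ih y
  have hqr : ∀ n (β : E), ‖β <• q n‖ ≤ r ^ (2 ^ n) * ‖β‖ := by
    intro n
    induction n with
    | zero => simpa [hq0] using hpr
    | succ n ih =>
      intro β
      rw [hqs, ← act_act, pow_succ, pow_mul, pow_two, mul_assoc]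
      exact (ih _).trans (mul_le_mul_of_nonneg_left (ih β) (by positivity))
  have hspan : ∀ x ∈ Submodule.span ℂ {b : B | ∃ x y : E, b = inner B x y},
      Tendsto (fun n => x * q n) atTop (𝓝 0) := by
    intro x hx
    induction hx using Submodule.span_induction with
    | zero => simp
    | add x y _ _ hx hy => simpa [add_mul] using hx.add hy
    | smul c x _ hx => simpa [smul_mul_assoc] using hx.const_smul c
    | mem x hx =>
      obtain ⟨ξ, η, rfl⟩ := hx
      have h1 : Tendsto (fun n : ℕ => ‖ξ‖ * (r ^ (2 ^ n) * ‖η‖)) atTop (𝓝 0) := by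
        have h2 : Tendsto (fun n : ℕ => r ^ (2 ^ n)) atTop (𝓝 0) :=
          (tendsto_pow_atTop_nhds_zero_of_lt_one hr0 hr1).comp
            (tendsto_pow_atTop_atTop_of_one_lt one_lt_two)
        simpa using (h2.mul_const ‖η‖).const_mul ‖ξ‖
      refine squeeze_zero_norm (fun n => ?_) h1
      rw [← HilbertModule.inner_act_right]
      exact (norm_inner_le _ _).trans (mul_le_mul_of_nonneg_left (hqr n η) (norm_nonneg _))
  -- On the span of the inner products, multiplication by q_n tends to 0. Approximating p by such an
  -- x within 1/2 gives 1 = ‖q_{n+1}‖ ≤ ‖p q_n‖ < 1.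
  obtain ⟨x, hx, hpx⟩ := Metric.mem_closure_iff.1 (mem_innerIdeal.1 hpI) (1 / 2) (by norm_num)
  rw [dist_eq_norm] at hpx
  obtain ⟨n, hn⟩ := ((Metric.tendsto_nhds.1 (hspan x hx) (1 / 2) (by norm_num))).exists
  rw [dist_zero_right] at hn
  have h1 : ‖q (n + 1)‖ ≤ ‖p * q n‖ := by rw [hqs]; exact hqp n (q n)
  have h2 : p * q n = (p - x) * q n + x * q n := by rw [sub_mul]; abel
  have h3 : ‖(p - x) * q n‖ ≤ ‖p - x‖ := by
    refine (norm_mul_le _ _).trans ?_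
    rw [hqn, mul_one]
  rw [hqn, h2] at h1
  linarith [norm_add_le ((p - x) * q n) (x * q n)]

end Span

section Kets

variable {G : Type*} [Group G] [TopologicalSpace G] [IsTopologicalGroup G]
  [LocallyCompactSpace G] [T2Space G] [MeasurableSpace G] [BorelSpace G]
  {μ : Measure G} [μ.IsHaarMeasure]
  {B : Type*} [NonUnitalCStarAlgebra B] [CStarAction G B]
  {E : Type*} [NormedAddCommGroup E] [NormedSpace ℂ E] [CompleteSpace E] [SMul Bᵐᵒᵖ E]
  [HilbertModule B E] [HilbertAction G B E]

theorem op_ketLin_ketbra (ξ η ζ : E) (f : C_c(G, CompactOp B E)) :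
    (ketLin μ (CompactOp B E) (ketbra B ξ η) f).op ζ = ketLin μ B ξ (opToFun B η ζ f) := by
  rw [ketLin_apply, op_integral (integrable_cc μ _)]
  refine integral_congr_ae (Eventually.of_forall fun g => ?_)
  change (CStarAction.act g (ketbra B ξ η) * f g).op ζ = _
  rw [cact_ketbra]
  rfl

theorem IsKet.op_ketbra_apply {ξ : E} {X : L2 μ B →L[ℂ] E} (hX : IsKet μ ξ X) (η ζ : E)
    (f : C_c(G, CompactOp B E)) :
    (ketLin μ (CompactOp B E) (ketbra B ξ η) f).op ζ = X (opToFunL2 μ B η ζ (toL2 μ f)) := by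
  rw [op_ketLin_ketbra, opToFunL2_toL2, hX.2]

theorem IsKet.norm_ketLin_ketbra_le {ξ : E} {X : L2 μ B →L[ℂ] E} (hX : IsKet μ ξ X) (η : E)
    (f : C_c(G, CompactOp B E)) :
    ‖ketLin μ (CompactOp B E) (ketbra B ξ η) f‖ ≤ ‖X‖ * ‖η‖ * ‖toL2 μ f‖ := by
  rw [CompactOp.norm_def]
  refine ContinuousLinearMap.opNorm_le_bound _ (by positivity) fun ζ => ?_
  rw [hX.op_ketbra_apply]
  calc _ ≤ ‖X‖ * (‖η‖ * ‖ζ‖ * ‖toL2 μ f‖) :=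
        X.le_opNorm_of_le (norm_opToFunL2_le η ζ _)
    _ = _ := by ring

/-- Against a rank-one |α⟩⟨β|, the bra of |ξ⟩⟨η| is the function |γ_g(η)⟨γ_gξ,α⟩⟩⟨β|, which is the
transfer of ⟨⟨ξ|α. Rank-ones are total in K(E). -/
theorem IsKet.ketbra {ξ : E} {X : L2 μ B →L[ℂ] E} (hX : IsKet μ ξ X) (η : E) :
    IsKet μ (ketbra B ξ η) (ket μ (CompactOp B E) (ketbra B ξ η)) := by
  refine isKet_of_bound (hX.norm_ketLin_ketbra_le η) dense_span_ketbra ?_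
  rintro _ ⟨α, β, rfl⟩
  refine ⟨_, (hX.represents α).funToOp η β fun g => ?_⟩
  change star (CStarAction.act g (SquareIntegrable.ketbra B ξ η)) * SquareIntegrable.ketbra B α β
    = _
  rw [cact_ketbra, star_ketbra, ketbra_mul_ketbra]
  rfl

theorem IsKet.siNorm_ketbra_le {ξ : E} {X : L2 μ B →L[ℂ] E} (hX : IsKet μ ξ X) (η : E) :
    siNorm μ (CompactOp B E) (SquareIntegrable.ketbra B ξ η) ≤ siNorm μ B ξ * ‖η‖ := by
  have h1 : ‖ket μ (CompactOp B E) (SquareIntegrable.ketbra B ξ η)‖ ≤ ‖X‖ * ‖η‖ :=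
    opNorm_le_of_toL2 μ (by positivity) fun f => by
      rw [(hX.ketbra η).2]; exact hX.norm_ketLin_ketbra_le η f
  rw [hX.siNorm_eq, siNorm, add_mul]
  exact add_le_add (norm_ketbra_le ξ η) h1

theorem ketLin_op_funToOp (T : CompactOp B E) (η β : E) (f : C_c(G, B)) :
    ketLin μ (CompactOp B E) T (funToOp B η β f) = ketbra B (ketLin μ B (T.op η) f) β := by
  rw [ketLin_apply, ketLin_apply, ← ketbraL_apply,
    ← (ketbraL B β).integral_comp_comm (integrable_cc μ _)]
  refine integral_congr_ae (Eventually.of_forall fun g => ?_)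
  change CStarAction.act g T * ketbra B (gact B g η <• f g) β = ketbra B (gact B g (T.op η) <• f g) β
  rw [mul_ketbra, op_act, op_cact_gact]

theorem IsKet.apply_funToOp {T : CompactOp B E} {Y : L2 μ (CompactOp B E) →L[ℂ] CompactOp B E}
    (hY : IsKet μ T Y) (η β : E) (f : C_c(G, B)) :
    Y (funToOpL2 μ η β (toL2 μ f)) = SquareIntegrable.ketbra B (ketLin μ B (T.op η) f) β := by
  rw [funToOpL2_toL2, hY.2, ketLin_op_funToOp]

theorem IsKet.norm_ketLin_op_le {T : CompactOp B E}
    {Y : L2 μ (CompactOp B E) →L[ℂ] CompactOp B E} (hY : IsKet μ T Y) (η : E) (f : C_c(G, B)) :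
    ‖ketLin μ B (T.op η) f‖ ≤ ‖Y‖ * ‖η‖ * ‖toL2 μ f‖ := by
  set x := ketLin μ B (T.op η) f with hx
  rcases (norm_nonneg x).eq_or_lt with h0 | h0
  · rw [← h0]; positivity
  -- Taking β to be the vector x itself makes the value of the ket |x⟩⟨x|, whose norm is ‖x‖².
  · have h1 : ‖x‖ ^ 2 ≤ ‖Y‖ * (‖η‖ * ‖x‖ * ‖toL2 μ f‖) := by
      rw [← norm_ketbra_self (B := B), hx, ← hY.apply_funToOp]
      exact Y.le_opNorm_of_le (norm_funToOpL2_le η _ _)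
    have h2 : ‖x‖ * ‖x‖ ≤ ‖x‖ * (‖Y‖ * ‖η‖ * ‖toL2 μ f‖) := by
      rw [← pow_two]; exact h1.trans (le_of_eq (by ring))
    exact le_of_mul_le_mul_left h2 h0

/-- Vectors Sα with S compact are total. Against Sα, the bra of Tη is the function ⟨γ_gη, (γ_g(T)*
S)α⟩, a transfer of ⟨⟨T|S. -/
theorem IsKet.op_apply {T : CompactOp B E} {Y : L2 μ (CompactOp B E) →L[ℂ] CompactOp B E}
    (hY : IsKet μ T Y) (η : E) : IsKet μ (T.op η) (ket μ B (T.op η)) := by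
  refine isKet_of_bound (hY.norm_ketLin_op_le η) (dense_span_op_apply (B := B)) ?_
  rintro _ ⟨S, α, rfl⟩
  refine ⟨_, (hY.represents S).opToFun η α fun g => ?_⟩
  change inner B (gact B g (T.op η)) (S.op α)
    = inner B (gact B g η) ((star (CStarAction.act g T)).op (S.op α))
  rw [← inner_op_left, op_cact_gact]

theorem IsKet.siNorm_op_le {T : CompactOp B E} {Y : L2 μ (CompactOp B E) →L[ℂ] CompactOp B E}
    (hY : IsKet μ T Y) (η : E) : siNorm μ B (T.op η) ≤ siNorm μ (CompactOp B E) T * ‖η‖ := by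
  have h1 : ‖ket μ B (T.op η)‖ ≤ ‖Y‖ * ‖η‖ :=
    opNorm_le_of_toL2 μ (by positivity) fun f => by
      rw [(hY.op_apply η).2]; exact hY.norm_ketLin_op_le η f
  rw [hY.siNorm_eq, siNorm, add_mul]
  exact add_le_add (T.op.le_opNorm η) h1

end Kets

end SquareIntegrable

/-! ### Relative continuity passes between E and K(E) -/

namespace SquareIntegrable

section IntegralMem

variable {G : Type*} [TopologicalSpace G] [T2Space G] [MeasurableSpace G] [BorelSpace G]
  (μ : Measure G) [IsFiniteMeasureOnCompacts μ] {V : Type*} [NormedAddCommGroup V]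
  [NormedSpace ℂ V] [CompleteSpace V]

theorem integral_cc_mem {S : Submodule ℂ V} (hS : IsClosed (S : Set V)) (f : C_c(G, V))
    (h : ∀ g, f g ∈ S) : ∫ g, f g ∂μ ∈ S := by
  have _ : CompleteSpace S := hS.completeSpace_coe
  let k : C_c(G, S) :=
    { toFun := fun g => ⟨f g, h g⟩
      continuous_toFun := f.continuous.subtype_mk _
      hasCompactSupport' := HasCompactSupport.intro f.hasCompactSupport.isCompact fun g hg =>
        Subtype.ext (image_eq_zero_of_notMem_tsupport (f := f) hg) }
  have := S.subtypeL.integral_comp_comm (integrable_cc μ k)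
  change ∫ g, f g ∂μ = _ at this
  rw [this]
  exact (∫ g, k g ∂μ).2

end IntegralMem

section Relative

variable {G : Type*} [Group G] [TopologicalSpace G] [IsTopologicalGroup G]
  [LocallyCompactSpace G] [T2Space G] [MeasurableSpace G] [BorelSpace G]
  {μ : Measure G} [μ.IsHaarMeasure]
  {B : Type*} [NonUnitalCStarAlgebra B] [CStarAction G B]
  {E : Type*} [NormedAddCommGroup E] [NormedSpace ℂ E] [CompleteSpace E] [SMul Bᵐᵒᵖ E]
  [HilbertModule B E] [HilbertAction G B E]

variable (B) in
/-- The kernel `x ↦ |η K(x)⟩⟨γ_x η'|`. -/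
noncomputable def kernelToOp (η η' : E) (K : C_c(G, B)) : C_c(G, CompactOp B E) where
  toFun x := ketbra B (η <• K x) (gact B x η')
  continuous_toFun := continuous_ketbra.comp
    ((continuous_act continuous_const K.continuous).prodMk (continuous_gact B η'))
  hasCompactSupport' := HasCompactSupport.intro K.hasCompactSupport.isCompact fun x hx => by
    rw [image_eq_zero_of_notMem_tsupport hx, act_zero, ← ketbraL_apply, map_zero]

theorem kernelToOp_apply (η η' : E) (K : C_c(G, B)) (x : G) :
    kernelToOp B η η' K x = ketbra B (η <• K x) (gact B x η') := rfl

theorem op_rhoFun_kernelToOp (η η' ζ' : E) (K : C_c(G, B)) (f : C_c(G, CompactOp B E)) (g : G) :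
    (rhoFun μ (B := CompactOp B E) (kernelToOp B η η' K) f g).op ζ'
      = gact B g η <• rhoFun μ K (opToFun B η' ζ' f) g := by
  rw [rhoFun_apply, rhoFun_apply, op_integral (integrable_rho μ _ f g), ← actL_apply,
    ← (actL B E (gact B g η)).integral_comp_comm (integrable_rho μ K (opToFun B η' ζ' f) g)]
  refine integral_congr_ae (Eventually.of_forall fun h => ?_)
  have h1 : CStarAction.act g (kernelToOp B η η' K (g⁻¹ * h))
      = ketbra B (gact B g η <• CStarAction.act g (K (g⁻¹ * h))) (gact B h η') := by
    have h2 : gact B g (gact B (g⁻¹ * h) η') = gact B h η' := by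
      have := DFunLike.congr_fun (gact_mul B (E := E) g (g⁻¹ * h)) η'
      rw [mul_inv_cancel_left] at this
      exact this.symm
    rw [kernelToOp_apply, cact_ketbra, gact_smul, h2]
  simp only [CompactOp.op_mul, h1, actL_apply, opToFun_apply, ← act_act]
  rfl

theorem inner_op_ccInner (ζ ζ' : E) (f k : C_c(G, CompactOp B E)) :
    inner B ζ ((ccInner μ f k).op ζ') = ∫ g, inner B ((f g).op ζ) ((k g).op ζ') ∂μ := by
  have hi : Integrable (fun g => star (f g) * k g) μ :=
    integrable_cc μ (starMul f.toContinuousMap k)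
  have h1 := ((innerL B E ζ).comp ((evalOp B ζ').restrictScalars ℝ)).integral_comp_comm hi
  refine h1.symm.trans (integral_congr_ae (Eventually.of_forall fun g => ?_))
  exact (inner_op_left (f g) ζ ((k g).op ζ')).symm

/-- `kernelToOp` is chosen so that its ρ-operator has the coefficients of ρ_K, conjugated by the
transfer maps; `inner_op_inner_adj` shows the same for the bra-kets. -/
theorem inner_op_inner_rho (η η' ζ ζ' : E) (K : C_c(G, B)) (f f' : C_c(G, CompactOp B E)) :
    inner B ζ ((inner (CompactOp B E) (toL2 μ f)
        (rho μ (B := CompactOp B E) (kernelToOp B η η' K) (toL2 μ f'))).op ζ')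
      = inner B (opToFunL2 μ B η ζ (toL2 μ f)) (rho μ K (opToFunL2 μ B η' ζ' (toL2 μ f'))) := by
  rw [rho_toL2, inner_toL2, opToFunL2_toL2, opToFunL2_toL2, rho_toL2, inner_toL2,
    inner_op_ccInner]
  refine integral_congr_ae (Eventually.of_forall fun g => ?_)
  simp only [op_rhoFun_kernelToOp, HilbertModule.inner_act_right, opToFun_apply,
    HilbertModule.star_inner]

theorem inner_op_inner_adj {ξ ξ' : E} {X X' : L2 μ B →L[ℂ] E} (hX : IsKet μ ξ X)
    (hX' : IsKet μ ξ' X') {η η' : E} {Y Y' : L2 μ (CompactOp B E) →L[ℂ] CompactOp B E}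
    (hY : IsKet μ (ketbra B ξ η) Y) (hY' : IsKet μ (ketbra B ξ' η') Y') (ζ ζ' : E)
    (f f' : C_c(G, CompactOp B E)) :
    inner B ζ ((inner (CompactOp B E) (toL2 μ f)
        ((adj (CompactOp B E) Y ∘L Y') (toL2 μ f'))).op ζ')
      = inner B (opToFunL2 μ B η ζ (toL2 μ f))
        ((adj B X ∘L X') (opToFunL2 μ B η' ζ' (toL2 μ f'))) := by
  rw [ContinuousLinearMap.comp_apply, ContinuousLinearMap.comp_apply, ← hY.adj, ← hX.adj,
    ← hX.op_ketbra_apply, ← hX'.op_ketbra_apply, ← hY.2, ← hY'.2, inner_op_left]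
  rfl

/-- D' and the operators of transported kernels arise from D and ρ_K through the same bounded maps,
so the error is multiplied by at most ‖η‖‖η'‖. Approximations of D by ρ_K therefore transport to D'.
-/
theorem IsKet.crossed_ketbra {ξ ξ' : E} {X X' : L2 μ B →L[ℂ] E} (hX : IsKet μ ξ X)
    (hX' : IsKet μ ξ' X') {η η' : E} {Y Y' : L2 μ (CompactOp B E) →L[ℂ] CompactOp B E}
    (hY : IsKet μ (SquareIntegrable.ketbra B ξ η) Y)
    (hY' : IsKet μ (SquareIntegrable.ketbra B ξ' η') Y')
    (h : SquareIntegrable.adj B X ∘L X' ∈ crossedSubmodule μ B) :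
    SquareIntegrable.adj (CompactOp B E) Y ∘L Y' ∈ crossedSubmodule μ (CompactOp B E) := by
  set D := SquareIntegrable.adj B X ∘L X' with hD
  set D' := SquareIntegrable.adj (CompactOp B E) Y ∘L Y' with hD'
  have key : ∀ K : C_c(G, B), ‖D' - rho μ (B := CompactOp B E) (kernelToOp B η η' K)‖ ≤ ‖D - rho μ K‖ * (‖η‖ * ‖η'‖) := by
    intro K
    refine opNorm_le_of_inner_toL2 μ (by positivity) fun f f' => ?_
    refine norm_le_of_inner_op (by positivity) fun ζ ζ' => ?_
    have h1 : inner B ζ ((inner (CompactOp B E) (toL2 μ f)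
        ((D' - rho μ (B := CompactOp B E) (kernelToOp B η η' K)) (toL2 μ f'))).op ζ')
      = inner B (opToFunL2 μ B η ζ (toL2 μ f))
        ((D - rho μ K) (opToFunL2 μ B η' ζ' (toL2 μ f'))) := by
      rw [sub_apply, sub_apply, inner_sub_right, inner_sub_right, CompactOp.op_sub, sub_apply,
        inner_sub_right, inner_op_inner_rho, hD', inner_op_inner_adj hX hX' hY hY', ← hD]
    rw [h1]
    refine (norm_inner_le _ _).trans ?_
    have h2 := norm_opToFunL2_le (μ := μ) (B := B) η ζ (toL2 μ f)
    have h3 := (D - rho μ K).le_opNorm_of_le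
      (norm_opToFunL2_le (μ := μ) (B := B) η' ζ' (toL2 μ f'))
    calc _ ≤ (‖η‖ * ‖ζ‖ * ‖toL2 μ f‖) * (‖D - rho μ K‖ * (‖η'‖ * ‖ζ'‖ * ‖toL2 μ f'‖)) :=
          mul_le_mul h2 h3 (norm_nonneg _) (by positivity)
      _ = _ := by ring
  refine Metric.mem_closure_iff.2 fun ε hε => ?_
  obtain ⟨_, ⟨K, rfl⟩, hK⟩ := Metric.mem_closure_iff.1 h (ε / (‖η‖ * ‖η'‖ + 1)) (by positivity)
  rw [dist_eq_norm] at hK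
  change ‖D - rho μ K‖ < _ at hK
  refine ⟨_, ⟨kernelToOp B η η' K, rfl⟩, ?_⟩
  rw [dist_eq_norm]
  calc _ ≤ ‖D - rho μ K‖ * (‖η‖ * ‖η'‖) := key K
    _ ≤ ‖D - rho μ K‖ * (‖η‖ * ‖η'‖ + 1) := by gcongr; linarith
    _ < ε / (‖η‖ * ‖η'‖ + 1) * (‖η‖ * ‖η'‖ + 1) := by gcongr
    _ = ε := by field_simp

variable (B) in
/-- The kernel `x ↦ ⟨η, K(x) γ_x η'⟩`. -/
noncomputable def kernelToFun (η η' : E) (K : C_c(G, CompactOp B E)) : C_c(G, B) where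
  toFun x := inner B η ((K x).op (gact B x η'))
  continuous_toFun := continuous_inner continuous_const
    ((continuous_op.comp K.continuous).clm_apply (continuous_gact B η'))
  hasCompactSupport' := HasCompactSupport.intro K.hasCompactSupport.isCompact fun x hx => by
    rw [image_eq_zero_of_notMem_tsupport hx, CompactOp.op_zero, zero_apply, inner_zero_right]

theorem kernelToFun_apply (η η' : E) (K : C_c(G, CompactOp B E)) (x : G) :
    kernelToFun B η η' K x = inner B η ((K x).op (gact B x η')) := rfl

theorem act_kernelToFun (η η' : E) (K : C_c(G, CompactOp B E)) (g h : G) :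
    CStarAction.act g (kernelToFun B η η' K (g⁻¹ * h))
      = inner B (gact B g η) ((CStarAction.act g (K (g⁻¹ * h))).op (gact B h η')) := by
  have h2 : gact B g⁻¹ (gact B h η') = gact B (g⁻¹ * h) η' :=
    (DFunLike.congr_fun (gact_mul B (E := E) g⁻¹ h) η').symm
  rw [kernelToFun_apply, ← inner_gact, op_cact, h2]

theorem star_funToOp_mul_rhoFun (η η' β β' : E) (K : C_c(G, CompactOp B E)) (f f' : C_c(G, B))
    (g : G) : star (funToOp B η β f g) * rhoFun μ K (funToOp B η' β' f') g
      = ketbra B (β <• (star (f g) * rhoFun μ (kernelToFun B η η' K) f' g)) β' := by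
  have hi := integrable_rho μ (kernelToFun B η η' K) f' g
  have hi' : Integrable (fun h => star (f g) *
      (CStarAction.act g (kernelToFun B η η' K (g⁻¹ * h)) * f' h)) μ := (ContinuousLinearMap.mul ℝ B (star (f g))).integrable_comp hi
  rw [rhoFun_apply, rhoFun_apply, ← integral_mul_left_of_integrable (integrable_rho μ K _ g),
    ← integral_mul_left_of_integrable hi, ← integral_ketbra_act hi']
  refine integral_congr_ae (Eventually.of_forall fun h => ?_)
  simp only [funToOp_apply, star_ketbra, mul_ketbra, op_act, ketbra_apply, inner_act_left,
    act_kernelToFun, act_act, mul_assoc]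

theorem inner_inner_rho_ketbra (η η' β β' : E) (K : C_c(G, CompactOp B E)) (f f' : C_c(G, B)) :
    inner (CompactOp B E) (funToOpL2 μ η β (toL2 μ f))
        (rho μ K (funToOpL2 μ η' β' (toL2 μ f')))
      = ketbra B (β <• inner B (toL2 μ f) (rho μ (kernelToFun B η η' K) (toL2 μ f'))) β' := by
  rw [funToOpL2_toL2, funToOpL2_toL2, rho_toL2, rho_toL2, inner_toL2, inner_toL2]
  have hi : Integrable (fun g => star (f g) * rhoFun μ (kernelToFun B η η' K) f' g) μ :=
    integrable_cc μ (starMul f.toContinuousMap (rhoFun μ (kernelToFun B η η' K) f'))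
  unfold ccInner
  rw [← integral_ketbra_act hi]
  exact integral_congr_ae (Eventually.of_forall fun g => star_funToOp_mul_rhoFun _ _ _ _ _ _ _ _)

theorem IsKet.inner_inner_adj_ketbra {T T' : CompactOp B E}
    {Y Y' : L2 μ (CompactOp B E) →L[ℂ] CompactOp B E} (hY : IsKet μ T Y) (hY' : IsKet μ T' Y')
    {η η' : E} {X X' : L2 μ B →L[ℂ] E} (hX : IsKet μ (T.op η) X) (hX' : IsKet μ (T'.op η') X')
    (β β' : E) (f f' : C_c(G, B)) :
    inner (CompactOp B E) (funToOpL2 μ η β (toL2 μ f))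
        ((SquareIntegrable.adj (CompactOp B E) Y ∘L Y') (funToOpL2 μ η' β' (toL2 μ f')))
      = SquareIntegrable.ketbra B (β <• inner B (toL2 μ f)
        ((SquareIntegrable.adj B X ∘L X') (toL2 μ f'))) β' := by
  rw [ContinuousLinearMap.comp_apply, ContinuousLinearMap.comp_apply, ← hY.adj, ← hX.adj,
    hY.apply_funToOp, hY'.apply_funToOp, hX.2, hX'.2, inner_compact, star_ketbra,
    ketbra_mul_ketbra]

theorem kernelToFun_mem (η η' : E) (K : C_c(G, CompactOp B E)) (x : G) :
    kernelToFun B η η' K x ∈ innerIdeal B E := inner_mem_innerIdeal _ _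

/-- Needed because `norm_le_of_norm_act_le` recovers the norm of a coefficient from its action on
`E` only inside the ideal. -/
theorem inner_rho_mem_innerIdeal {K : C_c(G, B)} (hK : ∀ x, K x ∈ innerIdeal B E)
    (f f' : C_c(G, B)) : inner B (toL2 μ f) (rho μ K (toL2 μ f')) ∈ innerIdeal B E := by
  have hcl : IsClosed ((innerIdeal B E).toNonUnitalSubalgebra.toSubmodule : Set B) :=
    isClosed_innerIdeal B E
  have h1 : ∀ g, rhoFun μ K f' g ∈ innerIdeal B E := fun g => by
    let k : C_c(G, B) :=
      { toFun := fun h => CStarAction.act g (K (g⁻¹ * h)) * f' h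
        continuous_toFun := (continuous_cstarAct continuous_const
          (K.continuous.comp (by fun_prop))).mul f'.continuous
        hasCompactSupport' := f'.hasCompactSupport.mul_left }
    exact integral_cc_mem μ hcl k fun h => innerIdeal_mul_mem (cact_mem_innerIdeal g (hK _)) _
  rw [rho_toL2, inner_toL2]
  exact integral_cc_mem μ hcl (starMul f.toContinuousMap (rhoFun μ K f'))
    fun g => mul_innerIdeal_mem (h1 g) _

/-- In this direction a coefficient a in `B` is only visible through |βa⟩⟨β'| in K(E). Its norm is
recovered from all ‖βa‖, since a lies in the ideal of inner products. -/
theorem IsKet.crossed_op {T T' : CompactOp B E}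
    {Y Y' : L2 μ (CompactOp B E) →L[ℂ] CompactOp B E} (hY : IsKet μ T Y) (hY' : IsKet μ T' Y')
    {η η' : E} {X X' : L2 μ B →L[ℂ] E} (hX : IsKet μ (T.op η) X) (hX' : IsKet μ (T'.op η') X')
    (h : SquareIntegrable.adj (CompactOp B E) Y ∘L Y' ∈ crossedSubmodule μ (CompactOp B E)) :
    SquareIntegrable.adj B X ∘L X' ∈ crossedSubmodule μ B := by
  set D := SquareIntegrable.adj (CompactOp B E) Y ∘L Y' with hD
  set D' := SquareIntegrable.adj B X ∘L X' with hD'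
  have key : ∀ K : C_c(G, CompactOp B E),
      ‖D' - rho μ (kernelToFun B η η' K)‖ ≤ ‖D - rho μ K‖ * (‖η‖ * ‖η'‖) := by
    intro K
    refine opNorm_le_of_inner_toL2 μ (by positivity) fun f f' => ?_
    refine norm_le_of_norm_act_le (E := E) ?_ (by positivity) fun β => ?_
    · rw [sub_apply, inner_sub_right]
      refine sub_mem ?_ (inner_rho_mem_innerIdeal (kernelToFun_mem η η' K) f f')
      rw [hD', ContinuousLinearMap.comp_apply, ← hX.adj]
      exact inner_mem_innerIdeal _ _
    set a := inner B (toL2 μ f) ((D' - rho μ (kernelToFun B η η' K)) (toL2 μ f')) with ha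
    have h1 : ∀ β', inner (CompactOp B E) (funToOpL2 μ η β (toL2 μ f))
        ((D - rho μ K) (funToOpL2 μ η' β' (toL2 μ f')))
        = SquareIntegrable.ketbra B (β <• a) β' := by
      intro β'
      rw [sub_apply, inner_sub_right, inner_inner_rho_ketbra, hD,
        hY.inner_inner_adj_ketbra hY' hX hX', ← ketbra_sub, ← act_sub, ← inner_sub_right, ← hD',
        ← sub_apply]
    rcases (norm_nonneg (β <• a)).eq_or_lt with h0 | h0
    · rw [← h0]; positivity
    -- The choice β' = βa turns the coefficient into |βa⟩⟨βa|, whose norm is ‖βa‖².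
    have h2 : ‖β <• a‖ ^ 2 ≤ (‖η‖ * ‖β‖ * ‖toL2 μ f‖)
        * (‖D - rho μ K‖ * (‖η'‖ * ‖β <• a‖ * ‖toL2 μ f'‖)) := by
      rw [← norm_ketbra_self (B := B), ← h1]
      refine (norm_inner_le _ _).trans ?_
      exact mul_le_mul (norm_funToOpL2_le η β _)
        ((D - rho μ K).le_opNorm_of_le (norm_funToOpL2_le η' _ _)) (norm_nonneg _)
        (by positivity)
    have h3 : ‖β <• a‖ * ‖β <• a‖
        ≤ ‖β <• a‖ * (‖D - rho μ K‖ * (‖η‖ * ‖η'‖) * ‖toL2 μ f‖ * ‖toL2 μ f'‖ * ‖β‖) := by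
      rw [← pow_two]; exact h2.trans (le_of_eq (by ring))
    exact le_of_mul_le_mul_left h3 h0
  refine Metric.mem_closure_iff.2 fun ε hε => ?_
  obtain ⟨_, ⟨K, rfl⟩, hK⟩ := Metric.mem_closure_iff.1 h (ε / (‖η‖ * ‖η'‖ + 1)) (by positivity)
  rw [dist_eq_norm] at hK
  change ‖D - rho μ K‖ < _ at hK
  refine ⟨_, ⟨kernelToFun B η η' K, rfl⟩, ?_⟩
  rw [dist_eq_norm]
  calc _ ≤ ‖D - rho μ K‖ * (‖η‖ * ‖η'‖) := key K
    _ ≤ ‖D - rho μ K‖ * (‖η‖ * ‖η'‖ + 1) := by gcongr; linarith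
    _ < ε / (‖η‖ * ‖η'‖ + 1) * (‖η‖ * ‖η'‖ + 1) := by gcongr
    _ = ε := by field_simp

end Relative

end SquareIntegrable

/-! ### The maps i and j and their compositions -/

namespace SquareIntegrable

section Correspondence

variable {G : Type*} [Group G] [TopologicalSpace G] [IsTopologicalGroup G]
  [LocallyCompactSpace G] [T2Space G] [MeasurableSpace G] [BorelSpace G]
  {μ : Measure G} [μ.IsHaarMeasure]
  {B : Type*} [NonUnitalCStarAlgebra B] [CStarAction G B]
  {E : Type*} [NormedAddCommGroup E] [NormedSpace ℂ E] [CompleteSpace E] [SMul Bᵐᵒᵖ E]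
  [HilbertModule B E] [HilbertAction G B E]

theorem completion_span (S : Set E) :
    completion μ B (Submodule.span ℂ S : Set E) = completion μ B S := by
  unfold completion
  congr 1
  ext T
  simp only [Set.mem_ofPred_eq, SetLike.coe_subset_coe, Submodule.span_le]

theorem toCompacts_eq (R : Submodule ℂ E) : toCompacts μ B R
    = completion μ (CompactOp B E) {T | ∃ ξ ∈ R, ∃ η, T = ketbra B ξ η} := by
  have h : {T : CompactOp B E | ∃ ξ ∈ R, ∃ η : E, T.op = rankOne B ξ η}
      = {T | ∃ ξ ∈ R, ∃ η, T = ketbra B ξ η} := by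
    ext T
    exact ⟨fun ⟨ξ, hξ, η, h⟩ => ⟨ξ, hξ, η, CompactOp.ext h⟩,
      fun ⟨ξ, hξ, η, h⟩ => ⟨ξ, hξ, η, by rw [h]; rfl⟩⟩
  rw [toCompacts, h, completion_span]

theorem ofCompacts_eq (R : Submodule ℂ (CompactOp B E)) : ofCompacts μ B R
    = completion μ B {x : E | ∃ T ∈ R, ∃ η : E, x = T.op η} := by
  rw [ofCompacts, completion_span]

theorem ketbra_mem_toCompacts {R : Submodule ℂ E} {ξ : E} (hξ : ξ ∈ R) (η : E) :
    ketbra B ξ η ∈ toCompacts μ B R := by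
  rw [toCompacts_eq]
  exact subset_completion _ ⟨ξ, hξ, η, rfl⟩

theorem op_mem_ofCompacts {R : Submodule ℂ (CompactOp B E)} {T : CompactOp B E} (hT : T ∈ R)
    (η : E) : T.op η ∈ ofCompacts μ B R := by
  rw [ofCompacts_eq]
  exact subset_completion _ ⟨T, hT, η, rfl⟩

/-- Relative continuity is checked on the generators |ξ⟩⟨η| and survives completion. For density,
each |ξ⟩⟨η| is a limit of |x⟩⟨η| with x in R. -/
theorem toCompacts_mem_contSubspaces {R : Submodule ℂ E} (hR : R ∈ contSubspaces μ B E) :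
    toCompacts μ B R ∈ contSubspaces μ (CompactOp B E) (CompactOp B E) := by
  obtain ⟨hd, hc, hr⟩ := hR
  have hr' := (isRelativelyContinuous_iff hr.1).1 hr
  have hsub : {T | ∃ ξ ∈ R, ∃ η, T = ketbra B ξ η} ⊆ squareIntegrable μ (CompactOp B E) := by
    rintro _ ⟨ξ, hξ, η, rfl⟩
    exact ((isKet_ket (hr.1 hξ)).ketbra η).mem
  have hrel : IsRelativelyContinuous μ (CompactOp B E)
      {T | ∃ ξ ∈ R, ∃ η, T = ketbra B ξ η} := by
    refine (isRelativelyContinuous_iff hsub).2 ?_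
    rintro _ ⟨ξ, hξ, η, rfl⟩ _ ⟨ξ', hξ', η', rfl⟩ Y Y' hY hY'
    have hX := isKet_ket (hr.1 hξ)
    have hX' := isKet_ket (hr.1 hξ')
    exact hX.crossed_ketbra hX' hY hY' (hr' ξ hξ ξ' hξ' _ _ hX hX')
  refine ⟨?_, ?_, ?_⟩
  · refine (dense_span_ketbra.mono ?_).of_closure
    rw [← Submodule.topologicalClosure_coe, SetLike.coe_subset_coe, Submodule.span_le]
    rintro _ ⟨ξ, η, rfl⟩
    have h1 : ξ ∈ closure (R : Set E) := hd ξ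
    exact map_mem_closure (f := ketbraL B η) (ketbraL B η).continuous h1
      fun x hx => ketbra_mem_toCompacts hx η
  · rw [toCompacts_eq]
    exact isComplete_completion hsub
  · rw [toCompacts_eq]
    exact isRelativelyContinuous_completion hrel

theorem ofCompacts_mem_contSubspaces {R : Submodule ℂ (CompactOp B E)}
    (hR : R ∈ contSubspaces μ (CompactOp B E) (CompactOp B E)) :
    ofCompacts μ B R ∈ contSubspaces μ B E := by
  obtain ⟨hd, hc, hr⟩ := hR
  have hr' := (isRelativelyContinuous_iff hr.1).1 hr
  have hsub : {x : E | ∃ T ∈ R, ∃ η : E, x = T.op η} ⊆ squareIntegrable μ B := by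
    rintro _ ⟨T, hT, η, rfl⟩
    exact ((isKet_ket (hr.1 hT)).op_apply η).mem
  have hrel : IsRelativelyContinuous μ B {x : E | ∃ T ∈ R, ∃ η : E, x = T.op η} := by
    refine (isRelativelyContinuous_iff hsub).2 ?_
    rintro _ ⟨T, hT, η, rfl⟩ _ ⟨T', hT', η', rfl⟩ X X' hX hX'
    have hY := isKet_ket (hr.1 hT)
    have hY' := isKet_ket (hr.1 hT')
    exact hY.crossed_op hY' hX hX' (hr' T hT T' hT' _ _ hY hY')
  refine ⟨?_, ?_, ?_⟩
  · refine ((dense_span_op_apply (B := B)).mono ?_).of_closure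
    rw [← Submodule.topologicalClosure_coe, SetLike.coe_subset_coe, Submodule.span_le]
    rintro _ ⟨T, η, rfl⟩
    have h1 : T ∈ closure (R : Set (CompactOp B E)) := hd T
    exact map_mem_closure (f := evalOp B η) (evalOp B η).continuous h1
      fun x hx => op_mem_ofCompacts hx η
  · rw [ofCompacts_eq]
    exact isComplete_completion hsub
  · rw [ofCompacts_eq]
    exact isRelativelyContinuous_completion hrel

theorem convAct_convAct {ξ : E} (hξ : ξ ∈ squareIntegrable μ B) (K L : C_c(G, B)) :
    convAct μ B (convAct μ B ξ K) L = convAct μ B ξ (dagger (rhoFun μ K (dagger L))) := by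
  have hX := isKet_ket hξ
  rw [← (hX.convAct K).apply_dagger, ← hX.apply_dagger, ContinuousLinearMap.comp_apply, rho_toL2,
    dagger_dagger]

theorem siNorm_convAct_sub_le {ξ η : E} (hξ : ξ ∈ squareIntegrable μ B)
    (hη : η ∈ squareIntegrable μ B) (K : C_c(G, B)) :
    siNorm μ B (convAct μ B ξ K - convAct μ B η K)
      ≤ siNorm μ B (ξ - η) * (‖toL2 μ (dagger K)‖ + ‖rho μ K‖) := by
  have hX := isKet_ket hξ
  have hY := isKet_ket hη
  rw [((hX.convAct K).sub (hY.convAct K)).siNorm_eq, ← hX.apply_dagger, ← hY.apply_dagger,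
    ← sub_apply, ← ContinuousLinearMap.sub_comp]
  have h1 := norm_ket_sub_le hX hY
  calc _ ≤ ‖ket μ B ξ - ket μ B η‖ * ‖toL2 μ (dagger K)‖ + ‖ket μ B ξ - ket μ B η‖ * ‖rho μ K‖ :=
        add_le_add (ContinuousLinearMap.le_opNorm _ _) (ContinuousLinearMap.opNorm_comp_le _ _)
    _ ≤ _ := by rw [← mul_add]; gcongr

theorem siNorm_nonneg (ξ : E) : 0 ≤ siNorm μ B ξ := add_nonneg (norm_nonneg _) (norm_nonneg _)

/-- A linear image of a square-integrable limit lies in a complete subspace `R'` if the images of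
approximating elements do. -/
theorem mem_of_siNorm_bound {F : Type*} {C : Type*} [NonUnitalCStarAlgebra C] [CStarAction G C]
    [NormedAddCommGroup F] [NormedSpace ℂ F] [CompleteSpace F] [SMul Cᵐᵒᵖ F] [HilbertModule C F]
    [HilbertAction G C F] {R' : Submodule ℂ F} (hR' : IsCompleteSubspace μ C R') {P : Set E}
    {Λ : E → F} {M : ℝ} {ξ : E} (hξ : Λ ξ ∈ squareIntegrable μ C)
    (hP : ∀ η ∈ P, Λ η ∈ R' ∧ siNorm μ C (Λ ξ - Λ η) ≤ siNorm μ B (ξ - η) * M)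
    (h : ∀ ε > 0, ∃ η ∈ P, siNorm μ B (ξ - η) < ε) : Λ ξ ∈ R' := by
  refine hR'.closed_si _ hξ fun ε hε => ?_
  obtain ⟨η, hη, hlt⟩ := h (ε / (|M| + 1)) (by positivity)
  obtain ⟨h1, h2⟩ := hP η hη
  refine ⟨_, h1, h2.trans_lt ?_⟩
  calc _ ≤ siNorm μ B (ξ - η) * (|M| + 1) := by
        refine mul_le_mul_of_nonneg_left ?_ (siNorm_nonneg _)
        linarith [le_abs_self M]
    _ < ε / (|M| + 1) * (|M| + 1) := by gcongr
    _ = ε := by field_simp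

/-- A convolution in `E` turns into one in K(E) with an operator-valued kernel, so it stays within a
complete subspace of K(E). `op_convAct_ketbra` is the reverse passage. -/
theorem ketbra_convAct_op (T : CompactOp B E) (η₀ η : E) (K : C_c(G, B)) :
    ketbra B (convAct μ B (T.op η₀) K) η
      = convAct μ (CompactOp B E) T (kernelToOp B η₀ η K) := by
  rw [convAct_eq, ketLin_apply, ← ketbraL_apply,
    ← (ketbraL B η).integral_comp_comm (integrable_cc μ _)]
  refine integral_congr_ae (Eventually.of_forall fun g => ?_)
  have h2 : gact B g (gact B g⁻¹ η) = η := gact_gact_inv B g η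
  change ketbra B (gact B g (T.op η₀) <• CStarAction.act g (K g⁻¹)) η
    = CStarAction.act g (T * kernelToOp B η₀ η K g⁻¹)
  rw [kernelToOp_apply, mul_ketbra, cact_ketbra, h2, op_act, gact_smul]

theorem op_convAct_ketbra (ξ η' η : E) (L : C_c(G, CompactOp B E)) :
    (convAct μ (CompactOp B E) (ketbra B ξ η') L).op η
      = convAct μ B ξ (kernelToFun B η' η L) := by
  rw [convAct_eq, ketLin_apply, op_integral (integrable_cc μ _)]
  refine integral_congr_ae (Eventually.of_forall fun g => ?_)
  change (CStarAction.act g (ketbra B ξ η') * CStarAction.act g (L g⁻¹)).op η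
    = gact B g (ξ <• kernelToFun B η' η L g⁻¹)
  have h := act_kernelToFun η' η L g 1
  rw [mul_one, gact_one] at h
  rw [gact_smul, h, cact_ketbra]
  rfl

variable (μ B) in
/-- The subspace of all `ξ ∈ E_si` with `|ξ⟩⟨η| ∈ R` and `|ξ ∗ K⟩⟨η| ∈ R` for all `η` and `K`. -/
def ketbraSubmodule (R : Submodule ℂ (CompactOp B E)) : Submodule ℂ E where
  carrier := {ξ | ∃ X : L2 μ B →L[ℂ] E, IsKet μ ξ X ∧ ∀ η, ketbra B ξ η ∈ R ∧
    ∀ K, ketbra B (X (toL2 μ (dagger K))) η ∈ R}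
  add_mem' := by
    rintro ξ ξ' ⟨X, hX, h⟩ ⟨X', hX', h'⟩
    refine ⟨_, hX.add hX', fun η => ⟨?_, fun K => ?_⟩⟩
    · rw [← ketbraL_apply, map_add]
      exact R.add_mem (h η).1 (h' η).1
    · rw [← ketbraL_apply, add_apply, map_add]
      exact R.add_mem ((h η).2 K) ((h' η).2 K)
  zero_mem' := by
    refine ⟨0, isKet_zero, fun η => ⟨?_, fun K => ?_⟩⟩
    · rw [← ketbraL_apply, map_zero]; exact R.zero_mem
    · rw [← ketbraL_apply, zero_apply, map_zero]; exact R.zero_mem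
  smul_mem' := by
    rintro c ξ ⟨X, hX, h⟩
    refine ⟨_, hX.smul c, fun η => ⟨?_, fun K => ?_⟩⟩
    · rw [← ketbraL_apply, map_smul]
      exact R.smul_mem c (h η).1
    · rw [← ketbraL_apply, smul_apply, map_smul]
      exact R.smul_mem c ((h η).2 K)

theorem mem_ketbraSubmodule {R : Submodule ℂ (CompactOp B E)} {ξ : E} :
    ξ ∈ ketbraSubmodule μ B R ↔ ξ ∈ squareIntegrable μ B ∧ ∀ η, ketbra B ξ η ∈ R ∧
      ∀ K, ketbra B (convAct μ B ξ K) η ∈ R := by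
  constructor
  · rintro ⟨X, hX, h⟩
    refine ⟨hX.mem, fun η => ⟨(h η).1, fun K => ?_⟩⟩
    rw [← hX.apply_dagger]
    exact (h η).2 K
  · rintro ⟨hξ, h⟩
    refine ⟨_, isKet_ket hξ, fun η => ⟨(h η).1, fun K => ?_⟩⟩
    rw [(isKet_ket hξ).apply_dagger]
    exact (h η).2 K

/-- The two conditions are continuous for ‖·‖_si. Building all ξ∗K into the definition makes
stability under convolution automatic, as (ξ∗K)∗L is again some ξ∗K'. -/
theorem isComplete_ketbraSubmodule {R : Submodule ℂ (CompactOp B E)}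
    (hR : IsCompleteSubspace μ (CompactOp B E) R) :
    IsCompleteSubspace μ B (ketbraSubmodule μ B R) where
  subset_si := fun ξ hξ => (mem_ketbraSubmodule.1 hξ).1
  closed_si ξ hξ h := by
    have hX := isKet_ket hξ
    refine mem_ketbraSubmodule.2 ⟨hξ, fun η => ⟨?_, fun K => ?_⟩⟩
    · refine mem_of_siNorm_bound hR (M := ‖η‖) (Λ := fun ξ => ketbra B ξ η) (hX.ketbra η).mem
        (fun ζ hζ => ⟨((mem_ketbraSubmodule.1 hζ).2 η).1, ?_⟩) h
      rw [← ketbra_sub]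
      exact (hX.sub (isKet_ket (mem_ketbraSubmodule.1 hζ).1)).siNorm_ketbra_le η
    · refine mem_of_siNorm_bound hR (Λ := fun ξ => ketbra B (convAct μ B ξ K) η)
        (M := (‖toL2 μ (dagger K)‖ + ‖rho μ K‖) * ‖η‖) ((hX.convAct K).ketbra η).mem
        (fun ζ hζ => ⟨((mem_ketbraSubmodule.1 hζ).2 η).2 K, ?_⟩) h
      have hζ' := (mem_ketbraSubmodule.1 hζ).1
      rw [← ketbra_sub, ← mul_assoc]
      refine (((hX.convAct K).sub ((isKet_ket hζ').convAct K)).siNorm_ketbra_le η).trans ?_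
      gcongr
      exact siNorm_convAct_sub_le hξ hζ' K
  conv_mem ξ hξ K := by
    obtain ⟨h1, h2⟩ := mem_ketbraSubmodule.1 hξ
    refine mem_ketbraSubmodule.2 ⟨((isKet_ket h1).convAct K).mem,
      fun η => ⟨(h2 η).2 K, fun L => ?_⟩⟩
    rw [convAct_convAct h1]
    exact (h2 η).2 _

/-- For T in R, both |Tη₀⟩⟨η| = T|η₀⟩⟨η| and its convolved form T∗L stay in R, which gives one
inclusion. For the other, T is a ‖·‖_si-limit of TS with S of finite rank, and TS is a sum of
operators |Tξ⟩⟨η|. -/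
theorem toCompacts_ofCompacts {R : Submodule ℂ (CompactOp B E)}
    (hR : R ∈ contSubspaces μ (CompactOp B E) (CompactOp B E)) :
    toCompacts μ B (ofCompacts μ B R) = R := by
  have hR2 := toCompacts_mem_contSubspaces (ofCompacts_mem_contSubspaces hR)
  obtain ⟨hd, hc, hr⟩ := hR
  refine le_antisymm ?_ fun T hT => ?_
  · rw [toCompacts_eq]
    refine completion_le hc ?_
    rintro _ ⟨ξ, hξ, η, rfl⟩
    rw [ofCompacts_eq] at hξ
    refine ((mem_ketbraSubmodule.1 (completion_le (isComplete_ketbraSubmodule hc) ?_ hξ)).2 η).1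
    rintro _ ⟨T, hT, η₀, rfl⟩
    refine mem_ketbraSubmodule.2 ⟨((isKet_ket (hr.1 hT)).op_apply η₀).mem,
      fun η => ⟨?_, fun K => ?_⟩⟩
    · rw [← mul_ketbra]
      exact act_mem hc hr hT (ketbra B η₀ η)
    · rw [ketbra_convAct_op]
      exact hc.conv_mem T hT _
  · refine hR2.2.1.closed_si T (hr.1 hT) fun ε hε => ?_
    have hX := isKet_ket (hr.1 hT)
    obtain ⟨S, hS, hlt⟩ := hX.exists_siNorm_sub_act_lt
      ((isRelativelyContinuous_iff hr.1).1 hr T hT T hT _ _ hX hX) dense_span_ketbra hε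
    refine ⟨_, ?_, hlt⟩
    clear hlt
    change S ∈ Submodule.span ℂ _ at hS
    induction hS using Submodule.span_induction with
    | zero => rw [act_zero]; exact Submodule.zero_mem _
    | add x y _ _ hx hy => rw [act_add]; exact Submodule.add_mem _ hx hy
    | smul c x _ hx => rw [act_smul]; exact Submodule.smul_mem _ c hx
    | mem x hx =>
      obtain ⟨ξ, η, rfl⟩ := hx
      rw [act_compact, mul_ketbra]
      exact ketbra_mem_toCompacts (op_mem_ofCompacts hT ξ) η

variable (μ B) in
/-- The subspace of all `T ∈ K(E)_si` with `T η ∈ R` and `(T ∗ L) η ∈ R` for all `η` and `L`. -/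
def opSubmodule (R : Submodule ℂ E) : Submodule ℂ (CompactOp B E) where
  carrier := {T | ∃ Y : L2 μ (CompactOp B E) →L[ℂ] CompactOp B E, IsKet μ T Y ∧ ∀ η, T.op η ∈ R ∧
    ∀ L, (Y (toL2 μ (dagger L))).op η ∈ R}
  add_mem' := by
    rintro T T' ⟨Y, hY, h⟩ ⟨Y', hY', h'⟩
    exact ⟨_, hY.add hY', fun η => ⟨R.add_mem (h η).1 (h' η).1,
      fun L => R.add_mem ((h η).2 L) ((h' η).2 L)⟩⟩
  zero_mem' := ⟨0, isKet_zero, fun η => ⟨R.zero_mem, fun L => R.zero_mem⟩⟩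
  smul_mem' := by
    rintro c T ⟨Y, hY, h⟩
    exact ⟨_, hY.smul c, fun η => ⟨R.smul_mem c (h η).1, fun L => R.smul_mem c ((h η).2 L)⟩⟩

theorem mem_opSubmodule {R : Submodule ℂ E} {T : CompactOp B E} :
    T ∈ opSubmodule μ B R ↔ T ∈ squareIntegrable μ (CompactOp B E) ∧ ∀ η, T.op η ∈ R ∧
      ∀ L, (convAct μ (CompactOp B E) T L).op η ∈ R := by
  constructor
  · rintro ⟨Y, hY, h⟩
    refine ⟨hY.mem, fun η => ⟨(h η).1, fun L => ?_⟩⟩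
    rw [← hY.apply_dagger]
    exact (h η).2 L
  · rintro ⟨hT, h⟩
    refine ⟨_, isKet_ket hT, fun η => ⟨(h η).1, fun L => ?_⟩⟩
    rw [(isKet_ket hT).apply_dagger]
    exact (h η).2 L

theorem isComplete_opSubmodule {R : Submodule ℂ E} (hR : IsCompleteSubspace μ B R) :
    IsCompleteSubspace μ (CompactOp B E) (opSubmodule μ B R) where
  subset_si := fun T hT => (mem_opSubmodule.1 hT).1
  closed_si T hT h := by
    have hY := isKet_ket hT
    refine mem_opSubmodule.2 ⟨hT, fun η => ⟨?_, fun L => ?_⟩⟩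
    · refine mem_of_siNorm_bound hR (M := ‖η‖)
        (Λ := fun T : CompactOp B E => T.op η) (hY.op_apply η).mem
        (fun S hS => ⟨((mem_opSubmodule.1 hS).2 η).1, ?_⟩) h
      exact (hY.sub (isKet_ket (mem_opSubmodule.1 hS).1)).siNorm_op_le η
    · refine mem_of_siNorm_bound hR
        (Λ := fun T : CompactOp B E => (convAct μ (CompactOp B E) T L).op η)
        (M := (‖toL2 μ (dagger L)‖ + ‖rho μ L‖) * ‖η‖) ((hY.convAct L).op_apply η).mem
        (fun S hS => ⟨((mem_opSubmodule.1 hS).2 η).2 L, ?_⟩) h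
      have hS' := (mem_opSubmodule.1 hS).1
      rw [← mul_assoc]
      refine (((hY.convAct L).sub ((isKet_ket hS').convAct L)).siNorm_op_le η).trans ?_
      gcongr
      exact siNorm_convAct_sub_le hT hS' L
  conv_mem T hT L := by
    obtain ⟨h1, h2⟩ := mem_opSubmodule.1 hT
    refine mem_opSubmodule.2 ⟨((isKet_ket h1).convAct L).mem,
      fun η => ⟨(h2 η).2 L, fun L' => ?_⟩⟩
    rw [convAct_convAct h1]
    exact (h2 η).2 _

/-- Since |ξ⟩⟨η'|η = ξ⟨η',η⟩, and a convolution of |ξ⟩⟨η'| applied to η is a convolution of ξ with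
an ideal-valued kernel, j∘i(R) uses only coefficients in the ideal of inner products. A target R'
different from R is what the counterexample needs. -/
theorem ofCompacts_toCompacts_le_of {R R' : Submodule ℂ E}
    (hsi : (R : Set E) ⊆ squareIntegrable μ B) (hR' : IsCompleteSubspace μ B R')
    (h1 : ∀ ξ ∈ R, ∀ b ∈ innerIdeal B E, ξ <• b ∈ R')
    (h2 : ∀ ξ ∈ R, ∀ K : C_c(G, B), (∀ x, K x ∈ innerIdeal B E) → convAct μ B ξ K ∈ R') :
    ofCompacts μ B (toCompacts μ B R) ≤ R' := by
  rw [ofCompacts_eq]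
  refine completion_le hR' ?_
  rintro _ ⟨T, hT, η, rfl⟩
  rw [toCompacts_eq] at hT
  refine ((mem_opSubmodule.1 (completion_le (isComplete_opSubmodule hR') ?_ hT)).2 η).1
  rintro _ ⟨ξ, hξ, η', rfl⟩
  refine mem_opSubmodule.2 ⟨((isKet_ket (hsi hξ)).ketbra η').mem, fun η => ⟨?_, fun L => ?_⟩⟩
  · exact h1 ξ hξ _ (inner_mem_innerIdeal η' η)
  · rw [op_convAct_ketbra]
    exact h2 ξ hξ _ (kernelToFun_mem η' η L)

theorem ofCompacts_toCompacts_le {R : Submodule ℂ E} (hR : R ∈ contSubspaces μ B E) :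
    ofCompacts μ B (toCompacts μ B R) ≤ R :=
  ofCompacts_toCompacts_le_of hR.2.2.1 hR.2.1 (fun _ hξ b _ => act_mem hR.2.1 hR.2.2 hξ b)
    fun ξ hξ K _ => hR.2.1.conv_mem ξ hξ K

/-- For b an inner product, ξ⟨η,ζ⟩ = |ξ⟩⟨η|ζ is a generator. The closure follows from ‖ξ(b − a)‖_si
≤ ‖ξ‖_si ‖b − a‖. -/
theorem act_mem_ofCompacts_toCompacts {R : Submodule ℂ E} (hR : R ∈ contSubspaces μ B E) {ξ : E}
    (hξ : ξ ∈ R) {b : B} (hb : b ∈ innerIdeal B E) :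
    ξ <• b ∈ ofCompacts μ B (toCompacts μ B R) := by
  have hc := (ofCompacts_mem_contSubspaces (toCompacts_mem_contSubspaces hR)).2.1
  have hX := isKet_ket (hR.2.2.1 hξ)
  have hspan : ∀ a ∈ Submodule.span ℂ {b : B | ∃ x y : E, b = inner B x y},
      ξ <• a ∈ ofCompacts μ B (toCompacts μ B R) := by
    intro a ha
    induction ha using Submodule.span_induction with
    | zero => rw [act_zero]; exact Submodule.zero_mem _
    | add x y _ _ hx hy => rw [act_add]; exact Submodule.add_mem _ hx hy
    | smul c x _ hx => rw [act_smul]; exact Submodule.smul_mem _ c hx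
    | mem x hx =>
      obtain ⟨η, ζ, rfl⟩ := hx
      exact op_mem_ofCompacts (ketbra_mem_toCompacts hξ η) ζ
  refine hc.closed_si _ (hX.act b).mem fun ε hε => ?_
  obtain ⟨a, ha, hab⟩ := Metric.mem_closure_iff.1 (mem_innerIdeal.1 hb)
    (ε / (siNorm μ B ξ + 1)) (div_pos hε (by linarith [siNorm_nonneg (μ := μ) (B := B) ξ]))
  rw [dist_eq_norm] at hab
  refine ⟨_, hspan a ha, ?_⟩
  have hpos : 0 < siNorm μ B ξ + 1 := by linarith [siNorm_nonneg (μ := μ) (B := B) ξ]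
  rw [((hX.act b).sub (hX.act a)).siNorm_eq, ← act_sub, ← ContinuousLinearMap.comp_sub,
    ← mulL2_sub]
  have h1 : ‖ket μ B ξ ∘L mulL2 μ (b - a)‖ ≤ ‖ket μ B ξ‖ * ‖b - a‖ :=
    (ContinuousLinearMap.opNorm_comp_le _ _).trans (by gcongr; exact norm_mulL2_le _)
  calc _ ≤ ‖ξ‖ * ‖b - a‖ + ‖ket μ B ξ‖ * ‖b - a‖ := add_le_add (norm_act_le _ _) h1
    _ ≤ (siNorm μ B ξ + 1) * ‖b - a‖ := by
      rw [← add_mul]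
      refine mul_le_mul_of_nonneg_right ?_ (norm_nonneg _)
      rw [siNorm]; linarith
    _ < (siNorm μ B ξ + 1) * (ε / (siNorm μ B ξ + 1)) := by gcongr
    _ = ε := by field_simp

end Correspondence

end SquareIntegrable

/-! ### Quotients of C*-algebras by closed ideals -/

namespace SquareIntegrable

/-- A closed two-sided ideal of a C⋆-algebra. -/
structure ClosedIdeal (B : Type*) [NonUnitalCStarAlgebra B] extends
    NonUnitalStarSubalgebra ℂ B where
  isClosed : IsClosed (carrier : Set B)
  mul_mem_right : ∀ a ∈ carrier, ∀ b, a * b ∈ carrier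

namespace ClosedIdeal

variable {B : Type*} [NonUnitalCStarAlgebra B] (I : ClosedIdeal B)

/-- A closed ideal as a subspace. -/
def toSub : Submodule ℂ B := I.toSubmodule

theorem mul_right {a : B} (ha : a ∈ I.toSub) (b : B) : a * b ∈ I.toSub := I.mul_mem_right a ha b

theorem star_mem_toSub {a : B} (ha : a ∈ I.toSub) : star a ∈ I.toSub := I.star_mem' ha

theorem mul_left {a : B} (ha : a ∈ I.toSub) (b : B) : b * a ∈ I.toSub := by
  have := I.star_mem_toSub (I.mul_right (I.star_mem_toSub ha) (star b))
  rwa [star_mul, star_star, star_star] at this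

instance : IsClosed (I.toSub : Set B) := I.isClosed

/-- The quotient C⋆-algebra `B / I`. -/
def Quot : Type _ := B ⧸ I.toSub

noncomputable instance : NormedAddCommGroup I.Quot :=
  inferInstanceAs (NormedAddCommGroup (B ⧸ I.toSub))

noncomputable instance : NormedSpace ℂ I.Quot := inferInstanceAs (NormedSpace ℂ (B ⧸ I.toSub))

instance : CompleteSpace I.Quot := inferInstanceAs (CompleteSpace (B ⧸ I.toSub))

/-- The quotient map `B → B / I` as a linear map. -/
noncomputable def proj : B →ₗ[ℂ] I.Quot := I.toSub.mkQ

theorem proj_surjective : Function.Surjective I.proj := I.toSub.mkQ_surjective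

theorem proj_eq_zero {b : B} : I.proj b = 0 ↔ b ∈ I.toSub := Submodule.Quotient.mk_eq_zero _

theorem proj_eq {a b : B} : I.proj a = I.proj b ↔ a - b ∈ I.toSub := Submodule.Quotient.eq _

theorem norm_proj_le (b : B) : ‖I.proj b‖ ≤ ‖b‖ := Submodule.Quotient.norm_mk_le _ b

theorem exists_norm_lt (x : I.Quot) {ε : ℝ} (hε : 0 < ε) : ∃ b, I.proj b = x ∧ ‖b‖ < ‖x‖ + ε :=
  Submodule.Quotient.norm_mk_lt x hε

noncomputable instance : Mul I.Quot where
  mul x y := I.proj (Function.surjInv I.proj_surjective x * Function.surjInv I.proj_surjective y)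

noncomputable instance : Star I.Quot where
  star x := I.proj (star (Function.surjInv I.proj_surjective x))

theorem proj_mul (a b : B) : I.proj (a * b) = I.proj a * I.proj b := by
  refine I.proj_eq.2 ?_
  have ha := I.proj_eq.1 (Function.surjInv_eq I.proj_surjective (I.proj a)).symm
  have hb := I.proj_eq.1 (Function.surjInv_eq I.proj_surjective (I.proj b)).symm
  set a' := Function.surjInv I.proj_surjective (I.proj a)
  set b' := Function.surjInv I.proj_surjective (I.proj b)
  have h : a * b - a' * b' = (a - a') * b + a' * (b - b') := by rw [sub_mul, mul_sub]; abel
  rw [h]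
  exact add_mem (I.mul_right ha b) (I.mul_left hb a')

theorem proj_star (a : B) : I.proj (star a) = star (I.proj a) := by
  refine I.proj_eq.2 ?_
  have ha := I.proj_eq.1 (Function.surjInv_eq I.proj_surjective (I.proj a)).symm
  rw [← star_sub]
  exact I.star_mem_toSub ha

noncomputable instance : NonUnitalNormedRing I.Quot where
  left_distrib x y z := by
    obtain ⟨a, rfl⟩ := I.proj_surjective x
    obtain ⟨b, rfl⟩ := I.proj_surjective y
    obtain ⟨c, rfl⟩ := I.proj_surjective z
    rw [← map_add, ← proj_mul, ← proj_mul, ← proj_mul, ← map_add, mul_add]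
  right_distrib x y z := by
    obtain ⟨a, rfl⟩ := I.proj_surjective x
    obtain ⟨b, rfl⟩ := I.proj_surjective y
    obtain ⟨c, rfl⟩ := I.proj_surjective z
    rw [← map_add, ← proj_mul, ← proj_mul, ← proj_mul, ← map_add, add_mul]
  zero_mul x := by
    obtain ⟨a, rfl⟩ := I.proj_surjective x
    rw [← map_zero I.proj, ← proj_mul, zero_mul]
  mul_zero x := by
    obtain ⟨a, rfl⟩ := I.proj_surjective x
    rw [← map_zero I.proj, ← proj_mul, mul_zero]
  mul_assoc x y z := by
    obtain ⟨a, rfl⟩ := I.proj_surjective x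
    obtain ⟨b, rfl⟩ := I.proj_surjective y
    obtain ⟨c, rfl⟩ := I.proj_surjective z
    rw [← proj_mul, ← proj_mul, ← proj_mul, ← proj_mul, mul_assoc]
  dist_eq x y := (inferInstance : NormedAddCommGroup I.Quot).dist_eq x y
  norm_mul_le x y := by
    have hlim : Tendsto (fun ε : ℝ => (‖x‖ + ε) * (‖y‖ + ε)) (𝓝[>] 0) (𝓝 (‖x‖ * ‖y‖)) := by
      have : Continuous fun ε : ℝ => (‖x‖ + ε) * (‖y‖ + ε) := by fun_prop
      simpa using (this.tendsto 0).mono_left nhdsWithin_le_nhds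
    refine ge_of_tendsto hlim ?_
    filter_upwards [self_mem_nhdsWithin] with ε hε
    obtain ⟨a, rfl, ha⟩ := I.exists_norm_lt x hε
    obtain ⟨b, rfl, hb⟩ := I.exists_norm_lt y hε
    rw [← proj_mul]
    calc _ ≤ ‖a * b‖ := I.norm_proj_le _
      _ ≤ ‖a‖ * ‖b‖ := norm_mul_le _ _
      _ ≤ _ := mul_le_mul ha.le hb.le (norm_nonneg _) ((norm_nonneg _).trans ha.le)

noncomputable instance : StarRing I.Quot where
  star_involutive x := by
    obtain ⟨a, rfl⟩ := I.proj_surjective x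
    rw [← proj_star, ← proj_star, star_star]
  star_mul x y := by
    obtain ⟨a, rfl⟩ := I.proj_surjective x
    obtain ⟨b, rfl⟩ := I.proj_surjective y
    rw [← proj_mul, ← proj_star, ← proj_star, ← proj_star, ← proj_mul, star_mul]
  star_add x y := by
    obtain ⟨a, rfl⟩ := I.proj_surjective x
    obtain ⟨b, rfl⟩ := I.proj_surjective y
    rw [← map_add, ← proj_star, ← proj_star, ← proj_star, ← map_add, star_add]

instance : IsScalarTower ℂ I.Quot I.Quot where
  smul_assoc c x y := by
    obtain ⟨a, rfl⟩ := I.proj_surjective x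
    obtain ⟨b, rfl⟩ := I.proj_surjective y
    rw [smul_eq_mul, smul_eq_mul, ← map_smul, ← proj_mul, ← proj_mul, ← map_smul, smul_mul_assoc]

instance : SMulCommClass ℂ I.Quot I.Quot where
  smul_comm c x y := by
    obtain ⟨a, rfl⟩ := I.proj_surjective x
    obtain ⟨b, rfl⟩ := I.proj_surjective y
    rw [smul_eq_mul, smul_eq_mul, ← map_smul, ← proj_mul, ← proj_mul, ← map_smul, mul_smul_comm]

instance : StarModule ℂ I.Quot where
  star_smul c x := by
    obtain ⟨a, rfl⟩ := I.proj_surjective x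
    rw [← map_smul, ← proj_star, ← proj_star, star_smul, map_smul]

end ClosedIdeal

/-- For `‖e‖ ≤ 1`, compression by `1 - e⋆ e` does not increase the norm. -/
theorem norm_sub_star_mul_self_le {B : Type*} [NonUnitalCStarAlgebra B] (b : B) {e : B}
    (he : ‖e‖ ≤ 1) :
    ‖b - b * (star e * e)‖ ≤ ‖b‖ ∧ ‖b - star e * e * b‖ ≤ ‖b‖ := by
  let _ : PartialOrder (Unitization ℂ B) := CStarAlgebra.spectralOrder _
  have _ : StarOrderedRing (Unitization ℂ B) := CStarAlgebra.spectralOrderedRing _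
  -- In the unitization 1 − e*e is positive and at most 1, hence a contraction.
  set u : Unitization ℂ B := 1 - star (e : Unitization ℂ B) * e with hu
  have hn : ‖star (e : Unitization ℂ B) * e‖ ≤ 1 := by
    rw [CStarRing.norm_star_mul_self, Unitization.norm_inr]
    exact mul_le_one₀ he (norm_nonneg _) he
  have h0 : 0 ≤ star (e : Unitization ℂ B) * e := star_mul_self_nonneg _
  have h1 : 0 ≤ u := sub_nonneg.2 ((CStarAlgebra.norm_le_one_iff_of_nonneg _).1 hn)
  have h2 : ‖u‖ ≤ 1 := (CStarAlgebra.norm_le_one_iff_of_nonneg _).2 (sub_le_self _ h0)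
  constructor
  · have h3 : ((b - b * (star e * e) : B) : Unitization ℂ B) = b * u := by
      rw [hu, mul_sub, mul_one, Unitization.inr_sub, Unitization.inr_mul, Unitization.inr_mul,
        Unitization.inr_star]
    rw [← Unitization.norm_inr (𝕜 := ℂ), h3, ← Unitization.norm_inr (𝕜 := ℂ) b]
    exact (norm_mul_le _ _).trans (mul_le_of_le_one_right (norm_nonneg _) h2)
  · have h3 : ((b - star e * e * b : B) : Unitization ℂ B) = u * b := by
      rw [hu, sub_mul, one_mul, Unitization.inr_sub, Unitization.inr_mul, Unitization.inr_mul,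
        Unitization.inr_star]
    rw [← Unitization.norm_inr (𝕜 := ℂ), h3, ← Unitization.norm_inr (𝕜 := ℂ) b]
    exact (norm_mul_le _ _).trans (mul_le_of_le_one_left (norm_nonneg _) h2)

namespace ClosedIdeal

variable {B : Type*} [NonUnitalCStarAlgebra B] (I : ClosedIdeal B)

/-- Lift the class of b*b to d of almost minimal norm, so that c = d − b*b lies in I. With p = e*e
from an approximate unit of I, the class of b is that of b(1 − p), whose square is (1 − p)d(1 − p) −
(1 − p)c(1 − p). The first term has norm at most ‖d‖ and the second is small. -/
theorem norm_mul_self_le (x : I.Quot) : ‖x‖ * ‖x‖ ≤ ‖star x * x‖ := by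
  obtain ⟨b, rfl⟩ := I.proj_surjective x
  refine le_of_forall_pos_lt_add fun ε hε => ?_
  rw [← proj_star, ← proj_mul]
  obtain ⟨d, hd, hdn⟩ := I.exists_norm_lt (I.proj (star b * b)) (show 0 < ε / 2 by positivity)
  have hc := I.proj_eq.1 hd
  set c := d - star b * b with hc_def
  obtain ⟨e, heI, he, hes, hec⟩ := exists_approxUnit I.toNonUnitalStarSubalgebra I.isClosed
    (isCompact_singleton (x := c)) (Set.singleton_subset_iff.2 hc) (show 0 < ε / 4 by positivity)
  have hc1 := hec c rfl
  set p := star e * e with hp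
  have hps : star p = p := by rw [hp, star_mul, star_star]
  have hpI : p ∈ I.toSub := I.mul_left heI _
  have hc2 : ‖c - c * p‖ ≤ 2 * ‖c - c * e‖ := by
    rw [hp, hes]; exact norm_sub_mul_self_le he
  have h1 : I.proj b = I.proj (b - b * p) := I.proj_eq.2 (by
    rw [sub_sub_cancel]; exact I.mul_left hpI b)
  have h2 : star (b - b * p) * (b - b * p)
      = ((d - d * p) - p * (d - d * p)) - ((c - c * p) - p * (c - c * p)) := by
    rw [hc_def, star_sub, star_mul, hps]; noncomm_ring
  rw [h1]
  calc ‖I.proj (b - b * p)‖ * ‖I.proj (b - b * p)‖ ≤ ‖b - b * p‖ * ‖b - b * p‖ := by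
        gcongr <;> exact I.norm_proj_le _
    _ = ‖((d - d * p) - p * (d - d * p)) - ((c - c * p) - p * (c - c * p))‖ := by
        rw [← h2, CStarRing.norm_star_mul_self]
    _ ≤ ‖(d - d * p) - p * (d - d * p)‖ + ‖(c - c * p) - p * (c - c * p)‖ := norm_sub_le _ _
    _ ≤ ‖d‖ + ‖c - c * p‖ := add_le_add
        ((norm_sub_star_mul_self_le _ he).2.trans (norm_sub_star_mul_self_le _ he).1)
        (norm_sub_star_mul_self_le _ he).2
    _ < _ := by linarith

noncomputable instance : NonUnitalCStarAlgebra I.Quot where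
  norm_mul_self_le := I.norm_mul_self_le

/-- The quotient map `B → B / I`. -/
noncomputable def quotMap : B →⋆ₙₐ[ℂ] I.Quot where
  toFun := I.proj
  map_smul' := map_smul I.proj
  map_zero' := map_zero I.proj
  map_add' := map_add I.proj
  map_mul' := I.proj_mul
  map_star' := I.proj_star

theorem quotMap_surjective : Function.Surjective I.quotMap := I.proj_surjective

theorem quotMap_eq_zero {b : B} : I.quotMap b = 0 ↔ b ∈ I.toNonUnitalStarSubalgebra := I.proj_eq_zero

section Action

variable {G : Type*} [Group G] [TopologicalSpace G] [CStarAction G B]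

/-- The automorphism of `B` given by `g` as a linear map. -/
def cactLin (g : G) : B →ₗ[ℂ] B where
  toFun b := CStarAction.act g b
  map_add' := map_add _
  map_smul' := map_smul _

/-- The action on `B / I` for an invariant closed ideal `I`. -/
@[reducible] noncomputable def quotAction
    (hinv : ∀ (g : G), ∀ b ∈ I.toNonUnitalStarSubalgebra,
      CStarAction.act g b ∈ I.toNonUnitalStarSubalgebra) : CStarAction G I.Quot :=
  let a : G → (I.Quot →ₗ[ℂ] I.Quot) := fun g =>
    I.toSub.mapQ I.toSub (cactLin g) fun b hb => hinv g b hb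
  have ha : ∀ g b, a g (I.proj b) = I.proj (CStarAction.act g b) := fun g b => rfl
  { act :=
      { toFun := fun g =>
          { toFun := a g
            map_smul' := map_smul (a g)
            map_zero' := map_zero (a g)
            map_add' := map_add (a g)
            map_mul' := fun x y => by
              obtain ⟨b, rfl⟩ := I.proj_surjective x
              obtain ⟨c, rfl⟩ := I.proj_surjective y
              rw [ha, ha, ← proj_mul, ← proj_mul, ha, map_mul]
            map_star' := fun x => by
              obtain ⟨b, rfl⟩ := I.proj_surjective x
              rw [ha, ← proj_star, ← proj_star, ha, map_star] }
        map_one' := by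
          ext x
          obtain ⟨b, rfl⟩ := I.proj_surjective x
          exact (ha 1 b).trans (by rw [map_one]; rfl)
        map_mul' := fun g h => by
          ext x
          obtain ⟨b, rfl⟩ := I.proj_surjective x
          exact (ha (g * h) b).trans (by rw [map_mul]; rfl) }
    continuous_act := fun x => by
      obtain ⟨b, rfl⟩ := I.proj_surjective x
      change Continuous fun g => I.proj (CStarAction.act g b)
      have hmk : Continuous I.proj := I.proj.mkContinuous 1 (fun b => by
        rw [one_mul]; exact I.norm_proj_le b) |>.continuous
      exact hmk.comp (CStarAction.continuous_act b) }

theorem quotMap_act (hinv : ∀ (g : G), ∀ b ∈ I.toNonUnitalStarSubalgebra,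
      CStarAction.act g b ∈ I.toNonUnitalStarSubalgebra) (g : G) (b : B) :
    I.quotMap (CStarAction.act g b) = (I.quotAction hinv).act g (I.quotMap b) := rfl

end Action

end ClosedIdeal

end SquareIntegrable

/-! ### The kernel of C*_r(G,B) → C*_r(G,B/I) by matrix coefficients -/

namespace SquareIntegrable

/-- Lift the finitely many centres of an ε-cover and average the lifts with the weights max(0, ε −
‖i − q‖), which vanish away from q. An approximate section is enough here. -/
theorem exists_continuous_lift {B Q : Type*} [NonUnitalCStarAlgebra B] [NonUnitalCStarAlgebra Q]
    (π : B →⋆ₙₐ[ℂ] Q) (hπ : Function.Surjective π) {C : Set Q} (hC : IsCompact C) {ε : ℝ}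
    (hε : 0 < ε) : ∃ s : Q → B, ContinuousOn s C ∧ ∀ q ∈ C, ‖π (s q) - q‖ ≤ ε := by
  obtain ⟨t, -, ht, hcov⟩ := hC.finite_cover_balls hε
  lift t to Finset Q using ht
  choose l hl using hπ
  set w : Q → Q → ℝ := fun i q => max 0 (ε - ‖i - q‖)
  have hw : ∀ i q, 0 ≤ w i q := fun i q => le_max_left _ _
  have hwc : ∀ i, Continuous (w i) := fun i => by fun_prop
  have hW : ∀ q ∈ C, 0 < ∑ i ∈ t, w i q := fun q hq => by
    obtain ⟨i, hi, hiq⟩ := Set.mem_iUnion₂.1 (hcov hq)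
    refine Finset.sum_pos' (fun i _ => hw i q) ⟨i, hi, ?_⟩
    rw [Metric.mem_ball, dist_comm, dist_eq_norm] at hiq
    exact lt_max_of_lt_right (sub_pos.2 hiq)
  refine ⟨fun q => (∑ i ∈ t, w i q)⁻¹ • ∑ i ∈ t, w i q • l i, ?_, fun q hq => ?_⟩
  · have h1 : ContinuousOn (fun q => (∑ i ∈ t, w i q)⁻¹) C :=
      (continuous_finsetSum _ fun i _ => hwc i).continuousOn.inv₀ fun q hq => (hW q hq).ne'
    have h2 : ContinuousOn (fun q => ∑ i ∈ t, w i q • l i) C :=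
      (continuous_finsetSum _ fun i _ => (hwc i).smul continuous_const).continuousOn
    exact h1.smul h2
  · have h1 : π ((∑ i ∈ t, w i q)⁻¹ • ∑ i ∈ t, w i q • l i) - q
        = (∑ i ∈ t, w i q)⁻¹ • ∑ i ∈ t, w i q • (i - q) := by
      have h2 : ∀ (c : ℝ) (b : B), π (c • b) = c • π b := fun c b =>
        (homL π).map_smul_of_tower c b
      simp only [h2, map_sum, hl, smul_sub, Finset.sum_sub_distrib, ← Finset.sum_smul]
      rw [smul_smul _ _ q, inv_mul_cancel₀ (hW q hq).ne', one_smul]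
    rw [h1, norm_smul, norm_inv, Real.norm_of_nonneg (hW q hq).le, inv_mul_le_iff₀ (hW q hq),
      Finset.sum_mul]
    refine (norm_sum_le _ _).trans (Finset.sum_le_sum fun i _ => ?_)
    rw [norm_smul, Real.norm_of_nonneg (hw i q)]
    rcases le_or_gt ‖i - q‖ ε with h | h
    · exact mul_le_mul_of_nonneg_left h (hw i q)
    · have : w i q = 0 := max_eq_left (by linarith)
      rw [this, zero_mul, zero_mul]

section Kernel

variable {G : Type*} [Group G] [TopologicalSpace G] [IsTopologicalGroup G]
  [LocallyCompactSpace G] [T2Space G] [MeasurableSpace G] [BorelSpace G]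
  {μ : Measure G} [μ.IsHaarMeasure]
  {B Q : Type*} [NonUnitalCStarAlgebra B] [CStarAction G B]
  [NonUnitalCStarAlgebra Q] [CStarAction G Q] {π : B →⋆ₙₐ[ℂ] Q}

theorem inner_ccMap (π : B →⋆ₙₐ[ℂ] Q) (f k : C_c(G, B)) :
    inner Q (toL2 μ (ccMap π f)) (toL2 μ (ccMap π k)) = π (inner B (toL2 μ f) (toL2 μ k)) := by
  rw [inner_toL2, inner_toL2]
  refine Eq.trans ?_ (integral_hom π (integrable_cc μ (starMul f.toContinuousMap k)))
  refine integral_congr_ae (Eventually.of_forall fun g => ?_)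
  change star (π (f g)) * π (k g) = π (star (f g) * k g)
  rw [map_mul, map_star]

theorem rhoFun_ccMap (hinv : ∀ (g : G) (b : B), π (CStarAction.act g b) = CStarAction.act g (π b))
    (K f : C_c(G, B)) : rhoFun μ (ccMap π K) (ccMap π f) = ccMap π (rhoFun μ K f) := by
  refine CompactlySupportedContinuousMap.ext fun g => ?_
  refine Eq.trans ?_ (integral_hom π (integrable_rho μ K f g))
  refine integral_congr_ae (Eventually.of_forall fun h => ?_)
  change CStarAction.act g (π (K (g⁻¹ * h))) * π (f h) = π (CStarAction.act g (K (g⁻¹ * h)) * f h)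
  rw [map_mul π, hinv]

theorem norm_toL2_le_of_norm_le {f : C_c(G, Q)} {θ : C_c(G, ℝ)} {δ : ℝ} (hδ : 0 ≤ δ)
    (h : ∀ g, ‖f g‖ ≤ δ * θ g) : ‖toL2 μ f‖ ≤ δ * √(∫ g, θ g * θ g ∂μ) := by
  have hθi : Integrable (fun g => θ g * θ g) μ :=
    (θ.continuous.mul θ.continuous).integrable_of_hasCompactSupport θ.hasCompactSupport.mul_left
  have hc : 0 ≤ ∫ g, θ g * θ g ∂μ := integral_nonneg fun g => mul_self_nonneg _
  refine le_of_sq_le_sq (α := ℝ) ?_ (by positivity)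
  rw [norm_toL2, mul_pow, Real.sq_sqrt hc, ← integral_const_mul]
  refine norm_integral_le_of_norm_le (hθi.const_mul _) (Eventually.of_forall fun g => ?_)
  rw [CStarRing.norm_star_mul_self]
  have h1 := mul_self_le_mul_self (norm_nonneg _) (h g)
  linarith [h1, mul_mul_mul_comm δ (θ g) δ (θ g), pow_two δ]

/-- The lift of F need not vanish where F does, so it is cut off by θ; the error is then dominated
by the compactly supported δθ. -/
theorem exists_ccMap_pointwise_near (hπ : Function.Surjective π) (F : C_c(G, Q))
    {θ : C_c(G, ℝ)} (hθ1 : ∀ g ∈ tsupport F, θ g = 1) (hθ : ∀ g, 0 ≤ θ g) {δ : ℝ} (hδ : 0 < δ) :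
    ∃ K : C_c(G, B), ∀ g, ‖F g - π (K g)‖ ≤ δ * θ g := by
  obtain ⟨s, hsc, hs'⟩ := exists_continuous_lift π hπ
    (F.hasCompactSupport.isCompact_range F.continuous) hδ
  have hsF : Continuous fun g => s (F g) :=
    hsc.comp_continuous F.continuous fun g => Set.mem_range_self g
  refine ⟨cutMul θ ⟨_, hsF⟩, fun g => ?_⟩
  have h1 : F g = θ g • F g := by
    by_cases hg : g ∈ tsupport F
    · rw [hθ1 g hg, one_smul]
    · rw [image_eq_zero_of_notMem_tsupport hg, smul_zero]
  have h2 : π (θ g • s (F g)) = θ g • π (s (F g)) := (homL π).map_smul_of_tower (θ g) (s (F g))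
  have h3 : F g - π (θ g • s (F g)) = θ g • (F g - π (s (F g))) := by rw [h2, smul_sub, ← h1]
  change ‖F g - π (θ g • s (F g))‖ ≤ _
  rw [h3, norm_smul, Real.norm_of_nonneg (hθ g), norm_sub_rev, mul_comm]
  exact mul_le_mul_of_nonneg_right (hs' _ ⟨g, rfl⟩) (hθ g)

theorem exists_ccMap_near (hπ : Function.Surjective π) (F : C_c(G, Q)) {ε : ℝ} (hε : 0 < ε) :
    ∃ K : C_c(G, B), ‖toL2 μ (F - ccMap π K)‖ < ε := by
  obtain ⟨θ, hθ1, hθ⟩ := exists_cutoff F.hasCompactSupport.isCompact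
  obtain ⟨c, hc⟩ : ∃ c, c = √(∫ g, θ g * θ g ∂μ) := ⟨_, rfl⟩
  have hc0 : 0 ≤ c := hc ▸ Real.sqrt_nonneg _
  have hs : 0 < c + 1 := by positivity
  obtain ⟨K, hK⟩ := exists_ccMap_pointwise_near hπ F hθ1 (fun g => (hθ g).1) (div_pos hε hs)
  refine ⟨K, (norm_toL2_le_of_norm_le (div_pos hε hs).le hK).trans_lt ?_⟩
  rw [← hc, div_mul_eq_mul_div, div_lt_iff₀ hs]
  exact mul_lt_mul_of_pos_left (by linarith) hε

/-- This allows operators on L²(G,Q) to be estimated on functions that lift to `B`. -/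
theorem denseRange_ccMap (hπ : Function.Surjective π) :
    DenseRange fun K : C_c(G, B) => toL2 μ (ccMap π K) := by
  intro x
  refine L2_induction μ
    (p := fun x => x ∈ closure (Set.range fun K : C_c(G, B) => toL2 μ (ccMap π K)))
    isClosed_closure (fun F => ?_) x
  refine Metric.mem_closure_iff.2 fun ε hε => ?_
  obtain ⟨K, hK⟩ := exists_ccMap_near (μ := μ) hπ F hε
  rw [map_sub, ← dist_eq_norm] at hK
  exact ⟨_, ⟨K, rfl⟩, hK⟩

theorem rho_ccMap_apply
    (hinv : ∀ (g : G) (b : B), π (CStarAction.act g b) = CStarAction.act g (π b))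
    (K f : C_c(G, B)) :
    rho μ (ccMap π K) (toL2 μ (ccMap π f)) = toL2 μ (ccMap π (rhoFun μ K f)) := by
  rw [rho_toL2, rhoFun_ccMap hinv]

/-- The norm of `ρ_{π ∘ K}` is at most the distance of `ρ_K` to the operators with matrix
coefficients in the kernel of `π`. -/
theorem norm_rho_ccMap_le (hπ : Function.Surjective π)
    (hinv : ∀ (g : G) (b : B), π (CStarAction.act g b) = CStarAction.act g (π b))
    {T S : L2 μ B →L[ℂ] L2 μ B} (hTS : AdjPair B T S) (hT : ∀ x y, π (inner B x (T y)) = 0)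
    (K : C_c(G, B)) : ‖rho μ (ccMap π K)‖ ≤ ‖rho μ K - T‖ := by
  set D := rho μ K - T with hD
  -- The coefficients of T vanish in `Q`, so ρ_K may be replaced by D = ρ_K − T after applying π. As
  -- D is adjointable, `norm_map_inner_le` bounds it in the quotient.
  have hker : ∀ x, π (inner B (rho μ K x) (rho μ K x)) = π (inner B (D x) (D x)) := fun x => by
    have h1 : rho μ K x = D x + T x := by rw [hD, sub_apply, sub_add_cancel]
    have h2 : ∀ y, π (inner B (T x) y) = 0 := fun y => by
      rw [← HilbertModule.star_inner, map_star, hT, star_zero]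
    rw [h1, HilbertModule.inner_add_right, inner_add_left, map_add, map_add, hT, h2]
    simp
  refine ContinuousLinearMap.opNorm_le_bound _ (norm_nonneg _) fun q => ?_
  refine (denseRange_ccMap (μ := μ) hπ).induction_on
    (p := fun q => ‖rho μ (ccMap π K) q‖ ≤ ‖D‖ * ‖q‖) q
    (isClosed_le (by fun_prop) (by fun_prop)) fun f => ?_
  refine le_of_sq_le_sq (α := ℝ) ?_ (by positivity)
  rw [rho_ccMap_apply hinv, mul_pow, HilbertModule.norm_sq_eq (B := Q), inner_ccMap,
    HilbertModule.norm_sq_eq (B := Q) (toL2 μ (ccMap π f)), inner_ccMap, ← rho_toL2, hker]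
  exact norm_map_inner_le π hπ ((adjPair_rho K).sub hTS) _

theorem exists_adjPair_of_mem_crossed {T : L2 μ B →L[ℂ] L2 μ B} (hT : T ∈ crossedSubmodule μ B) :
    ∃ S, AdjPair B T S := by
  refine (isClosed_adjointable (B := B) (E := L2 μ B) (F := L2 μ B)).closure_subset_iff.2 ?_ hT
  rintro _ ⟨K, rfl⟩
  exact ⟨_, adjPair_rho K⟩

/-- The kernel of `C⋆_r(G, B) → C⋆_r(G, Q)` consists of the operators in `C⋆_r(G, B)` with matrix
coefficients in the kernel of `π`. -/
theorem mem_crossedGraph_zero_iff (hπ : Function.Surjective π)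
    (hinv : ∀ (g : G) (b : B), π (CStarAction.act g b) = CStarAction.act g (π b))
    {T : L2 μ B →L[ℂ] L2 μ B} : (T, 0) ∈ crossedGraph μ π ↔
      T ∈ crossedSubmodule μ B ∧ ∀ x y, π (inner B x (T y)) = 0 := by
  constructor
  · intro h
    refine ⟨map_mem_closure (f := Prod.fst) continuous_fst h ?_, fun x y => ?_⟩
    · rintro _ ⟨K, rfl⟩
      exact ⟨K, rfl⟩
    · have hc : Continuous π := (homL π).continuous
      refine L2_induction μ (p := fun x => π (inner B x (T y)) = 0) (isClosed_eq
        (hc.comp (continuous_inner continuous_id continuous_const)) continuous_const) (fun f => ?_) x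
      refine L2_induction μ (p := fun y => π (inner B (toL2 μ f) (T y)) = 0) (isClosed_eq
        (hc.comp (continuous_inner continuous_const T.continuous)) continuous_const) (fun k => ?_) y
      have hcl : IsClosed {p : (L2 μ B →L[ℂ] L2 μ B) × (L2 μ Q →L[ℂ] L2 μ Q) |
          π (inner B (toL2 μ f) (p.1 (toL2 μ k)))
            = inner Q (toL2 μ (ccMap π f)) (p.2 (toL2 μ (ccMap π k)))} :=
        isClosed_eq (hc.comp (continuous_inner continuous_const (continuous_fst.clm_apply continuous_const)))
          (continuous_inner continuous_const (continuous_snd.clm_apply continuous_const))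
      have := hcl.closure_subset_iff.2 (fun p hp => by
        obtain ⟨K, rfl⟩ := hp
        change π (inner B (toL2 μ f) (rho μ K (toL2 μ k)))
          = inner Q (toL2 μ (ccMap π f)) (rho μ (ccMap π K) (toL2 μ (ccMap π k)))
        rw [rho_ccMap_apply hinv, inner_ccMap, rho_toL2]) h
      refine Eq.trans this ?_
      exact inner_zero_right _
  · rintro ⟨hT, h⟩
    obtain ⟨S, hS⟩ := exists_adjPair_of_mem_crossed hT
    refine Metric.mem_closure_iff.2 fun ε hε => ?_
    -- Any approximation of T by ρ_K makes the second component small as well, since ‖ρ_{π∘K}‖ ≤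
    -- ‖ρ_K − T‖.
    obtain ⟨_, ⟨K, rfl⟩, hK⟩ := Metric.mem_closure_iff.1 hT ε hε
    change dist T (rho μ K) < ε at hK
    refine ⟨_, ⟨K, rfl⟩, ?_⟩
    rw [Prod.dist_eq]
    refine max_lt hK ?_
    rw [dist_comm, dist_eq_norm] at hK
    rw [dist_comm, dist_eq_norm]
    change ‖rho μ (ccMap π K) - 0‖ < ε
    rw [sub_zero]
    exact (norm_rho_ccMap_le hπ hinv hS h K).trans_lt hK

end Kernel

end SquareIntegrable

/-! ### Exact groups: j∘i is the identity -/

namespace SquareIntegrable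

/-- The ideal generated by the inner products, as a closed ideal. -/
noncomputable def innerClosedIdeal (B E : Type*) [NonUnitalCStarAlgebra B] [NormedAddCommGroup E]
    [NormedSpace ℂ E] [SMul Bᵐᵒᵖ E] [HilbertModule B E] : ClosedIdeal B where
  toNonUnitalStarSubalgebra := innerIdeal B E
  isClosed := isClosed_innerIdeal B E
  mul_mem_right _ ha b := innerIdeal_mul_mem (E := E) ha b

variable {G : Type u} [Group G] [TopologicalSpace G] [IsTopologicalGroup G]
  [LocallyCompactSpace G] [T2Space G] [MeasurableSpace G] [BorelSpace G]
  {μ : Measure G} [μ.IsHaarMeasure]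

theorem mem_crossedIdeal_of_exact (hG : IsExactGroup μ) {B : Type u} [NonUnitalCStarAlgebra B]
    [CStarAction G B] (I : ClosedIdeal B)
    (hinv : ∀ (g : G), ∀ b ∈ I.toNonUnitalStarSubalgebra,
      CStarAction.act g b ∈ I.toNonUnitalStarSubalgebra)
    {T : L2 μ B →L[ℂ] L2 μ B} (hT : T ∈ crossedSubmodule μ B)
    (h : ∀ x y, inner B x (T y) ∈ I.toNonUnitalStarSubalgebra) :
    T ∈ crossedIdeal μ (I.toNonUnitalStarSubalgebra : Set B) := by
  let _ : CStarAction G I.Quot := I.quotAction hinv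
  have h1 := hG B I.Quot I.quotMap I.quotMap_surjective (I.quotMap_act hinv)
  have h2 : {b : B | I.quotMap b = 0} = I.toNonUnitalStarSubalgebra :=
    Set.ext fun b => I.quotMap_eq_zero
  rw [← h2, h1]
  exact (mem_crossedGraph_zero_iff I.quotMap_surjective (I.quotMap_act hinv)).2
    ⟨hT, fun x y => I.quotMap_eq_zero.2 (h x y)⟩

/-- One factor of e² moves from the kernel onto ξ, where membership of ξe in j∘i(R) is already
known. -/
theorem convAct_tensor_mul {B E : Type*} [NonUnitalCStarAlgebra B] [CStarAction G B]
    [NormedAddCommGroup E] [NormedSpace ℂ E] [CompleteSpace E] [SMul Bᵐᵒᵖ E]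
    [HilbertModule B E] [HilbertAction G B E] (ξ : E) (φ : C_c(G, ℝ)) (a b : B) :
    convAct μ B ξ (tensor φ (a * b)) = convAct μ B (ξ <• a) (tensor φ b) := by
  refine integral_congr_ae (Eventually.of_forall fun g => ?_)
  change gact B g (ξ <• (φ g⁻¹ • (a * b))) = gact B g ((ξ <• a) <• (φ g⁻¹ • b))
  rw [act_act, mul_smul_comm]

/-- The coefficients of ⟨⟨ξ|ξ⟩⟩ are inner products of `E`, so exactness puts it in C*_r(G,I). Thus ξ
is a ‖·‖_si-limit of (ξe)∗(φ⊗e) with e in I, and these lie in j∘i(R). -/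
theorem ofCompacts_toCompacts_of_exact (hG : IsExactGroup μ) {B E : Type u}
    [NonUnitalCStarAlgebra B] [CStarAction G B]
    [NormedAddCommGroup E] [NormedSpace ℂ E] [CompleteSpace E] [SMul Bᵐᵒᵖ E]
    [HilbertModule B E] [HilbertAction G B E] {R : Submodule ℂ E} (hR : R ∈ contSubspaces μ B E) :
    ofCompacts μ B (toCompacts μ B R) = R := by
  refine le_antisymm (ofCompacts_toCompacts_le hR) fun ξ hξ => ?_
  have hc := (ofCompacts_mem_contSubspaces (toCompacts_mem_contSubspaces hR)).2.1
  have hX := isKet_ket (hR.2.2.1 hξ)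
  have hinv : ∀ (g : G), ∀ b ∈ innerIdeal B E, CStarAction.act g b ∈ innerIdeal B E :=
    fun g b hb => cact_mem_innerIdeal g hb
  have hT := mem_crossedIdeal_of_exact hG (innerClosedIdeal B E) hinv
    ((isRelativelyContinuous_iff hR.2.2.1).1 hR.2.2 ξ hξ ξ hξ _ _ hX hX) fun x y => by
      rw [ContinuousLinearMap.comp_apply, ← hX.adj]
      exact inner_mem_innerIdeal _ _
  refine hc.closed_si ξ (hR.2.2.1 hξ) fun ε hε => ?_
  obtain ⟨φ, e, he, h1, h2⟩ := hX.exists_approx (innerIdeal B E) (isClosed_innerIdeal B E) hinv hT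
    (inner_mem_innerIdeal ξ ξ) (show 0 < ε / 2 by positivity)
  refine ⟨convAct μ B ξ (tensor φ (e * e)), ?_, ?_⟩
  · rw [convAct_tensor_mul]
    exact hc.conv_mem _ (act_mem_ofCompacts_toCompacts hR hξ he) _
  · rw [(hX.sub (hX.convAct _)).siNorm_eq]
    linarith

end SquareIntegrable

/-! ### Closed invariant submodules -/

namespace SquareIntegrable

section InvariantSubmodule

variable {G B F : Type*} [Group G] [TopologicalSpace G] [NonUnitalCStarAlgebra B] [CStarAction G B]
  [NormedAddCommGroup F] [NormedSpace ℂ F] [SMul Bᵐᵒᵖ F] [HilbertModule B F] [HilbertAction G B F]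

variable (G B F) in
/-- A closed invariant submodule of a Hilbert `B,G`-module. -/
structure InvariantSubmodule extends Submodule ℂ F where
  isClosed : IsClosed (carrier : Set F)
  act_mem : ∀ x ∈ carrier, ∀ b : B, x <• b ∈ carrier
  gact_mem : ∀ x ∈ carrier, ∀ g : G, gact B g x ∈ carrier

namespace InvariantSubmodule

variable (V : InvariantSubmodule G B F)

instance : SMul Bᵐᵒᵖ V.toSubmodule where
  smul b x := ⟨(x : F) <• b.unop, V.act_mem x x.2 b.unop⟩

instance [CompleteSpace F] : CompleteSpace V.toSubmodule := V.isClosed.completeSpace_coe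

noncomputable instance : HilbertModule B V.toSubmodule where
  inner x y := inner B (x : F) (y : F)
  inner_add_right x y z := HilbertModule.inner_add_right (x : F) y z
  inner_smul_right c x y := HilbertModule.inner_smul_right c (x : F) y
  inner_act_right x y b := HilbertModule.inner_act_right (x : F) (y : F) b
  star_inner x y := HilbertModule.star_inner (x : F) y
  inner_self_nonneg x := HilbertModule.inner_self_nonneg (x : F)
  norm_sq_eq x := HilbertModule.norm_sq_eq (B := B) (x : F)

noncomputable instance : HilbertAction G B V.toSubmodule where
  act :=
    { toFun := fun g => ((gact B g).toLinearMap.restrict (p := V.toSubmodule) (q := V.toSubmodule)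
        fun x hx => V.gact_mem x hx g)
      map_one' := LinearMap.ext fun x => Subtype.ext (DFunLike.congr_fun (gact_one B) (x : F))
      map_mul' := fun g h => LinearMap.ext fun x => Subtype.ext (DFunLike.congr_fun (gact_mul B g h) (x : F)) }
  act_smul g x b := Subtype.ext (gact_smul B g (x : F) b)
  inner_act g x y := inner_gact B g (x : F) y
  continuous_act x := Continuous.subtype_mk (continuous_gact B (x : F)) _

end InvariantSubmodule

end InvariantSubmodule

section Sub

variable {G : Type*} [Group G] [TopologicalSpace G] [IsTopologicalGroup G]
  [LocallyCompactSpace G] [T2Space G] [MeasurableSpace G] [BorelSpace G]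
  {μ : Measure G} [μ.IsHaarMeasure]
  {B F : Type*} [NonUnitalCStarAlgebra B] [CStarAction G B]
  [NormedAddCommGroup F] [NormedSpace ℂ F] [CompleteSpace F] [SMul Bᵐᵒᵖ F] [HilbertModule B F]
  [HilbertAction G B F] (V : InvariantSubmodule G B F)

theorem InvariantSubmodule.coe_ketLin (ξ : V.toSubmodule) (f : C_c(G, B)) :
    ((ketLin μ B ξ f : V.toSubmodule) : F) = ketLin μ B (ξ : F) f :=
  (V.toSubmodule.subtypeL.integral_comp_comm (integrable_cc μ (ketFun ξ f))).symm

/-- The adjoint of the corestriction is the restriction of the adjoint to the submodule, so no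
complement of the submodule is needed. -/
theorem IsKet.codRestrict {ξ : V.toSubmodule} {X : L2 μ B →L[ℂ] F} (h : IsKet μ (ξ : F) X)
    (hX : ∀ x, X x ∈ V.toSubmodule) : IsKet μ ξ (X.codRestrict V.toSubmodule hX) :=
  ⟨⟨SquareIntegrable.adj B X ∘L V.toSubmodule.subtypeL, fun x y => h.adj x y⟩,
    fun f => Subtype.ext ((h.2 f).trans (V.coe_ketLin ξ f).symm)⟩

end Sub

end SquareIntegrable

/-! ### Non-exact groups: the counterexample in L²(G,I) -/

namespace SquareIntegrable

/-- The kernel of a `⋆`-homomorphism. -/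
def homKernel {B Q : Type*} [NonUnitalCStarAlgebra B] [NonUnitalCStarAlgebra Q]
    (π : B →⋆ₙₐ[ℂ] Q) : NonUnitalStarSubalgebra ℂ B where
  carrier := {b | π b = 0}
  add_mem' {a b} ha hb := by
    rw [Set.mem_ofPred_eq] at *
    rw [map_add, ha, hb, add_zero]
  zero_mem' := map_zero π
  smul_mem' c b hb := by
    rw [Set.mem_ofPred_eq] at *
    rw [map_smul, hb, smul_zero]
  mul_mem' {a b} ha _ := by
    rw [Set.mem_ofPred_eq] at *
    rw [map_mul, ha, zero_mul]
  star_mem' {a} ha := by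
    rw [Set.mem_ofPred_eq] at *
    rw [map_star, ha, star_zero]

theorem mem_homKernel {B Q : Type*} [NonUnitalCStarAlgebra B] [NonUnitalCStarAlgebra Q]
    {π : B →⋆ₙₐ[ℂ] Q} {b : B} : b ∈ homKernel π ↔ π b = 0 := Iff.rfl

theorem isClosed_homKernel {B Q : Type*} [NonUnitalCStarAlgebra B] [NonUnitalCStarAlgebra Q]
    (π : B →⋆ₙₐ[ℂ] Q) : IsClosed (homKernel π : Set B) :=
  isClosed_singleton.preimage (homL π).continuous

section Nonexact

variable {G : Type*} [Group G] [TopologicalSpace G] [IsTopologicalGroup G]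
  [LocallyCompactSpace G] [T2Space G] [MeasurableSpace G] [BorelSpace G]
  {μ : Measure G} [μ.IsHaarMeasure]
  {B Q : Type*} [NonUnitalCStarAlgebra B] [CStarAction G B]
  [NonUnitalCStarAlgebra Q] [CStarAction G Q] {π : B →⋆ₙₐ[ℂ] Q}

variable (μ) in
/-- The submodule `L²(G, I)` of `L²(G, B)` for the kernel `I` of `π`. -/
def kernelL2 (hinv : ∀ (g : G) (b : B), π (CStarAction.act g b) = CStarAction.act g (π b)) :
    InvariantSubmodule G B (L2 μ B) where
  carrier := {x | ∀ y, π (inner B y x) = 0}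
  add_mem' {x x'} hx hx' y := by rw [HilbertModule.inner_add_right, map_add, hx, hx', add_zero]
  zero_mem' y := by rw [inner_zero_right, map_zero]
  smul_mem' c x hx y := by rw [HilbertModule.inner_smul_right, map_smul, hx, smul_zero]
  isClosed := by
    have : {x : L2 μ B | ∀ y, π (inner B y x) = 0} = ⋂ y, {x | π (inner B y x) = 0} := by
      ext x; simp
    rw [this]
    exact isClosed_iInter fun y => isClosed_eq
      ((homL π).continuous.comp (continuous_inner continuous_const continuous_id)) continuous_const
  act_mem x hx b y := by rw [HilbertModule.inner_act_right, map_mul, hx, zero_mul]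
  gact_mem x hx g y := by
    have h : y = gact B g (gact B g⁻¹ y) := (gact_gact_inv B g y).symm
    rw [h, inner_gact, hinv, hx, map_zero]

theorem mem_kernelL2 (hinv : ∀ (g : G) (b : B), π (CStarAction.act g b) = CStarAction.act g (π b))
    {x : L2 μ B} : x ∈ (kernelL2 μ hinv).toSubmodule ↔ ∀ y, π (inner B y x) = 0 := Iff.rfl

variable (μ π) in
/-- The kernel of `C⋆_r(G, B) → C⋆_r(G, Q)`, described by matrix coefficients. -/
noncomputable def crossedKernel : Submodule ℂ (L2 μ B →L[ℂ] L2 μ B) where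
  carrier := {T | T ∈ crossedSubmodule μ B ∧ ∀ x y, π (inner B x (T y)) = 0}
  add_mem' {S T} hS hT := ⟨add_mem hS.1 hT.1, fun x y => by
    rw [add_apply, HilbertModule.inner_add_right, map_add, hS.2, hT.2, add_zero]⟩
  zero_mem' := ⟨zero_mem _, fun x y => by rw [zero_apply, inner_zero_right, map_zero]⟩
  smul_mem' c T hT := ⟨Submodule.smul_mem _ c hT.1, fun x y => by
    rw [smul_apply, HilbertModule.inner_smul_right, map_smul, hT.2, smul_zero]⟩

theorem isClosed_crossedKernel : IsClosed (crossedKernel μ π : Set (L2 μ B →L[ℂ] L2 μ B)) := by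
  have : (crossedKernel μ π : Set (L2 μ B →L[ℂ] L2 μ B)) = (crossedSubmodule μ B : Set (L2 μ B →L[ℂ] L2 μ B)) ∩
      ⋂ x, ⋂ y, {T : L2 μ B →L[ℂ] L2 μ B | π (inner B x (T y)) = 0} := by
    ext T
    simp only [Set.mem_inter_iff, Set.mem_iInter]
    exact Iff.rfl
  rw [this]
  refine isClosed_crossed.inter (isClosed_iInter fun x => isClosed_iInter fun y => isClosed_eq
    ((homL π).continuous.comp (continuous_inner continuous_const ?_)) continuous_const)
  exact continuous_id.clm_apply continuous_const

theorem crossedKernel_comp_rho {T : L2 μ B →L[ℂ] L2 μ B} (hT : T ∈ crossedKernel μ π)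
    (K : C_c(G, B)) : T ∘L rho μ K ∈ crossedKernel μ π :=
  ⟨crossed_comp hT.1 (rho_mem_crossed K), fun x _ => hT.2 x _⟩

variable (μ π) in
/-- The ideal `C⋆_r(G, I)` for the kernel `I` of `π`, as a closed subspace. -/
noncomputable def crossedIdealSubmodule : Submodule ℂ (L2 μ B →L[ℂ] L2 μ B) :=
  (Submodule.map ({ toFun := rho μ, map_add' := rho_add μ, map_smul' := rho_smul μ } :
    C_c(G, B) →ₗ[ℂ] L2 μ B →L[ℂ] L2 μ B)
    { carrier := {K | ∀ g, π (K g) = 0}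
      add_mem' := fun {K L} hK hL g => by
        change π (K g + L g) = 0
        rw [map_add, hK, hL, add_zero]
      zero_mem' := fun g => map_zero π
      smul_mem' := fun c K hK g => by
        change π (c • K g) = 0
        rw [map_smul, hK, smul_zero] }).topologicalClosure

theorem mem_crossedIdealSubmodule {T : L2 μ B →L[ℂ] L2 μ B} :
    T ∈ crossedIdealSubmodule μ π ↔ T ∈ crossedIdeal μ {b | π b = 0} := by
  change T ∈ closure _ ↔ T ∈ closure _
  refine iff_of_eq (congrArg (T ∈ closure ·) (Set.ext fun S => ?_))
  exact ⟨fun ⟨K, hK, h⟩ => ⟨K, hK, h.symm⟩, fun ⟨K, hK, h⟩ => ⟨K, hK, h.symm⟩⟩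

theorem rho_mem_crossedIdealSubmodule {K : C_c(G, B)} (hK : ∀ g, π (K g) = 0) :
    rho μ K ∈ crossedIdealSubmodule μ π := subset_closure ⟨K, hK, rfl⟩

theorem isClosed_crossedIdealSubmodule :
    IsClosed (crossedIdealSubmodule μ π : Set (L2 μ B →L[ℂ] L2 μ B)) := isClosed_closure

theorem crossed_equivariant {T : L2 μ B →L[ℂ] L2 μ B} (hT : T ∈ crossedSubmodule μ B) (g : G)
    (x : L2 μ B) : T (gact B g x) = gact B g (T x) := by
  have hcl : IsClosed {T : L2 μ B →L[ℂ] L2 μ B | T (gact B g x) = gact B g (T x)} :=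
    isClosed_eq (continuous_id.clm_apply continuous_const)
      ((gact B g).continuous.comp (continuous_id.clm_apply continuous_const))
  refine hcl.closure_subset_iff.2 ?_ hT
  rintro _ ⟨K, rfl⟩
  exact (isKet_toL2_dagger (μ := μ) K).equivariant g x

variable (hinv : ∀ (g : G) (b : B), π (CStarAction.act g b) = CStarAction.act g (π b))

include hinv

/-- Modulo I the kernel of ρ_L ρ_K is a convolution with 0. This and the next two lemmas say that
C*_r(G,I) absorbs products with the crossed product and with M_b for b in I. -/
theorem comp_rho_mem_crossedIdealSubmodule {S : L2 μ B →L[ℂ] L2 μ B}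
    (hS : S ∈ crossedSubmodule μ B) {K : C_c(G, B)} (hK : ∀ g, π (K g) = 0) :
    S ∘L rho μ K ∈ crossedIdealSubmodule μ π := by
  refine isClosed_crossedIdealSubmodule.closure_subset ?_
  refine map_mem_closure (f := fun S : L2 μ B →L[ℂ] L2 μ B => S ∘L rho μ K) (by fun_prop) hS ?_
  rintro _ ⟨L, rfl⟩
  change rho μ L ∘L rho μ K ∈ _
  rw [rho_comp_rho]
  refine rho_mem_crossedIdealSubmodule fun g => ?_
  have h1 : ccMap π (dagger K) = 0 := CompactlySupportedContinuousMap.ext fun g => by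
    change π (CStarAction.act g (K g⁻¹)) = 0
    rw [hinv, hK, map_zero]
  have h2 : ∀ g, π (rhoFun μ L (dagger K) g) = 0 := fun g => by
    have h3 := rhoFun_ccMap (μ := μ) hinv L (dagger K)
    rw [h1] at h3
    have h4 : ccMap π (rhoFun μ L (dagger K)) g = 0 := by
      rw [← h3]
      exact congrFun (congrArg DFunLike.coe ((rhoLin μ (ccMap π L)).map_zero)) g
    exact h4
  rw [dagger_apply, hinv, h2, map_zero]

theorem crossedIdealSubmodule_comp_rho {S : L2 μ B →L[ℂ] L2 μ B}
    (hS : S ∈ crossedIdealSubmodule μ π) (K : C_c(G, B)) :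
    S ∘L rho μ K ∈ crossedIdealSubmodule μ π := by
  refine isClosed_crossedIdealSubmodule.closure_subset ?_
  refine map_mem_closure (f := fun S : L2 μ B →L[ℂ] L2 μ B => S ∘L rho μ K) (by fun_prop) hS ?_
  rintro _ ⟨L, hL, rfl⟩
  change rho μ L ∘L rho μ K ∈ _
  rw [rho_comp_rho]
  refine rho_mem_crossedIdealSubmodule fun g => ?_
  have h1 : ∀ g, π (rhoFun μ L (dagger K) g) = 0 := fun g => by
    have h2 : π (rhoFun μ L (dagger K) g) = rhoFun μ (ccMap π L) (ccMap π (dagger K)) g := by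
      rw [rhoFun_ccMap hinv]; rfl
    rw [h2, rhoFun_apply]
    refine integral_eq_zero_of_ae (Eventually.of_forall fun h => ?_)
    change CStarAction.act g (π (L (g⁻¹ * h))) * _ = 0
    rw [hL, map_zero, zero_mul]
  rw [dagger_apply, hinv, h1, map_zero]

theorem comp_mulL2_mem_crossedIdealSubmodule {S : L2 μ B →L[ℂ] L2 μ B}
    (hS : S ∈ crossedSubmodule μ B) {b : B} (hb : π b = 0) :
    S ∘L mulL2 μ b ∈ crossedIdealSubmodule μ π := by
  refine isClosed_crossedIdealSubmodule.closure_subset ?_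
  refine map_mem_closure (f := fun S : L2 μ B →L[ℂ] L2 μ B => S ∘L mulL2 μ b) (by fun_prop) hS ?_
  rintro _ ⟨L, rfl⟩
  change rho μ L ∘L mulL2 μ b ∈ _
  rw [rho_comp_mulL2]
  refine rho_mem_crossedIdealSubmodule fun g => ?_
  change π (L g * CStarAction.act g b) = 0
  rw [map_mul, hinv, hb, map_zero, mul_zero]

theorem crossedIdealSubmodule_le : crossedIdealSubmodule μ π ≤ crossedKernel μ π := by
  refine Submodule.topologicalClosure_minimal _ ?_ isClosed_crossedKernel
  rintro _ ⟨K, hK, rfl⟩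
  refine ⟨rho_mem_crossed K, fun x y => ?_⟩
  have hc : Continuous π := (homL π).continuous
  change π (inner B x (rho μ K y)) = 0
  refine L2_induction μ (p := fun x => π (inner B x (rho μ K y)) = 0) (isClosed_eq
    (hc.comp (continuous_inner continuous_id continuous_const)) continuous_const) (fun f => ?_) x
  refine L2_induction μ (p := fun y => π (inner B (toL2 μ f) (rho μ K y)) = 0) (isClosed_eq
    (hc.comp (continuous_inner continuous_const (rho μ K).continuous)) continuous_const)
    (fun k => ?_) y
  have h0 : ccMap π K = 0 := CompactlySupportedContinuousMap.ext hK
  rw [rho_toL2, ← inner_ccMap, ← rho_ccMap_apply hinv, h0, rho_zero, zero_apply, inner_zero_right]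

/-- The subspace of `L²(G, I)_si` of all `ξ` for which `|ξ⟩⟩` belongs to the kernel of
`C⋆_r(G, B) → C⋆_r(G, Q)`. -/
noncomputable def kernelSubspace : Submodule ℂ (kernelL2 μ hinv).toSubmodule :=
  ketSubmodule μ B (kernelL2 μ hinv).toSubmodule.subtypeL (crossedKernel μ π)

theorem mem_kernelSubspace_of_isKet {x : L2 μ B} {T : L2 μ B →L[ℂ] L2 μ B} (h : IsKet μ x T)
    (hT : T ∈ crossedKernel μ π) (hx : x ∈ (kernelL2 μ hinv).toSubmodule) :
    (⟨x, hx⟩ : (kernelL2 μ hinv).toSubmodule) ∈ kernelSubspace (μ := μ) hinv :=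
  ⟨T.codRestrict _ fun y => (mem_kernelL2 hinv).2 fun z => hT.2 z y,
    h.codRestrict (ξ := ⟨x, hx⟩) _ _, hT⟩

theorem isComplete_kernelSubspace : IsCompleteSubspace μ B (kernelSubspace (μ := μ) hinv) :=
  isCompleteSubspace_ketSubmodule _ isClosed_crossedKernel fun _ hX K => crossedKernel_comp_rho hX K

/-- The adjoint of a ket into L²(G,I) is the restriction of the adjoint of the same operator into
L²(G,B). The bra-ket is therefore a product S*T of elements of the crossed product. -/
theorem isRelativelyContinuous_kernelSubspace :
    IsRelativelyContinuous μ B (kernelSubspace (μ := μ) hinv : Set (kernelL2 μ hinv).toSubmodule) := by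
  refine (isRelativelyContinuous_iff (isComplete_kernelSubspace hinv).subset_si).2 ?_
  intro ξ hξ η hη X Y hX hY
  have h1 : (kernelL2 μ hinv).toSubmodule.subtypeL ∘L X ∈ crossedKernel μ π :=
    (mem_ketSubmodule hX).1 hξ
  have h2 : (kernelL2 μ hinv).toSubmodule.subtypeL ∘L Y ∈ crossedKernel μ π :=
    (mem_ketSubmodule hY).1 hη
  obtain ⟨S, hS⟩ := exists_adjPair_of_mem_crossed h1.1
  have h3 : adj B X = S ∘L (kernelL2 μ hinv).toSubmodule.subtypeL :=
    AdjPair.adj_eq fun x y => hS x y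
  rw [h3, ContinuousLinearMap.comp_assoc]
  exact crossed_comp (mem_crossed_of_adjPair hS h1.1) h2.1

/-- Approximate x by xe with e in I, and x by f in C_c(G,B). Then fe is I-valued, so its ket lies in
C*_r(G,I) and hence in the kernel. -/
theorem dense_kernelSubspace : Dense (kernelSubspace (μ := μ) hinv : Set (kernelL2 μ hinv).toSubmodule) := by
  intro x
  refine Metric.mem_closure_iff.2 fun ε hε => ?_
  have hx : inner B (x : L2 μ B) (x : L2 μ B) ∈ homKernel π := (mem_kernelL2 hinv).1 x.2 _
  obtain ⟨e, heI, he, -, hxe⟩ := exists_approxUnit (homKernel π) (isClosed_homKernel π)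
    (isCompact_singleton (x := inner B (x : L2 μ B) (x : L2 μ B)))
    (Set.singleton_subset_iff.2 hx) (show 0 < (ε / 2) ^ 2 / 2 by positivity)
  have h1 : ‖(x : L2 μ B) - (x : L2 μ B) <• e‖ < ε / 2 := by
    refine lt_of_pow_lt_pow_left₀ 2 (by positivity) ?_
    have h2 := norm_sub_act_sq_le (x : L2 μ B) he
    have h3 := hxe _ rfl
    linarith
  obtain ⟨_, ⟨f, rfl⟩, hf⟩ := Metric.mem_closure_iff.1 (denseRange_toL2 μ (x : L2 μ B)) (ε / 2)
    (by positivity)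
  rw [dist_eq_norm] at hf
  have hfe : ∀ g, π (ccAct f e g) = 0 := fun g => by
    change π (f g * e) = 0
    rw [map_mul, mem_homKernel.1 heI, mul_zero]
  have hmem : toL2 μ (ccAct f e) ∈ (kernelL2 μ hinv).toSubmodule := fun y => by
    rw [← toL2_act, HilbertModule.inner_act_right, map_mul, mem_homKernel.1 heI, mul_zero]
  have hker : rho μ (dagger (ccAct f e)) ∈ crossedKernel μ π :=
    crossedIdealSubmodule_le hinv (rho_mem_crossedIdealSubmodule fun g => by
      rw [dagger_apply, hinv, hfe, map_zero])
  refine ⟨_, mem_kernelSubspace_of_isKet hinv (isKet_toL2 (ccAct f e)) hker hmem, ?_⟩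
  rw [dist_eq_norm]
  change ‖(x : L2 μ B) - toL2 μ (ccAct f e)‖ < ε
  have h4 : (x : L2 μ B) - toL2 μ (ccAct f e)
      = ((x : L2 μ B) - (x : L2 μ B) <• e) + ((x : L2 μ B) - toL2 μ f) <• e := by
    rw [← toL2_act, sub_act]; abel
  rw [h4]
  calc _ ≤ ‖(x : L2 μ B) - (x : L2 μ B) <• e‖ + ‖((x : L2 μ B) - toL2 μ f) <• e‖ := norm_add_le _ _
    _ ≤ ‖(x : L2 μ B) - (x : L2 μ B) <• e‖ + ‖(x : L2 μ B) - toL2 μ f‖ * 1 := by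
      gcongr
      exact (norm_act_le _ _).trans (by gcongr)
    _ < ε := by linarith

theorem kernelSubspace_mem_contSubspaces :
    kernelSubspace (μ := μ) hinv ∈ contSubspaces μ B (kernelL2 μ hinv).toSubmodule :=
  ⟨dense_kernelSubspace hinv, isComplete_kernelSubspace hinv,
    isRelativelyContinuous_kernelSubspace hinv⟩

theorem innerIdeal_kernelL2 {b : B} (hb : b ∈ innerIdeal B (kernelL2 μ hinv).toSubmodule) :
    π b = 0 :=
  innerIdeal_induction (E := (kernelL2 μ hinv).toSubmodule) (p := fun b => π b = 0)
    (isClosed_homKernel π) (map_zero π) (fun _ _ ha hb => by rw [map_add, ha, hb, add_zero])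
    (fun _ _ ha => by rw [map_smul, ha, smul_zero])
    (fun x y => (mem_kernelL2 hinv).1 y.2 _) hb

/-- Inner products of L²(G,I) lie in I. Acting by such coefficients, or convolving with such
kernels, moves a ket from C*_r(G,B) into C*_r(G,I). -/
theorem ofCompacts_toCompacts_kernelSubspace_le :
    ofCompacts μ B (toCompacts μ B (kernelSubspace (μ := μ) hinv)) ≤
      ketSubmodule μ B (kernelL2 μ hinv).toSubmodule.subtypeL (crossedIdealSubmodule μ π) := by
  refine ofCompacts_toCompacts_le_of (isComplete_kernelSubspace hinv).subset_si
    (isCompleteSubspace_ketSubmodule _ isClosed_crossedIdealSubmodule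
      fun X hX K => crossedIdealSubmodule_comp_rho hinv hX K) ?_ ?_
  · rintro ξ ⟨X, hX, hXJ⟩ b hb
    refine ⟨_, hX.act b, ?_⟩
    rw [← ContinuousLinearMap.comp_assoc]
    exact comp_mulL2_mem_crossedIdealSubmodule hinv hXJ.1 (innerIdeal_kernelL2 hinv hb)
  · rintro ξ ⟨X, hX, hXJ⟩ K hK
    refine ⟨_, hX.convAct K, ?_⟩
    rw [← ContinuousLinearMap.comp_assoc]
    exact comp_rho_mem_crossedIdealSubmodule hinv hXJ.1 fun g => innerIdeal_kernelL2 hinv (hK g)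

/-- For T in the kernel, T(K†) lies in R and has ket Tρ_K; under the hypothesis this operator
belongs to C*_r(G,I). An approximate unit of all of C*_r(G,B) then gives T itself. -/
theorem crossedKernel_le_of_eq
    (h : ofCompacts μ B (toCompacts μ B (kernelSubspace (μ := μ) hinv)) = kernelSubspace hinv) :
    crossedKernel μ π ≤ crossedIdealSubmodule μ π := by
  intro T hT
  obtain ⟨S, hS⟩ := exists_adjPair_of_mem_crossed hT.1
  have hle := ofCompacts_toCompacts_kernelSubspace_le (μ := μ) hinv
  rw [h] at hle
  have hTK : ∀ K : C_c(G, B), T ∘L rho μ K ∈ crossedIdealSubmodule μ π := fun K => by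
    have hk := (isKet_toL2_dagger (μ := μ) K).map hS (crossed_equivariant hT.1)
    have hmem : T (toL2 μ (dagger K)) ∈ (kernelL2 μ hinv).toSubmodule := fun y => hT.2 y _
    obtain ⟨X, hX, hXI⟩ := hle (mem_kernelSubspace_of_isKet hinv hk
      (crossedKernel_comp_rho hT K) hmem)
    have h1 := hX.unique (hk.codRestrict (ξ := ⟨_, hmem⟩) _
      fun y => (mem_kernelL2 hinv).2 fun z => hT.2 z _)
    rw [h1] at hXI
    exact hXI
  refine isClosed_crossedIdealSubmodule.closure_subset (Metric.mem_closure_iff.2 fun ε hε => ?_)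
  -- Only the operator half of the approximate unit is needed, so the vector is set to 0 and the
  -- ideal is all of `B`.
  obtain ⟨φ, e, -, -, h1, -⟩ := exists_approxUnit_cc (μ := μ) (ξ := (0 : L2 μ B)) (T := T)
    (⊤ : NonUnitalStarSubalgebra ℂ B) isClosed_univ (fun _ _ _ => trivial)
    (by rw [crossedIdeal_top]; exact hT.1) trivial hε
  exact ⟨_, hTK _, by rwa [dist_eq_norm]⟩

theorem ofCompacts_toCompacts_ne (hπ : Function.Surjective π)
    (h : crossedIdeal μ {b : B | π b = 0} ≠ {T | (T, 0) ∈ crossedGraph μ π}) :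
    ofCompacts μ B (toCompacts μ B (kernelSubspace (μ := μ) hinv)) ≠ kernelSubspace hinv := by
  intro heq
  refine h (Set.ext fun T => ?_)
  rw [← mem_crossedIdealSubmodule, Set.mem_ofPred_eq, mem_crossedGraph_zero_iff hπ hinv]
  exact ⟨fun hT => crossedIdealSubmodule_le hinv hT, fun hT => crossedKernel_le_of_eq hinv heq hT⟩

end Nonexact

end SquareIntegrable

theorem mainTheorem6 {G : Type u} [Group G] [TopologicalSpace G] [IsTopologicalGroup G]
    [LocallyCompactSpace G] [T2Space G] [MeasurableSpace G] [BorelSpace G]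
    (μ : Measure G) [μ.IsHaarMeasure] [μ.Regular] :
    (∀ (B E : Type u) [NonUnitalCStarAlgebra B] [CStarAction G B]
      [NormedAddCommGroup E] [NormedSpace ℂ E] [CompleteSpace E] [SMul Bᵐᵒᵖ E]
      [HilbertModule B E] [HilbertAction G B E],
      (∀ R ∈ contSubspaces μ B E,
        toCompacts μ B R ∈ contSubspaces μ (CompactOp B E) (CompactOp B E)) ∧
      (∀ R ∈ contSubspaces μ (CompactOp B E) (CompactOp B E),
        ofCompacts μ B R ∈ contSubspaces μ B E) ∧
      (∀ R ∈ contSubspaces μ (CompactOp B E) (CompactOp B E),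
        toCompacts μ B (ofCompacts μ B R) = R) ∧
      (∀ R ∈ contSubspaces μ B E, ofCompacts μ B (toCompacts μ B R) ≤ R)) ∧
    (IsExactGroup μ →
      ∀ (B E : Type u) [NonUnitalCStarAlgebra B] [CStarAction G B]
        [NormedAddCommGroup E] [NormedSpace ℂ E] [CompleteSpace E] [SMul Bᵐᵒᵖ E]
        [HilbertModule B E] [HilbertAction G B E],
        ∀ R ∈ contSubspaces μ B E, ofCompacts μ B (toCompacts μ B R) = R) ∧
    (¬ IsExactGroup μ →
      ∃ (B E : Type u) (_ : NonUnitalCStarAlgebra B) (_ : CStarAction G B)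
        (_ : NormedAddCommGroup E) (_ : NormedSpace ℂ E) (_ : CompleteSpace E) (_ : SMul Bᵐᵒᵖ E)
        (_ : HilbertModule B E) (_ : HilbertAction G B E),
        ∃ R ∈ contSubspaces μ B E, ofCompacts μ B (toCompacts μ B R) ≠ R) := by
  refine ⟨fun B E _ _ _ _ _ _ _ _ => ⟨fun R hR => ?_, fun R hR => ?_, fun R hR => ?_,
    fun R hR => ?_⟩, fun hG B E _ _ _ _ _ _ _ _ R hR => ?_, fun hG => ?_⟩
  · exact SquareIntegrable.toCompacts_mem_contSubspaces hR
  · exact SquareIntegrable.ofCompacts_mem_contSubspaces hR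
  · exact SquareIntegrable.toCompacts_ofCompacts hR
  · exact SquareIntegrable.ofCompacts_toCompacts_le hR
  · exact SquareIntegrable.ofCompacts_toCompacts_of_exact hG hR
  · simp only [IsExactGroup, not_forall] at hG
    obtain ⟨B, Q, _, _, _, _, π, hπ, hinv, hne⟩ := hG
    exact ⟨B, (SquareIntegrable.kernelL2 μ hinv).toSubmodule, _, _, _, _, inferInstance, _, _, _, _,
      SquareIntegrable.kernelSubspace_mem_contSubspaces hinv,
      SquareIntegrable.ofCompacts_toCompacts_ne hinv hπ hne⟩
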